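/- Let $M$ be a (Hausdorff, finite-dimensional) smooth manifold with a smooth affine connection $\nabla$, with torsion $T(X,Y)=\nabla_XY-\nabla_YX-[X,Y]$ and curvature $R(X,Y)Z=\nabla_X\nabla_YZ-\nabla_Y\nabla_XZ-\nabla_{[X,Y]}Z$. For $P\in M$, $u,v\in T_PM$ and small $|s|$ put $\mathbb T_s(P,u,v)=(\gamma(s),\,v(s),\,-u(s))$, where $\gamma$ is the affinely parametrized geodesic with $\gamma(0)=P$, $\dot\gamma(0)=u$, and $u(s),v(s)$ are the parallel transports of $u,v$ along $\gamma$ to $\gamma(s)$. For a triple $(P_0,u_0,v_0)$, let $P_i(s)\in M$ be the base point of $(\mathbb T_s)^i(P_0,u_0,v_0)$ and $Q_i(s)$ the base point of $(\mathbb T_s^{-1})^i(P_0,u_0,v_0)$. (A) Let $P_0\in M$ and $u,v\in T_{P_0}M$. For all small $|s|$ the iterates $(\mathbb T_s)^i(P_0,u,v)$, $-2\le i\le 4$, are defined, and for every smooth function $f$ on a neighbourhood of $P_0$ with values in $\mathbb R$ or in a finite-dimensional real vector space, $$\lim_{s\to0}\frac{f(P_4(s))-f(P_0)}{s^2}=\lim_{s\to0}\frac{f(P_2(s))-f(Q_2(s))}{s^2}=-T(u,v)(f).$$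 If $T\equiv0$ on $M$, then $$\lim_{s\to0}\frac{f(P_4(s))-f(P_0)}{s^3}=\lim_{s\to0}\frac{f(Q_2(s))-f(P_2(s))}{s^3}=\tfrac12\big(R(u,v)(u+v)\big)(f).$$ Here $X(f)$ denotes the derivative of $f$ along the tangent vector $X$. (B) Let $x\in M$, $u_x,v_x\in T_xM$ and let $f$ be a smooth real function on an open neighbourhood $U$ of $x$. Then there are $a>0$ and an open neighbourhood $W$ of $(x,u_x,v_x)$ in $TM\times_MTM$ such that for $s\in(-a,a)$, $(P_0,u_0,v_0)\in W$ and $-2\le i\le4$ the triples $(\mathbb T_s)^i(P_0,u_0,v_0)$ are defined and unique, have base point in $U$ and depend smoothly on $(s,P_0,u_0,v_0)$, and such that in the ring $C^\infty((-a,a)\times W)$, with $(s^n)$ the principal ideal generated by $s^n$: 1. $f(P_2(s))-f(Q_2(s))\equiv -s^2\,T(u_0,v_0)(f) \pmod{(s^3)}$; 2. $f(P_4(s))-f(P_0)\equiv -s^2\,T(u_0,v_0)(f) \pmod{(s^3)}$; and, if $T\equiv0$ on $M$, 3. $f(Q_2(s))-f(P_2(s))\equiv \tfrac12 s^3\,\big(R(u_0,v_0)(u_0+v_0)\big)(f)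 \pmod{(s^4)}$; 4. $f(P_4(s))-f(P_0)\equiv \tfrac12 s^3\,\big(R(u_0,v_0)(u_0+v_0)\big)(f) \pmod{(s^4)}$. -/

import Mathlib

open Set Filter Topology Bundle
open scoped Manifold ContDiff

noncomputable section

namespace GeodesicGap

variable {E : Type*} [NormedAddCommGroup E] [NormedSpace ℝ E]
  {M : Type*} [TopologicalSpace M] [ChartedSpace E M]

/-- The derivative `X(f)` of a function `f : M → F` along the tangent vector `X` at `x`. -/
def dirDeriv {F : Type*} [NormedAddCommGroup F] [NormedSpace ℝ F]
    (f : M → F) (x : M) (X : TangentSpace 𝓘(ℝ, E) x) : F :=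
  mvfderiv 𝓘(ℝ, E) f x X

/-- The velocity `dγ/dt (t)` of a curve in `M`. -/
def velocity (γ : ℝ → M) (t : ℝ) : TangentSpace 𝓘(ℝ, E) (γ t) :=
  mfderiv 𝓘(ℝ, ℝ) 𝓘(ℝ, E) γ t (1 : ℝ)

section Connection

variable [IsManifold 𝓘(ℝ, E) ∞ M]

/-- `R(X, Y)Z = ∇_X ∇_Y Z - ∇_Y ∇_X Z - ∇_[X,Y] Z` for vector fields, at the point `x`.
Mathlib writes `cov Z x (X x)` for `(∇_X Z)(x)`. -/
def curvatureField (cov : CovariantDerivative 𝓘(ℝ, E) E (TangentSpace 𝓘(ℝ, E) : M → Type _))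
    (X Y Z : Π x : M, TangentSpace 𝓘(ℝ, E) x) (x : M) : TangentSpace 𝓘(ℝ, E) x :=
  cov (fun y ↦ cov Z y (Y y)) x (X x) - cov (fun y ↦ cov Z y (X y)) x (Y x)
    - cov Z x (VectorField.mlieBracket 𝓘(ℝ, E) X Y x)

/-- The curvature tensor `R(u, v)w` at `x`: the value at `x` of `R(X, Y)Z` for vector fields
`X, Y, Z` with values `u, v, w` at `x` and smooth near `x`; here the fields with constant
coefficients in the preferred chart at `x` are used (the value does not depend on this choice). -/
def curvature (cov : CovariantDerivative 𝓘(ℝ, E) E (TangentSpace 𝓘(ℝ, E) : M → Type _))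
    (x : M) (u v w : TangentSpace 𝓘(ℝ, E) x) : TangentSpace 𝓘(ℝ, E) x :=
  curvatureField cov (FiberBundle.extend E u) (FiberBundle.extend E v) (FiberBundle.extend E w) x

/-- The covariant derivative `∇_{γ'} V` at time `t` of a vector field `V` along a curve `γ`,
in the preferred chart at `γ t`: the derivative of the components of `V` (the first summand)
plus the Christoffel term `Γ^i_{jk} V^j (γ')^k ∂_i`, which is the covariant derivative in the
direction `γ'(t)` of the field with the constant components of `V t`. -/
def covDerivAlong (cov : CovariantDerivative 𝓘(ℝ, E) E (TangentSpace 𝓘(ℝ, E) : M → Type _))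
    (γ : ℝ → M) (V : Π t : ℝ, TangentSpace 𝓘(ℝ, E) (γ t)) (t : ℝ) :
    TangentSpace 𝓘(ℝ, E) (γ t) :=
  let e := trivializationAt E (TangentSpace 𝓘(ℝ, E) : M → Type _) (γ t)
  e.symm (γ t) (deriv (fun τ : ℝ ↦ (e ⟨γ τ, V τ⟩).2) t)
    + cov (FiberBundle.extend E (V t)) (γ t) (velocity γ t)

/-- `V` is a smooth vector field along `γ` on `J` that is parallel: `∇_{γ'} V = 0`. -/
def IsParallelOn (cov : CovariantDerivative 𝓘(ℝ, E) E (TangentSpace 𝓘(ℝ, E) : M → Type _))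
    (γ : ℝ → M) (V : Π t : ℝ, TangentSpace 𝓘(ℝ, E) (γ t)) (J : Set ℝ) : Prop :=
  ContMDiffOn 𝓘(ℝ, ℝ) (𝓘(ℝ, E).prod 𝓘(ℝ, E)) ∞
    (fun t ↦ (⟨γ t, V t⟩ : TotalSpace E (TangentSpace 𝓘(ℝ, E) : M → Type _))) J ∧
  ∀ t ∈ J, covDerivAlong cov γ V t = 0

/-- `γ` is an affinely parametrized geodesic on `J`: smooth, with parallel velocity. -/
def IsGeodesicOn (cov : CovariantDerivative 𝓘(ℝ, E) E (TangentSpace 𝓘(ℝ, E) : M → Type _))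
    (γ : ℝ → M) (J : Set ℝ) : Prop :=
  ContMDiffOn 𝓘(ℝ, ℝ) 𝓘(ℝ, E) ∞ γ J ∧ IsParallelOn cov γ (velocity γ) J

variable (E M) in
/-- The manifold `TM ×_M TM` of triples `(P, u, v)` with `P ∈ M` and `u, v ∈ T_P M`. -/
abbrev Triple : Type _ :=
  TotalSpace (E × E)
    ((TangentSpace 𝓘(ℝ, E) : M → Type _) ×ᵇ (TangentSpace 𝓘(ℝ, E) : M → Type _))

/-- `IsTurn cov s p q` says that `𝕋_s p` is defined and equal to `q`: for `p = (P, u, v)` there is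
a geodesic `γ` on an open interval containing `0` and `s`, with `γ 0 = P` and `γ' 0 = u`, and
`q = (γ s, v s, -u s)`, where `u t`, `v t` are the parallel transports of `u`, `v` along `γ`. -/
def IsTurn (cov : CovariantDerivative 𝓘(ℝ, E) E (TangentSpace 𝓘(ℝ, E) : M → Type _))
    (s : ℝ) (p q : Triple E M) : Prop :=
  ∃ (J : Set ℝ) (γ : ℝ → M) (u v : Π t : ℝ, TangentSpace 𝓘(ℝ, E) (γ t)),
    IsOpen J ∧ J.OrdConnected ∧ 0 ∈ J ∧ s ∈ J ∧
    IsGeodesicOn cov γ J ∧ velocity γ 0 = u 0 ∧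
    IsParallelOn cov γ u J ∧ IsParallelOn cov γ v J ∧
    p = ⟨γ 0, (u 0, v 0)⟩ ∧ q = ⟨γ s, (v s, -u s)⟩

/-- `c i = (𝕋_s)^i p` for `-2 ≤ i ≤ 4`, all these iterates being defined. With `P_i = (c i).proj`
and `Q_i = (c (-i)).proj` these are the two geodesic quadrilaterals
`P_0, P_1, P_2, P_3, P_4` and `Q_2, Q_1, P_0, P_1, P_2`. -/
def IsTurnOrbit (cov : CovariantDerivative 𝓘(ℝ, E) E (TangentSpace 𝓘(ℝ, E) : M → Type _))
    (s : ℝ) (p : Triple E M) (c : ℤ → Triple E M) : Prop :=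
  c 0 = p ∧ ∀ i : ℤ, -2 ≤ i → i < 4 → IsTurn cov s (c i) (c (i + 1))

/-- `h₁ = h₂ mod (s ^ k)` in the ring of smooth functions of `(s, p)` on the open set
`D ⊆ ℝ × (TM ×_M TM)`. -/
def CongrMod (k : ℕ) (D : Set (ℝ × Triple E M)) (h₁ h₂ : ℝ × Triple E M → ℝ) : Prop :=
  ContMDiffOn (𝓘(ℝ, ℝ).prod (𝓘(ℝ, E).prod 𝓘(ℝ, E × E))) 𝓘(ℝ, ℝ) ∞ h₁ D ∧
  ContMDiffOn (𝓘(ℝ, ℝ).prod (𝓘(ℝ, E).prod 𝓘(ℝ, E × E))) 𝓘(ℝ, ℝ) ∞ h₂ D ∧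
  ∃ g : ℝ × Triple E M → ℝ,
    ContMDiffOn (𝓘(ℝ, ℝ).prod (𝓘(ℝ, E).prod 𝓘(ℝ, E × E))) 𝓘(ℝ, ℝ) ∞ g D ∧
    ∀ z ∈ D, h₁ z - h₂ z = z.1 ^ k * g z

end Connection

end GeodesicGap

end

/-! Work in a chart, with Christoffel map `Γ`: the first slot of `Γ x` takes the differentiated
field, the second the direction, so that `T(u, v) = Γ(v, u) - Γ(u, v)`. The point `P₂` is reached
from `P₀` by following `u` for time `s` and then the transported `v`. Unwinding `𝕋_s⁻¹`, the point
`Q₂` is reached by following `v` first and then the transported `u`. Thus `Q₂` is `P₂` with `u` and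
`v` interchanged, and `P₂ - Q₂` is the antisymmetrization in `(u, v)` of the Taylor expansion of a
two-step endpoint (`exists_two_step_taylor`, `exists_gap_taylor`). The term `s(u + v)` cancels,
order two leaves `Γ(u, v) - Γ(v, u) = -T(u, v)`, and if `Γ` is symmetric, order three leaves `-½
R(u, v)(u + v)` (`twoStepThird_sub_swapVec`).

The other quadrilateral is the same one seen from its middle vertex: for the triple `𝕋_s² p` the
points `P₂`, `Q₂` are the `P₄`, `P₀` of `p`. At `s = 0` this triple is `(P₀, -u, -v)`. The torsion
term is even under this sign change and the curvature term is odd, which explains why only the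
latter changes sign. Replacing the moving triple by its value at `s = 0` costs one more factor `s`
(`exists_shifted_congruence`).

Congruences modulo `(sᵏ)` need remainders that are smooth in `(s, p)` jointly. Two tools provide
them. The flow of a smooth vector field is jointly smooth, by the implicit function theorem for its
integral equation in `C([0, 1], X)` (`exists_local_flow`). Hadamard's lemma writes a remainder as an
explicit integral of smooth data (`exists_pow_smul_of_hasDerivAt`). Both rest on the smoothness of
the superposition operator `α ↦ F ∘ α` (`contDiffOn_superpose`). The passage from points to values
of `f` uses a smooth difference quotient (`exists_difference_quotient`).

On the manifold, the connection minus the flat connection of a chart is a tensor, namely `Γ`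
(`exists_isChristoffel`). Geodesics with parallel fields are the integral curves of `spray Γ`, and
uniqueness for this equation makes every orbit of turns the one computed in the chart. The limits
follow from the congruences for a fixed triple, a vector-valued `f` being tested against linear
functionals. -/

open Set Filter Topology Bundle
open scoped Manifold ContDiff

noncomputable section

namespace GeodesicGap

/-! ### Smoothness of superposition operators on spaces of continuous functions. -/

section Nemytskii

universe u

/-- The superposition operator `α ↦ F ∘ α` on continuous functions, with the value `0` where
`F ∘ α` is not continuous. -/
def superpose {K X Y : Type*} [TopologicalSpace K] [TopologicalSpace X] [TopologicalSpace Y]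
    [Zero Y] (F : X → Y) (α : C(K, X)) : C(K, Y) :=
  open Classical in if h : Continuous (F ∘ α) then ⟨F ∘ α, h⟩ else 0

lemma superpose_apply {K X Y : Type*} [TopologicalSpace K] [TopologicalSpace X]
    [TopologicalSpace Y] [Zero Y] {F : X → Y} {s : Set X} (hF : ContinuousOn F s) {α : C(K, X)}
    (hα : ∀ k, α k ∈ s) (k : K) : superpose F α k = F (α k) := by
  have h : Continuous (F ∘ α) := hF.comp_continuous α.continuous hα
  simp [superpose, h]

variable {K : Type*} [TopologicalSpace K] [CompactSpace K]

/-- The pointwise action of a continuous bilinear map on continuous functions. -/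
def pointwise (K : Type*) [TopologicalSpace K] [CompactSpace K] {V X Y : Type*}
    [NormedAddCommGroup V] [NormedSpace ℝ V] [NormedAddCommGroup X] [NormedSpace ℝ X]
    [NormedAddCommGroup Y] [NormedSpace ℝ Y] (B : V →L[ℝ] X →L[ℝ] Y) :
    C(K, V) →L[ℝ] C(K, X) →L[ℝ] C(K, Y) :=
  LinearMap.mkContinuous₂
    (LinearMap.mk₂ ℝ (fun (A : C(K, V)) (h : C(K, X)) ↦
      (⟨fun k ↦ B (A k) (h k), (B.continuous.comp A.continuous).clm_apply h.continuous⟩ : C(K, Y)))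
      (fun _ _ _ ↦ by ext; simp) (fun _ _ _ ↦ by ext; simp)
      (fun _ _ _ ↦ by ext; simp) (fun _ _ _ ↦ by ext; simp)) ‖B‖
    (fun A h ↦ by
      rw [ContinuousMap.norm_le _ (by positivity)]
      refine fun k ↦ (B.le_opNorm₂ _ _).trans ?_
      gcongr
      exacts [A.norm_coe_le_norm k, h.norm_coe_le_norm k])

section

variable {V X Y : Type*} [NormedAddCommGroup V] [NormedSpace ℝ V] [NormedAddCommGroup X]
  [NormedSpace ℝ X] [NormedAddCommGroup Y] [NormedSpace ℝ Y] (B : V →L[ℝ] X →L[ℝ] Y)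

@[simp] lemma pointwise_apply (A : C(K, V)) (h : C(K, X)) (k : K) :
    pointwise K B A h k = B (A k) (h k) := rfl

lemma contDiff_pointwise {n : ℕ∞ω} : ContDiff ℝ n (pointwise K B) :=
  (pointwise K B).contDiff

end

lemma isOpen_forall_mem {X : Type*} [TopologicalSpace X] {s : Set X} (hs : IsOpen s) :
    IsOpen {α : C(K, X) | ∀ k, α k ∈ s} := by
  have := ContinuousMap.isOpen_setOfPred_mapsTo (X := K) isCompact_univ hs
  simpa [MapsTo] using this

/-- The range of `α` is compact, so one `δ` serves for the continuity of the derivative of `F` at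
all points `α k`, and one radius keeps all the balls inside `s`. The mean value inequality on these
balls then bounds the error uniformly in `k`. -/
lemma hasFDerivAt_superpose {X Y : Type*} [NormedAddCommGroup X] [NormedSpace ℝ X]
    [NormedAddCommGroup Y] [NormedSpace ℝ Y] {F : X → Y} {s : Set X} (hs : IsOpen s)
    (hF : ContDiffOn ℝ 1 F s) {α : C(K, X)} (hα : ∀ k, α k ∈ s) :
    HasFDerivAt (superpose F : C(K, X) → C(K, Y))
      (pointwise K (.id ℝ (X →L[ℝ] Y)) (superpose (fderiv ℝ F) α)) α := by
  have hF' : ContinuousOn (fderiv ℝ F) s := hF.continuousOn_fderiv_of_isOpen hs le_rfl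
  have hd : ∀ x ∈ s, DifferentiableAt ℝ F x := fun x hx ↦
    (hF.differentiableOn one_ne_zero).differentiableAt (hs.mem_nhds hx)
  rw [hasFDerivAt_iff_isLittleO, Asymptotics.isLittleO_iff]
  intro ε hε
  have hcpt : IsCompact (range α) := isCompact_range α.continuous
  have h1 := hcpt.uniformContinuousAt_of_continuousAt (fderiv ℝ F)
    (by rintro _ ⟨k, rfl⟩; exact hF'.continuousAt (hs.mem_nhds (hα k)))
    (Metric.dist_mem_uniformity hε)
  obtain ⟨δ₁, hδ₁, h1⟩ := Metric.mem_uniformity_dist.1 h1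
  obtain ⟨δ₂, hδ₂, h2⟩ := hcpt.exists_thickening_subset_open hs (by rintro _ ⟨k, rfl⟩; exact hα k)
  have hball : ∀ k, Metric.ball (α k) (min δ₁ δ₂) ⊆ s := fun k y hy ↦
    h2 (Metric.mem_thickening_iff.2 ⟨α k, mem_range_self k, (lt_min_iff.1 hy).2⟩)
  filter_upwards [Metric.ball_mem_nhds α (lt_min hδ₁ hδ₂)] with β hβ
  have hβk : ∀ k, β k ∈ Metric.ball (α k) (min δ₁ δ₂) := fun k ↦
    (ContinuousMap.dist_apply_le_dist k).trans_lt hβ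
  rw [ContinuousMap.norm_le _ (by positivity)]
  intro k
  have h3 : ‖F (β k) - F (α k) - fderiv ℝ F (α k) (β k - α k)‖ ≤ ε * ‖β k - α k‖ := by
    refine Convex.norm_image_sub_le_of_norm_fderiv_le' (s := Metric.ball (α k) (min δ₁ δ₂))
      (fun x hx ↦ hd x (hball k hx)) (fun x hx ↦ ?_) (convex_ball _ _)
      (Metric.mem_ball_self (lt_min hδ₁ hδ₂)) (hβk k)
    have := h1 (a := α k) (b := x) (by rw [dist_comm]; exact (lt_min_iff.1 hx).1)
      (mem_range_self k)
    rw [← dist_eq_norm, dist_comm]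
    exact this.le
  have e1 : superpose F β k = F (β k) :=
    superpose_apply (hF.continuousOn) (fun k ↦ hball k (hβk k)) k
  simp only [ContinuousMap.sub_apply, e1, superpose_apply hF.continuousOn hα,
    pointwise_apply, ContinuousLinearMap.id_apply, superpose_apply hF' hα]
  exact h3.trans (mul_le_mul_of_nonneg_left ((β - α).norm_coe_le_norm k) hε.le)

/-- By `hasFDerivAt_superpose` the derivative is again a superposition operator, that of `fderiv ℝ
F`, followed by a continuous linear map; so the order of smoothness goes up by induction. The target
changes from `Y` to `X →L[ℝ] Y` along the induction, hence the common universe of `X` and `Y`. -/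
theorem contDiffOn_superpose {X : Type u} {Y : Type u} [NormedAddCommGroup X] [NormedSpace ℝ X]
    [NormedAddCommGroup Y] [NormedSpace ℝ Y] {F : X → Y} {s : Set X} (hs : IsOpen s)
    (hF : ContDiffOn ℝ ∞ F s) :
    ContDiffOn ℝ ∞ (superpose F : C(K, X) → C(K, Y)) {α | ∀ k, α k ∈ s} := by
  rw [contDiffOn_infty]
  intro n
  induction n generalizing Y with
  | zero =>
    rw [Nat.cast_zero, contDiffOn_zero]
    exact fun α hα ↦
      (hasFDerivAt_superpose hs (hF.of_le (by simp)) hα).continuousAt.continuousWithinAt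
  | succ n ih =>
    rw [Nat.cast_add, Nat.cast_one, contDiffOn_succ_iff_fderiv_of_isOpen (isOpen_forall_mem hs)]
    have hd := fun (α : C(K, X)) (hα : ∀ k, α k ∈ s) ↦
      hasFDerivAt_superpose hs (hF.of_le (by simp)) hα
    refine ⟨fun α hα ↦ (hd α hα).differentiableAt.differentiableWithinAt, by simp, ?_⟩
    have hF' : ContDiffOn ℝ ∞ (fderiv ℝ F) s := hF.fderiv_of_isOpen hs (by simp)
    exact ((contDiff_pointwise (.id ℝ (X →L[ℝ] Y))).comp_contDiffOn (ih hF')).congr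
      fun α hα ↦ (hd α hα).fderiv

end Nemytskii

/-! ### Integral operators on `C([0, 1], X)`. -/

section Integral

variable {X : Type*} [NormedAddCommGroup X] [NormedSpace ℝ X]

/-- The Volterra operator `α ↦ (t ↦ ∫₀ᵗ α)` on `C([0, 1], X)`. -/
def volterra (X : Type*) [NormedAddCommGroup X] [NormedSpace ℝ X] :
    C(unitInterval, X) →L[ℝ] C(unitInterval, X) :=
  LinearMap.mkContinuous
    { toFun := fun α ↦ ⟨fun t ↦ ∫ σ in (0 : ℝ)..t, IccExtend zero_le_one α σ,
        (intervalIntegral.continuous_primitive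
          (fun _ _ ↦ (α.continuous.Icc_extend').intervalIntegrable _ _) 0).comp
          continuous_subtype_val⟩
      map_add' := fun α β ↦ by
        ext t
        simp only [ContinuousMap.coe_mk, ContinuousMap.add_apply]
        rw [← intervalIntegral.integral_add]
        · rfl
        · exact (α.continuous.Icc_extend').intervalIntegrable _ _
        · exact (β.continuous.Icc_extend').intervalIntegrable _ _
      map_smul' := fun c α ↦ by
        ext t
        simp only [ContinuousMap.coe_mk, ContinuousMap.smul_apply, RingHom.id_apply]
        rw [← intervalIntegral.integral_smul]
        rfl } 1
    (fun α ↦ by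
      rw [one_mul, ContinuousMap.norm_le _ (norm_nonneg _)]
      intro t
      refine (intervalIntegral.norm_integral_le_of_norm_le_const (C := ‖α‖)
        (fun σ _ ↦ α.norm_coe_le_norm _)).trans ?_
      rw [sub_zero, abs_of_nonneg t.2.1]
      exact mul_le_of_le_one_right (norm_nonneg _) t.2.2)

lemma volterra_apply (α : C(unitInterval, X)) (t : unitInterval) :
    volterra X α t = ∫ σ in (0 : ℝ)..t, IccExtend zero_le_one α σ := rfl

/-- The moment `α ↦ ∫₀¹ σᵏ α(σ) dσ`. -/
def moment (X : Type*) [NormedAddCommGroup X] [NormedSpace ℝ X] (k : ℕ) :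
    C(unitInterval, X) →L[ℝ] X :=
  LinearMap.mkContinuous
    { toFun := fun α ↦ ∫ σ in (0 : ℝ)..1, σ ^ k • IccExtend zero_le_one α σ
      map_add' := fun α β ↦ by
        rw [← intervalIntegral.integral_add]
        · simp only [← smul_add]; rfl
        · exact ((continuous_pow k).smul α.continuous.Icc_extend').intervalIntegrable _ _
        · exact ((continuous_pow k).smul β.continuous.Icc_extend').intervalIntegrable _ _
      map_smul' := fun c α ↦ by
        rw [RingHom.id_apply, ← intervalIntegral.integral_smul]
        congr 1
        ext σ
        rw [smul_comm]; rfl } 1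
    (fun α ↦ by
      rw [one_mul]
      refine (intervalIntegral.norm_integral_le_of_norm_le_const (C := ‖α‖)
        (fun σ hσ ↦ ?_)).trans (by simp)
      rw [uIoc_of_le zero_le_one] at hσ
      rw [norm_smul, norm_pow, Real.norm_of_nonneg hσ.1.le]
      exact (mul_le_of_le_one_left (norm_nonneg _) (pow_le_one₀ hσ.1.le hσ.2)).trans
        (α.norm_coe_le_norm _))

lemma moment_apply (k : ℕ) (α : C(unitInterval, X)) :
    moment X k α = ∫ σ in (0 : ℝ)..1, σ ^ k • IccExtend zero_le_one α σ := rfl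

end Integral

/-! ### Implicit functions and smooth local flows. -/

/-- The implicit function theorem, with smoothness on a whole neighbourhood. -/
theorem exists_implicit {E₁ E₂ F : Type*} [NormedAddCommGroup E₁] [NormedSpace ℝ E₁]
    [CompleteSpace E₁] [NormedAddCommGroup E₂] [NormedSpace ℝ E₂] [CompleteSpace E₂]
    [NormedAddCommGroup F] [NormedSpace ℝ F] [CompleteSpace F]
    {f : E₁ × E₂ → F} {O : Set (E₁ × E₂)} (hO : IsOpen O) (hf : ContDiffOn ℝ ∞ f O)
    {u : E₁ × E₂} (hu : u ∈ O) (h0 : f u = 0)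
    (hinv : (fderiv ℝ f u ∘L .inr ℝ E₁ E₂).IsInvertible) :
    ∃ g : E₁ → E₂, g u.1 = u.2 ∧
      (∀ᶠ x in 𝓝 u.1, ContDiffAt ℝ ∞ g x ∧ f (x, g x) = 0) ∧
      ∀ᶠ v in 𝓝 u, f v = 0 → g v.1 = v.2 := by
  have hfd : ∀ v ∈ O, ContDiffAt ℝ ∞ f v := fun v hv ↦ hf.contDiffAt (hO.mem_nhds hv)
  have hn : (∞ : ℕ∞ω) ≠ 0 := by simp
  set g := (hfd u hu).implicitFunction hn hinv with hg
  have hgs : ContDiffAt ℝ ∞ g u.1 := (hfd u hu).contDiffAt_implicitFunction hn hinv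
  have hgu : g u.1 = u.2 := (hfd u hu).implicitFunction_apply_self hn hinv
  have hg0 : ∀ᶠ x in 𝓝 u.1, f (x, g x) = f u := (hfd u hu).eventually_apply_implicitFunction hn hinv
  have hiff := (hfd u hu).eventually_apply_eq_iff_implicitFunction hn hinv
  refine ⟨g, hgu, ?_, hiff.mono fun v hv h ↦ hv.1 (h.trans h0.symm)⟩
  have hgc : ∀ᶠ x in 𝓝 u.1, ContinuousAt g x := by
    have := (hgs.of_le (m := 1) (by simp)).eventually (by simp)
    exact this.mono fun x hx ↦ hx.continuousAt
  have hpc : ContinuousAt (fun x ↦ (x, g x)) u.1 := continuousAt_id.prodMk hgs.continuousAt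
  have hpc' : Tendsto (fun x ↦ (x, g x)) (𝓝 u.1) (𝓝 u) := by
    have := hpc.tendsto; rwa [hgu] at this
  -- Invertible operators form an open set, so the partial derivative stays invertible near `u`.
  have hinv' : ∀ᶠ v in 𝓝 u, (fderiv ℝ f v ∘L .inr ℝ E₁ E₂).IsInvertible := by
    have hcont : ContinuousAt (fun v ↦ fderiv ℝ f v ∘L .inr ℝ E₁ E₂) u := by
      have h1 : ContinuousAt (fderiv ℝ f) u :=
        (hf.continuousOn_fderiv_of_isOpen hO (by simp)).continuousAt (hO.mem_nhds hu)
      exact h1.clm_comp continuousAt_const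
    obtain ⟨e, he⟩ := hinv
    have h2 := e.nhds
    rw [he] at h2
    exact (hcont.eventually h2).mono fun v ⟨e', he'⟩ ↦ ⟨e', he'⟩
  filter_upwards [hgc, hg0, hpc'.eventually hinv', hpc'.eventually (hO.mem_nhds hu),
    hg0.eventually_nhds] with x hx1 hx2 hx3 hx4 hx5
  refine ⟨?_, hx2.trans h0⟩
  -- Smoothness of order `∞` at `u.1` alone gives no neighbourhood common to all finite orders. The
  -- theorem is therefore applied afresh at `(x, g x)`; local uniqueness identifies the new implicit
  -- function with `g` near `x`.
  have hs := (hfd _ hx4).contDiffAt_implicitFunction hn hx3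
  refine hs.congr_of_eventuallyEq ?_
  have hiff' := (hfd _ hx4).eventually_apply_eq_iff_implicitFunction hn hx3
  have hpx : Tendsto (fun y ↦ (y, g y)) (𝓝 x) (𝓝 (x, g x)) :=
    (continuousAt_id.prodMk hx1 : ContinuousAt (fun y ↦ (y, g y)) x)
  filter_upwards [hpx.eventually hiff', hx5] with y hy1 hy2
  exact (hy1.1 (hy2.trans hx2.symm)).symm

/-- Constant functions, as a continuous linear map. -/
def constCLM (K : Type*) [TopologicalSpace K] [CompactSpace K] (X : Type*) [NormedAddCommGroup X]
    [NormedSpace ℝ X] : X →L[ℝ] C(K, X) :=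
  LinearMap.mkContinuous
    { toFun := fun x ↦ ContinuousMap.const K x
      map_add' := fun _ _ ↦ rfl
      map_smul' := fun _ _ ↦ rfl } 1
    (fun x ↦ by
      rw [one_mul, ContinuousMap.norm_le _ (norm_nonneg _)]
      exact fun _ ↦ le_rfl)

/-- Evaluation of continuous functions at a point, as a continuous linear map. -/
def evalCLM {K : Type*} [TopologicalSpace K] [CompactSpace K] (X : Type*) [NormedAddCommGroup X]
    [NormedSpace ℝ X] (k : K) : C(K, X) →L[ℝ] X :=
  LinearMap.mkContinuous
    { toFun := fun α ↦ α k
      map_add' := fun _ _ ↦ rfl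
      map_smul' := fun _ _ ↦ rfl } 1
    (fun α ↦ by simpa using α.norm_coe_le_norm k)

/-- A smooth vector field has a smooth local flow. -/
theorem exists_local_flow {X : Type*} [NormedAddCommGroup X] [NormedSpace ℝ X] [CompleteSpace X]
    {A : X → X} {s : Set X} (hs : IsOpen s) (hA : ContDiffOn ℝ ∞ A s) {z₀ : X} (hz₀ : z₀ ∈ s) :
    ∃ (a : ℝ) (N : Set X) (ψ : ℝ → X → X), 0 < a ∧ IsOpen N ∧ z₀ ∈ N ∧
      ContDiffOn ℝ ∞ (fun p : ℝ × X ↦ ψ p.1 p.2) (Ioo (-a) a ×ˢ N) ∧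
      (∀ z ∈ N, ψ 0 z = z) ∧
      ∀ t ∈ Ioo (-a) a, ∀ z ∈ N, ψ t z ∈ s ∧ HasDerivAt (fun τ ↦ ψ τ z) (A (ψ t z)) t := by
  let I := unitInterval
  -- The zeros of `f` are the curves `α(τ) = z + t ∫₀^τ A(α)`, that is, solutions run at speed `t`
  -- on the fixed interval `[0, 1]`; time has become a parameter.
  let f : (ℝ × X) × C(I, X) → C(I, X) := fun v ↦
    v.2 - constCLM I X v.1.2 - v.1.1 • volterra X (superpose A v.2)
  let O : Set ((ℝ × X) × C(I, X)) := Prod.snd ⁻¹' {α | ∀ k, α k ∈ s}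
  have hO : IsOpen O := (isOpen_forall_mem hs).preimage continuous_snd
  have hsup : ContDiffOn ℝ ∞ (superpose A : C(I, X) → C(I, X)) {α | ∀ k, α k ∈ s} :=
    contDiffOn_superpose hs hA
  have hf : ContDiffOn ℝ ∞ f O := by
    have h1 : ContDiffOn ℝ ∞ (fun v : (ℝ × X) × C(I, X) ↦ superpose A v.2) O :=
      hsup.comp contDiff_snd.contDiffOn fun v hv ↦ hv
    have h2 : ContDiffOn ℝ ∞ (fun v : (ℝ × X) × C(I, X) ↦ volterra X (superpose A v.2)) O :=
      (volterra X).contDiff.comp_contDiffOn h1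
    have h3 : ContDiff ℝ ∞ (fun v : (ℝ × X) × C(I, X) ↦ constCLM I X v.1.2) :=
      (constCLM I X).contDiff.comp (contDiff_snd.comp contDiff_fst)
    exact (contDiff_snd.contDiffOn.sub h3.contDiffOn).sub
      ((contDiff_fst.comp contDiff_fst).contDiffOn.smul h2)
  have hfv : ∀ v ∈ O, ∀ τ : I, f v τ =
      v.2 τ - (v.1.2 + v.1.1 • ∫ σ in (0 : ℝ)..τ, A (IccExtend zero_le_one v.2 σ)) := by
    intro v hv τ
    change v.2 τ - v.1.2 - v.1.1 • volterra X (superpose A v.2) τ = _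
    rw [sub_sub, volterra_apply]
    congr 4
    funext σ
    exact superpose_apply hA.continuousOn hv _
  let u : (ℝ × X) × C(I, X) := ((0, z₀), constCLM I X z₀)
  have hu : u ∈ O := fun k ↦ hz₀
  have h0 : f u = 0 := by simp [f, u]
  -- At `t = 0` the integral term disappears and `f` is a translation in `α`, so its partial
  -- derivative is the identity.
  have hinv : (fderiv ℝ f u ∘L .inr ℝ (ℝ × X) C(I, X)).IsInvertible := by
    have h1 : HasFDerivAt f (fderiv ℝ f u) u :=
      ((hf.contDiffAt (hO.mem_nhds hu)).differentiableAt (by simp)).hasFDerivAt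
    have h2 : HasFDerivAt (fun α : C(I, X) ↦ (((0, z₀) : ℝ × X), α))
        (.inr ℝ (ℝ × X) C(I, X)) (constCLM I X z₀) := hasFDerivAt_prodMk_right _ _
    have h3 := HasFDerivAt.comp (constCLM I X z₀) (f := fun α ↦ (((0, z₀) : ℝ × X), α)) h1 h2
    have h4 : HasFDerivAt (f ∘ fun α ↦ (((0, z₀) : ℝ × X), α)) (.id ℝ C(I, X))
        (constCLM I X z₀) := by
      have : (f ∘ fun α ↦ (((0, z₀) : ℝ × X), α)) = fun α ↦ α - constCLM I X z₀ := by
        funext α; simp [f]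
      rw [this]
      exact (hasFDerivAt_id _).sub_const _
    rw [h3.unique h4]
    exact ⟨.refl ℝ _, rfl⟩
  obtain ⟨g, hgu, hg, huniq⟩ := exists_implicit hO hf hu h0 hinv
  have hgc : ContinuousAt g ((0, z₀) : ℝ × X) := hg.self_of_nhds.1.continuousAt
  obtain ⟨r, hr, hball⟩ := Metric.eventually_nhds_iff_ball.1 (huniq.and (hO.mem_nhds hu))
  have hgr : ∀ᶠ x in 𝓝 ((0, z₀) : ℝ × X), g x ∈ Metric.ball (constCLM I X z₀) r := by
    have := hgc.eventually_mem (Metric.ball_mem_nhds _ hr)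
    rwa [show g (0, z₀) = constCLM I X z₀ from hgu] at this
  obtain ⟨ε, hε, hB⟩ := Metric.eventually_nhds_iff_ball.1 (hg.and hgr)
  set a := min ε r
  have ha : 0 < a := lt_min hε hr
  have hmem : ∀ t ∈ Ioo (-a) a, ∀ z ∈ Metric.ball z₀ a, ((t, z) : ℝ × X) ∈
      Metric.ball ((0, z₀) : ℝ × X) ε := by
    intro t ht z hz
    rw [Metric.mem_ball, Prod.dist_eq, max_lt_iff, dist_zero_right, Real.norm_eq_abs, abs_lt]
    exact ⟨⟨by linarith [ht.1, min_le_left ε r], by linarith [ht.2, min_le_left ε r]⟩,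
      (Metric.mem_ball.1 hz).trans_le (min_le_left _ _)⟩
  have hsol : ∀ t ∈ Ioo (-a) a, ∀ z ∈ Metric.ball z₀ a, ∀ τ : I, g (t, z) τ ∈ s ∧
      g (t, z) τ = z + t • ∫ σ in (0 : ℝ)..τ, A (IccExtend zero_le_one (g (t, z)) σ) := by
    intro t ht z hz τ
    obtain ⟨⟨-, h1⟩, h2⟩ := hB _ (hmem t ht z hz)
    have hv : ((t, z), g (t, z)) ∈ Metric.ball u r := by
      rw [Metric.mem_ball, Prod.dist_eq, max_lt_iff]
      refine ⟨?_, h2⟩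
      rw [Prod.dist_eq, max_lt_iff, dist_zero_right, Real.norm_eq_abs, abs_lt]
      exact ⟨⟨by linarith [ht.1, min_le_right ε r], by linarith [ht.2, min_le_right ε r]⟩,
        (Metric.mem_ball.1 hz).trans_le (min_le_right _ _)⟩
    have hs' : ∀ k, g (t, z) k ∈ s := (hball _ hv).2
    refine ⟨hs' τ, ?_⟩
    have h3 := DFunLike.congr_fun h1 τ
    rwa [hfv ((t, z), g (t, z)) hs', ContinuousMap.zero_apply, sub_eq_zero] at h3
  -- The reparametrized curve `k ↦ g (t, z) (τ k)` solves the equation with parameter `τ t` and lies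
  -- in the ball of uniqueness. Hence `t ↦ g (t, z) 1` traces the solution in its true time.
  have hscale : ∀ t ∈ Ioo (-a) a, ∀ z ∈ Metric.ball z₀ a, ∀ τ : I,
      g (τ * t, z) 1 = g (t, z) τ := by
    intro t ht z hz τ
    have hτt : τ * t ∈ Ioo (-a) a := by
      rw [mem_Ioo, ← abs_lt] at ht ⊢
      rw [abs_mul, abs_of_nonneg τ.2.1]
      exact (mul_le_of_le_one_left (abs_nonneg _) τ.2.2).trans_lt ht
    let β : C(I, X) := (g (t, z)).comp ⟨fun k ↦ τ * k, by fun_prop⟩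
    have hβ : g (τ * t, z) = β := by
      have hv : ((τ * t, z), β) ∈ Metric.ball u r := by
        rw [Metric.mem_ball, Prod.dist_eq, max_lt_iff]
        constructor
        · rw [Prod.dist_eq, max_lt_iff, dist_zero_right, Real.norm_eq_abs, abs_lt]
          exact ⟨⟨by linarith [hτt.1, min_le_right ε r], by linarith [hτt.2, min_le_right ε r]⟩,
            (Metric.mem_ball.1 hz).trans_le (min_le_right _ _)⟩
        · refine lt_of_le_of_lt ?_ (hB _ (hmem t ht z hz)).2
          rw [ContinuousMap.dist_le dist_nonneg]
          exact fun k ↦ ContinuousMap.dist_apply_le_dist (f := g (t, z)) (g := constCLM I X z₀)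
            (τ * k)
      refine (hball _ hv).1 ?_
      ext k
      have hβs : ∀ k, β k ∈ s := fun k ↦ (hsol t ht z hz (τ * k)).1
      rw [hfv ((τ * t, z), β) hβs, ContinuousMap.zero_apply, sub_eq_zero]
      have h1 := (hsol t ht z hz (τ * k)).2
      have h2 : (∫ σ in (0 : ℝ)..(τ * k : I), A (IccExtend zero_le_one (g (t, z)) σ)) =
          (τ : ℝ) • ∫ σ in (0 : ℝ)..k, A (IccExtend zero_le_one (g (t, z)) (τ * σ)) := by
        rw [intervalIntegral.smul_integral_comp_mul_left
          (fun σ ↦ A (IccExtend zero_le_one (g (t, z)) σ))]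
        rw [mul_zero]; rfl
      rw [h2, smul_smul, mul_comm t] at h1
      refine h1.trans ?_
      congr 2
      refine intervalIntegral.integral_congr fun σ hσ ↦ ?_
      rw [uIcc_of_le k.2.1] at hσ
      have hσ1 : σ ∈ Icc (0 : ℝ) 1 := ⟨hσ.1, hσ.2.trans k.2.2⟩
      have hσ2 : (τ : ℝ) * σ ∈ Icc (0 : ℝ) 1 := ⟨mul_nonneg τ.2.1 hσ.1,
        mul_le_one₀ τ.2.2 hσ.1 hσ1.2⟩
      simp only [IccExtend_of_mem _ _ hσ1, IccExtend_of_mem _ _ hσ2]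
      rfl
    rw [hβ]
    exact congrArg (g (t, z)) (mul_one τ)
  have hcd : ContDiffOn ℝ ∞ (fun p : ℝ × X ↦ g (p.1, p.2) 1)
      (Ioo (-a) a ×ˢ Metric.ball z₀ a) := by
    intro p hp
    have := (hB _ (hmem p.1 hp.1 p.2 hp.2)).1.1
    exact ((evalCLM X (1 : I)).contDiff.contDiffAt.comp p this).contDiffWithinAt
  have hint : ∀ t ∈ Ioo (-a) a, ∀ z ∈ Metric.ball z₀ a,
      g (t, z) 1 = z + ∫ σ in (0 : ℝ)..t, A (g (σ, z) 1) := by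
    intro t ht z hz
    have h1 := (hsol t ht z hz 1).2
    have h2 := intervalIntegral.smul_integral_comp_mul_right (a := 0) (b := 1)
      (fun σ ↦ A (g (σ, z) 1)) t
    rw [zero_mul, one_mul] at h2
    rw [← h2]
    refine h1.trans ?_
    congr 2
    refine intervalIntegral.integral_congr fun σ hσ ↦ ?_
    rw [uIcc_of_le (by simp)] at hσ
    have hσ1 : σ ∈ Icc (0 : ℝ) 1 := ⟨hσ.1, hσ.2⟩
    simp only [IccExtend_of_mem _ _ hσ1]
    rw [← hscale t ht z hz ⟨σ, hσ1⟩]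
  refine ⟨a, Metric.ball z₀ a, fun t z ↦ g (t, z) 1, ha, Metric.isOpen_ball,
    Metric.mem_ball_self ha, hcd, fun z hz ↦ ?_, fun t ht z hz ↦ ⟨(hsol t ht z hz 1).1, ?_⟩⟩
  · simpa using hint 0 ⟨by linarith, ha⟩ z hz
  · have hc : ContinuousOn (fun σ ↦ A (g (σ, z) 1)) (Ioo (-a) a) := by
      refine hA.continuousOn.comp (t := s) ?_ fun σ hσ ↦ (hsol σ hσ z hz 1).1
      exact hcd.continuousOn.comp (f := fun σ : ℝ ↦ (σ, z)) (by fun_prop) fun σ hσ ↦ ⟨hσ, hz⟩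
    have h0a : (0 : ℝ) ∈ Ioo (-a) a := ⟨by linarith, ha⟩
    have hFTC := intervalIntegral.integral_hasDerivAt_right (a := 0) (b := t)
      (f := fun σ ↦ A (g (σ, z) 1))
      ((hc.mono (ordConnected_Ioo.uIcc_subset h0a ht)).intervalIntegrable)
      (hc.stronglyMeasurableAtFilter isOpen_Ioo t ht) (hc.continuousAt (isOpen_Ioo.mem_nhds ht))
    refine (hFTC.const_add z).congr_of_eventuallyEq ?_
    filter_upwards [isOpen_Ioo.mem_nhds ht] with τ hτ
    exact hint τ hτ z hz

/-! ### Hadamard's lemma: Taylor expansions with smooth remainders. -/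

section Hadamard

universe u

variable {X Y : Type u} [NormedAddCommGroup X] [NormedSpace ℝ X] [NormedAddCommGroup Y]
  [NormedSpace ℝ Y] {a : ℝ} {W : Set X}

/-- The segment `t ↦ p + t • v` in `C([0, 1], X)`. -/
def segmentCLM (X : Type*) [NormedAddCommGroup X] [NormedSpace ℝ X] :
    X × X →L[ℝ] C(unitInterval, X) :=
  LinearMap.mkContinuous
    { toFun := fun p ↦ ⟨fun t ↦ p.1 + (t : ℝ) • p.2, by fun_prop⟩
      map_add' := fun p q ↦ by
        ext t
        simp only [ContinuousMap.coe_mk, ContinuousMap.add_apply, Prod.fst_add, Prod.snd_add]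
        module
      map_smul' := fun c p ↦ by
        ext t
        simp only [ContinuousMap.coe_mk, ContinuousMap.smul_apply, Prod.smul_fst, Prod.smul_snd,
          RingHom.id_apply]
        module } 2
    (fun p ↦ by
      rw [ContinuousMap.norm_le _ (by positivity)]
      intro t
      have h1 : ‖(t : ℝ) • p.2‖ ≤ ‖p.2‖ := by
        rw [norm_smul, Real.norm_of_nonneg t.2.1]
        exact mul_le_of_le_one_left (norm_nonneg _) t.2.2
      have h2 := norm_fst_le p
      have h3 := norm_snd_le p
      have h4 := norm_add_le p.1 ((t : ℝ) • p.2)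
      simp only [LinearMap.coe_mk, AddHom.coe_mk, ContinuousMap.coe_mk]
      linarith)

@[simp] lemma segmentCLM_apply {X : Type*} [NormedAddCommGroup X] [NormedSpace ℝ X] (p : X × X)
    (t : unitInterval) : segmentCLM X p t = p.1 + (t : ℝ) • p.2 := rfl

/-- A function vanishing at `s = 0` whose `s`-derivative is divisible by `s ^ k` is divisible by
`s ^ (k + 1)`, with smooth quotient. -/
theorem exists_pow_smul_of_hasDerivAt (hW : IsOpen W) {q r : ℝ × X → Y} {k : ℕ} [CompleteSpace Y]
    (hr : ContDiffOn ℝ ∞ r (Ioo (-a) a ×ˢ W))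
    (hq : ∀ s ∈ Ioo (-a) a, ∀ z ∈ W, HasDerivAt (fun σ ↦ q (σ, z)) (s ^ k • r (s, z)) s)
    (h0 : ∀ z ∈ W, q (0, z) = 0) :
    ∃ r' : ℝ × X → Y, ContDiffOn ℝ ∞ r' (Ioo (-a) a ×ˢ W) ∧
      ∀ s ∈ Ioo (-a) a, ∀ z ∈ W, q (s, z) = s ^ (k + 1) • r' (s, z) := by
  have hpath : ContDiff ℝ ∞ (fun p : ℝ × X ↦
      segmentCLM (ℝ × X) (((0 : ℝ), p.2), (p.1, (0 : X)))) :=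
    (segmentCLM (ℝ × X)).contDiff.comp (by fun_prop)
  have hmem : ∀ s ∈ Ioo (-a) a, ∀ z ∈ W, ∀ t : unitInterval,
      segmentCLM (ℝ × X) (((0 : ℝ), z), (s, (0 : X))) t ∈ Ioo (-a) a ×ˢ W := by
    intro s hs z hz t
    simp only [segmentCLM_apply, Prod.smul_mk, Prod.mk_add_mk, zero_add, smul_zero, add_zero,
      smul_eq_mul]
    refine ⟨?_, hz⟩
    rw [mem_Ioo, ← abs_lt] at hs ⊢
    rw [abs_mul, abs_of_nonneg t.2.1]
    exact (mul_le_of_le_one_left (abs_nonneg _) t.2.2).trans_lt hs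
  -- Substituting `σ = t s` in `q (s, z) = ∫₀ˢ σᵏ r (σ, z) dσ` gives `s ^ (k + 1) ∫₀¹ tᵏ r (t s, z)
  -- dt`. The last integral is smooth in `(s, z)`: it is a linear functional of the superposition of
  -- `r` with a segment that depends smoothly on `(s, z)`.
  refine ⟨fun p ↦ moment Y k (superpose r (segmentCLM (ℝ × X) (((0 : ℝ), p.2), (p.1, (0 : X))))),
    ?_, fun s hs z hz ↦ ?_⟩
  · exact (moment Y k).contDiff.comp_contDiffOn
      ((contDiffOn_superpose (isOpen_Ioo.prod hW) hr).comp hpath.contDiffOn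
        fun p hp ↦ hmem p.1 hp.1 p.2 hp.2)
  · have h0a : (0 : ℝ) ∈ Ioo (-a) a := ⟨by linarith [hs.1, hs.2], by linarith [hs.1, hs.2]⟩
    have hsub : uIcc 0 s ⊆ Ioo (-a) a := ordConnected_Ioo.uIcc_subset h0a hs
    have hc : ContinuousOn (fun σ : ℝ ↦ σ ^ k • r (σ, z)) (uIcc 0 s) :=
      (continuous_pow k).continuousOn.smul (hr.continuousOn.comp (f := fun σ : ℝ ↦ (σ, z))
        (by fun_prop) fun σ hσ ↦ ⟨hsub hσ, hz⟩)
    have h1 := intervalIntegral.integral_eq_sub_of_hasDerivAt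
      (fun σ hσ ↦ hq σ (hsub hσ) z hz) hc.intervalIntegrable
    rw [h0 z hz, sub_zero] at h1
    have h2 := intervalIntegral.smul_integral_comp_mul_right (a := 0) (b := 1)
      (fun σ ↦ σ ^ k • r (σ, z)) s
    rw [zero_mul, one_mul] at h2
    beta_reduce
    rw [← h1, ← h2, pow_succ', mul_smul]
    refine congrArg (s • ·) ?_
    rw [moment_apply, ← intervalIntegral.integral_smul]
    refine intervalIntegral.integral_congr fun t ht ↦ ?_
    rw [uIcc_of_le zero_le_one] at ht
    simp only [IccExtend_of_mem _ _ ht]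
    rw [superpose_apply (K := unitInterval) hr.continuousOn
      (α := segmentCLM (ℝ × X) (((0 : ℝ), z), (s, (0 : X)))) (hmem s hs z hz)]
    rw [segmentCLM_apply, smul_smul, mul_pow, mul_comm (t ^ k)]
    simp

lemma contDiffOn_timeDeriv (hW : IsOpen W) {h : ℝ × X → Y}
    (hh : ContDiffOn ℝ ∞ h (Ioo (-a) a ×ˢ W)) :
    ContDiffOn ℝ ∞ (fun p ↦ deriv (fun σ ↦ h (σ, p.2)) p.1) (Ioo (-a) a ×ˢ W) ∧
      ∀ s ∈ Ioo (-a) a, ∀ z ∈ W,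
        HasDerivAt (fun σ ↦ h (σ, z)) (deriv (fun σ ↦ h (σ, z)) s) s := by
  have hD := isOpen_Ioo (a := -a) (b := a).prod hW
  have h1 : ∀ p ∈ Ioo (-a) a ×ˢ W,
      HasDerivAt (fun σ ↦ h (σ, p.2)) (fderiv ℝ h p (1, 0)) p.1 := by
    intro p hp
    have hd : HasFDerivAt h (fderiv ℝ h p) p :=
      ((hh.contDiffAt (hD.mem_nhds hp)).differentiableAt (by simp)).hasFDerivAt
    exact hd.comp_hasDerivAt (f := fun σ ↦ (σ, p.2)) p.1
      ((hasDerivAt_id p.1).prodMk (hasDerivAt_const p.1 p.2))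
  refine ⟨?_, fun s hs z hz ↦ ?_⟩
  · refine ((hh.fderiv_of_isOpen hD (m := ∞) (by simp)).clm_apply
      (contDiffOn_const (c := ((1 : ℝ), (0 : X))))).congr fun p hp ↦ (h1 p hp).deriv
  · have := h1 (s, z) ⟨hs, hz⟩
    rwa [← this.deriv] at this

/-- First order Taylor expansion in `s` with smooth remainder. -/
theorem exists_taylor_one (hW : IsOpen W) [CompleteSpace Y] {h : ℝ × X → Y}
    (hh : ContDiffOn ℝ ∞ h (Ioo (-a) a ×ˢ W)) :
    ∃ r : ℝ × X → Y, ContDiffOn ℝ ∞ r (Ioo (-a) a ×ˢ W) ∧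
      ∀ s ∈ Ioo (-a) a, ∀ z ∈ W, h (s, z) = h (0, z) + s • r (s, z) := by
  obtain ⟨h1, h2⟩ := contDiffOn_timeDeriv hW hh
  obtain ⟨r, hr, hr'⟩ := exists_pow_smul_of_hasDerivAt (k := 0) (q := fun p ↦ h p - h (0, p.2))
    hW h1 (fun s hs z hz ↦ by simpa using (h2 s hs z hz).sub_const (h (0, z)))
    (fun z hz ↦ by simp)
  refine ⟨r, hr, fun s hs z hz ↦ ?_⟩
  rw [← sub_eq_iff_eq_add']
  simpa using hr' s hs z hz

/-- Second order Taylor expansion in `s` with smooth remainder. -/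
theorem exists_taylor_two (hW : IsOpen W) [CompleteSpace Y] {h : ℝ × X → Y} {h' : X → Y}
    (hh : ContDiffOn ℝ ∞ h (Ioo (-a) a ×ˢ W))
    (hh' : ∀ z ∈ W, HasDerivAt (fun σ ↦ h (σ, z)) (h' z) 0) :
    ∃ r : ℝ × X → Y, ContDiffOn ℝ ∞ r (Ioo (-a) a ×ˢ W) ∧
      ∀ s ∈ Ioo (-a) a, ∀ z ∈ W, h (s, z) = h (0, z) + s • h' z + s ^ 2 • r (s, z) := by
  obtain ⟨h1, h2⟩ := contDiffOn_timeDeriv hW hh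
  obtain ⟨r₁, hr₁, hr₁'⟩ := exists_taylor_one hW h1
  obtain ⟨r, hr, hr'⟩ := exists_pow_smul_of_hasDerivAt (k := 1)
    (q := fun p ↦ h p - (h (0, p.2) + p.1 • h' p.2)) hW hr₁
    (fun s hs z hz ↦ by
      have h3 := (h2 s hs z hz).sub (((hasDerivAt_id s).smul_const (h' z)).const_add (h (0, z)))
      refine h3.congr_deriv ?_
      have := hr₁' s hs z hz
      simp only at this
      rw [this, (hh' z hz).deriv]
      simp)
    (fun z hz ↦ by simp)
  refine ⟨r, hr, fun s hs z hz ↦ ?_⟩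
  rw [← sub_eq_iff_eq_add']
  simpa using hr' s hs z hz

end Hadamard

/-! ### Uniqueness for autonomous differential equations. -/

/-- Two solutions of a `C¹` autonomous differential equation which agree at times accumulating at
`t₀` agree near `t₀`. -/
theorem eventuallyEq_of_frequently_eq {X : Type*} [NormedAddCommGroup X] [NormedSpace ℝ X]
    {A : X → X} {α β : ℝ → X} {t₀ : ℝ} (hA : ContDiffAt ℝ 1 A (α t₀))
    (hα : ∀ᶠ t in 𝓝 t₀, HasDerivAt α (A (α t)) t) (hβ : ∀ᶠ t in 𝓝 t₀, HasDerivAt β (A (β t)) t)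
    (h : ∃ᶠ t in 𝓝 t₀, α t = β t) : α =ᶠ[𝓝 t₀] β := by
  have hαc := hα.self_of_nhds.continuousAt
  have hβc := hβ.self_of_nhds.continuousAt
  have heq : α t₀ = β t₀ := by
    by_contra hne
    have h1 : ∀ᶠ t in 𝓝 t₀, α t ≠ β t :=
      (hαc.prodMk hβc).eventually (isOpen_ne_fun continuous_fst continuous_snd |>.mem_nhds hne)
    exact h (h1.mono fun t ht ↦ ht)
  obtain ⟨K, s, hs, hK⟩ := hA.exists_lipschitzOnWith
  refine ODE_solution_unique_of_eventually (v := fun _ ↦ A) (s := fun _ ↦ s) (K := K)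
    (Eventually.of_forall fun _ ↦ hK) (hα.and (hαc.eventually_mem hs))
    (hβ.and (hβc.eventually_mem (heq ▸ hs))) heq

/-- Uniqueness for a smooth autonomous differential equation on an interval. -/
theorem eqOn_of_hasDerivAt {X : Type*} [NormedAddCommGroup X] [NormedSpace ℝ X]
    {A : X → X} {s : Set X} (hs : IsOpen s) (hA : ContDiffOn ℝ ∞ A s) {α β : ℝ → X} {J : Set ℝ}
    (hJ : IsOpen J) (hJc : J.OrdConnected) (hα : ∀ t ∈ J, α t ∈ s ∧ HasDerivAt α (A (α t)) t)
    (hβ : ∀ t ∈ J, HasDerivAt β (A (β t)) t) {t₀ : ℝ} (ht₀ : t₀ ∈ J)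
    (h : α t₀ = β t₀) : EqOn α β J := by
  have key : ∀ t ∈ J, (∃ᶠ τ in 𝓝 t, α τ = β τ) → α =ᶠ[𝓝 t] β := fun t ht hf ↦ by
    refine eventuallyEq_of_frequently_eq
      ((hA.contDiffAt (hs.mem_nhds (hα t ht).1)).of_le (by simp)) ?_ ?_ hf
    · filter_upwards [hJ.mem_nhds ht] with τ hτ using (hα τ hτ).2
    · filter_upwards [hJ.mem_nhds ht] with τ hτ using hβ τ hτ
  -- The times near which the solutions agree form an open set, which `key` shows to be closed
  -- relative to the connected set `J`.
  have hsub : J ⊆ {t | α =ᶠ[𝓝 t] β} := by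
    refine hJc.isPreconnected.subset_of_closure_inter_subset isOpen_setOfPred_eventually_nhds
      ⟨t₀, ht₀, key t₀ ht₀ fun hc ↦ hc.self_of_nhds h⟩ ?_
    rintro t ⟨ht, htJ⟩
    refine key t htJ ((mem_closure_iff_frequently.1 ht).mono fun τ hτ ↦ ?_)
    exact (show α =ᶠ[𝓝 τ] β from hτ).self_of_nhds
  exact fun t ht ↦ (show α =ᶠ[𝓝 t] β from hsub ht).self_of_nhds

/-! ### The geodesic spray in coordinates and its flow. -/

section Coordinates

variable {E : Type*} [NormedAddCommGroup E]

/-- `(x, u, v) ↦ (x, v, -u)`. -/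
def quarterTurn (z : E × (E × E)) : E × (E × E) := (z.1, (z.2.2, -z.2.1))

/-- `(x, u, v) ↦ (x, -v, u)`. -/
def quarterTurnInv (z : E × (E × E)) : E × (E × E) := (z.1, (-z.2.2, z.2.1))

/-- `(x, u, v) ↦ (x, -u, v)`. -/
def reverse (z : E × (E × E)) : E × (E × E) := (z.1, (-z.2.1, z.2.2))

/-- `(x, u, v) ↦ (x, v, u)`. -/
def swapVec (z : E × (E × E)) : E × (E × E) := (z.1, (z.2.2, z.2.1))

@[simp] lemma quarterTurnInv_quarterTurn (z : E × (E × E)) :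
    quarterTurnInv (quarterTurn z) = z := by simp [quarterTurn, quarterTurnInv]

@[simp] lemma quarterTurn_quarterTurnInv (z : E × (E × E)) :
    quarterTurn (quarterTurnInv z) = z := by simp [quarterTurn, quarterTurnInv]

@[simp] lemma reverse_reverse (z : E × (E × E)) : reverse (reverse z) = z := by simp [reverse]

variable [NormedSpace ℝ E]

/-- The vector field on `(x, u, v)`-space whose integral curves are the geodesics `x`, with velocity
`u` and a parallel field `v`, for the connection with Christoffel map `Γ`. -/
def spray (Γ : E → E →L[ℝ] E →L[ℝ] E) (z : E × (E × E)) : E × (E × E) :=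
  (z.2.1, (-Γ z.1 z.2.1 z.2.1, -Γ z.1 z.2.2 z.2.1))

lemma contDiff_quarterTurn {n : ℕ∞ω} : ContDiff ℝ n (quarterTurn : E × (E × E) → _) := by
  unfold quarterTurn; fun_prop

lemma contDiff_quarterTurnInv {n : ℕ∞ω} : ContDiff ℝ n (quarterTurnInv : E × (E × E) → _) := by
  unfold quarterTurnInv; fun_prop

lemma contDiff_reverse {n : ℕ∞ω} : ContDiff ℝ n (reverse : E × (E × E) → _) := by
  unfold reverse; fun_prop

lemma contDiff_swapVec {n : ℕ∞ω} : ContDiff ℝ n (swapVec : E × (E × E) → _) := by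
  unfold swapVec; fun_prop

variable {Γ : E → E →L[ℝ] E →L[ℝ] E} {O : Set E}

lemma contDiffOn_christoffel_apply {X : Type*} [NormedAddCommGroup X] [NormedSpace ℝ X]
    {D : Set X} (hΓ : ContDiffOn ℝ ∞ Γ O) {x v u : X → E} (hx : ContDiffOn ℝ ∞ x D)
    (hxO : MapsTo x D O) (hv : ContDiffOn ℝ ∞ v D) (hu : ContDiffOn ℝ ∞ u D) :
    ContDiffOn ℝ ∞ (fun p ↦ Γ (x p) (v p) (u p)) D :=
  ((hΓ.comp hx hxO).clm_apply hv).clm_apply hu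

lemma contDiffOn_fderiv_christoffel_apply {X : Type*} [NormedAddCommGroup X] [NormedSpace ℝ X]
    {D : Set X} (hO : IsOpen O) (hΓ : ContDiffOn ℝ ∞ Γ O) {x w v u : X → E}
    (hx : ContDiffOn ℝ ∞ x D) (hxO : MapsTo x D O) (hw : ContDiffOn ℝ ∞ w D)
    (hv : ContDiffOn ℝ ∞ v D) (hu : ContDiffOn ℝ ∞ u D) :
    ContDiffOn ℝ ∞ (fun p ↦ fderiv ℝ Γ (x p) (w p) (v p) (u p)) D :=
  ((((hΓ.fderiv_of_isOpen hO (m := ∞) (by simp)).comp hx hxO).clm_apply hw).clm_apply hv).clm_apply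
    hu

lemma hasDerivAt_clm_apply₂ {V W Y : Type*} [NormedAddCommGroup V] [NormedSpace ℝ V]
    [NormedAddCommGroup W] [NormedSpace ℝ W] [NormedAddCommGroup Y] [NormedSpace ℝ Y]
    {G : ℝ → V →L[ℝ] W →L[ℝ] Y} {v : ℝ → V} {u : ℝ → W} {G' : V →L[ℝ] W →L[ℝ] Y} {v' : V} {u' : W}
    {t : ℝ} (hG : HasDerivAt G G' t) (hv : HasDerivAt v v' t) (hu : HasDerivAt u u' t) :
    HasDerivAt (fun s ↦ G s (v s) (u s)) (G' (v t) (u t) + G t v' (u t) + G t (v t) u') t := by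
  refine ((hG.clm_apply hv).clm_apply hu).congr_deriv ?_
  simp

lemma hasDerivAt_comp_of_contDiffOn {V : Type*} [NormedAddCommGroup V] [NormedSpace ℝ V]
    {G : E → V} (hO : IsOpen O) (hG : ContDiffOn ℝ ∞ G O) {x : ℝ → E} {x' : E} {t : ℝ}
    (hxO : x t ∈ O) (hx : HasDerivAt x x' t) :
    HasDerivAt (fun s ↦ G (x s)) (fderiv ℝ G (x t) x') t :=
  ((hG.contDiffAt (hO.mem_nhds hxO)).differentiableAt (by simp)).hasFDerivAt.comp_hasDerivAt t hx

lemma hasDerivAt_christoffel_apply (hO : IsOpen O) (hΓ : ContDiffOn ℝ ∞ Γ O) {x v u : ℝ → E}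
    {x' v' u' : E} {t : ℝ} (hxO : x t ∈ O) (hx : HasDerivAt x x' t) (hv : HasDerivAt v v' t)
    (hu : HasDerivAt u u' t) :
    HasDerivAt (fun s ↦ Γ (x s) (v s) (u s))
      (fderiv ℝ Γ (x t) x' (v t) (u t) + Γ (x t) v' (u t) + Γ (x t) (v t) u') t := by
  exact hasDerivAt_clm_apply₂ (hasDerivAt_comp_of_contDiffOn hO hΓ hxO hx) hv hu

lemma contDiffOn_spray (hΓ : ContDiffOn ℝ ∞ Γ O) :
    ContDiffOn ℝ ∞ (spray Γ) (O ×ˢ univ) := by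
  have h1 : ∀ {v u : E × (E × E) → E}, ContDiff ℝ ∞ v → ContDiff ℝ ∞ u →
      ContDiffOn ℝ ∞ (fun z : E × (E × E) ↦ Γ z.1 (v z) (u z)) (O ×ˢ univ) := fun hv hu ↦
    contDiffOn_christoffel_apply hΓ contDiffOn_fst (fun z hz ↦ hz.1) hv.contDiffOn hu.contDiffOn
  exact ContDiffOn.prodMk (by fun_prop)
    ((h1 (by fun_prop) (by fun_prop)).neg.prodMk (h1 (by fun_prop) (by fun_prop)).neg)

/-- `ψ` is a smooth flow of `spray Γ` for times in `(-a, a)` and initial values in `N`. -/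
structure IsFlowOn (Γ : E → E →L[ℝ] E →L[ℝ] E) (O : Set E) (a : ℝ) (N : Set (E × (E × E)))
    (ψ : ℝ → E × (E × E) → E × (E × E)) : Prop where
  isOpen : IsOpen N
  contDiffOn : ContDiffOn ℝ ∞ (fun p : ℝ × (E × (E × E)) ↦ ψ p.1 p.2) (Ioo (-a) a ×ˢ N)
  zero : ∀ z ∈ N, ψ 0 z = z
  mem : ∀ t ∈ Ioo (-a) a, ∀ z ∈ N, (ψ t z).1 ∈ O
  hasDerivAt : ∀ t ∈ Ioo (-a) a, ∀ z ∈ N, HasDerivAt (fun τ ↦ ψ τ z) (spray Γ (ψ t z)) t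

/-- Serves both symmetries of the spray: scaling of velocities (`c = d`) and reversal of the
geodesic (`c = -1`, `d = 1`). -/
lemma hasDerivAt_scale {α : ℝ → E × (E × E)} {α' : E × (E × E)} {t : ℝ} (h : HasDerivAt α α' t)
    (c d : ℝ) : HasDerivAt (fun s ↦ ((α s).1, (c • (α s).2.1, d • (α s).2.2)))
      (α'.1, (c • α'.2.1, d • α'.2.2)) t := by
  have h1 : HasDerivAt (fun s ↦ (α s).1) α'.1 t :=
    (ContinuousLinearMap.fst ℝ E (E × E)).hasFDerivAt.comp_hasDerivAt t h
  have h2 : HasDerivAt (fun s ↦ (α s).2) α'.2 t :=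
    (ContinuousLinearMap.snd ℝ E (E × E)).hasFDerivAt.comp_hasDerivAt t h
  have h3 : HasDerivAt (fun s ↦ (α s).2.1) α'.2.1 t :=
    (ContinuousLinearMap.fst ℝ E E).hasFDerivAt.comp_hasDerivAt t h2
  have h4 : HasDerivAt (fun s ↦ (α s).2.2) α'.2.2 t :=
    (ContinuousLinearMap.snd ℝ E E).hasFDerivAt.comp_hasDerivAt t h2
  exact h1.prodMk ((h3.const_smul c).prodMk (h4.const_smul d))

/-- The flow of the spray exists on a neighbourhood of `(x₀, B_R, B_R)`. -/
theorem exists_isFlowOn [CompleteSpace E] (hO : IsOpen O) (hΓ : ContDiffOn ℝ ∞ Γ O) {x₀ : E}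
    (hx₀ : x₀ ∈ O) {R : ℝ} (hR : 0 < R) :
    ∃ (a : ℝ) (V : Set E) (ψ : ℝ → E × (E × E) → E × (E × E)), 0 < a ∧ x₀ ∈ V ∧
      IsFlowOn Γ O a (V ×ˢ (Metric.ball 0 R ×ˢ Metric.ball 0 R)) ψ := by
  obtain ⟨a, N, ψ, ha, hN, hzN, hsm, h0, hd⟩ := exists_local_flow (hO.prod isOpen_univ)
    (contDiffOn_spray hΓ) (z₀ := (x₀, ((0 : E), (0 : E)))) ⟨hx₀, mem_univ _⟩
  obtain ⟨δ, hδ, hball⟩ := Metric.isOpen_iff.1 hN _ hzN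
  set c : ℝ := R / δ with hc
  have hc0 : 0 < c := div_pos hR hδ
  -- The local flow lives near zero vectors, of size less than `δ`. The vector components of the
  -- spray are quadratic in the vectors, so shrinking these by `c = R / δ` and speeding up time by
  -- `c` reaches vectors of size `R`, at the price of the shorter time `a / c`.
  let S : ℝ → E × (E × E) → E × (E × E) := fun c z ↦ (z.1, (c • z.2.1, c • z.2.2))
  have hS : ∀ c, ContDiff ℝ ∞ (S c) := fun c ↦ by fun_prop
  have hSN : ∀ z ∈ Metric.ball x₀ δ ×ˢ (Metric.ball (0 : E) R ×ˢ Metric.ball (0 : E) R),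
      S c⁻¹ z ∈ N := by
    rintro ⟨x, u, v⟩ ⟨hx, hu, hv⟩
    have : ∀ w ∈ Metric.ball (0 : E) R, ‖c⁻¹ • w‖ < δ := fun w hw ↦ by
      rw [norm_smul, norm_inv, Real.norm_of_nonneg hc0.le, inv_mul_lt_iff₀ hc0, hc,
        div_mul_cancel₀ _ hδ.ne']
      exact mem_ball_zero_iff.1 hw
    refine hball ?_
    rw [Metric.mem_ball, Prod.dist_eq, Prod.dist_eq, max_lt_iff, max_lt_iff, dist_zero_right,
      dist_zero_right]
    exact ⟨hx, this u hu, this v hv⟩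
  have hIoo : ∀ t ∈ Ioo (-(a / c)) (a / c), c * t ∈ Ioo (-a) a := fun t ht ↦ by
    rw [mem_Ioo, ← abs_lt] at ht ⊢
    rw [abs_mul, abs_of_pos hc0]
    rwa [lt_div_iff₀' hc0] at ht
  refine ⟨a / c, Metric.ball x₀ δ, fun t z ↦ S c (ψ (c * t) (S c⁻¹ z)), div_pos ha hc0,
    Metric.mem_ball_self hδ, ⟨?_, ?_, fun z hz ↦ ?_, fun t ht z hz ↦ ?_, fun t ht z hz ↦ ?_⟩⟩
  · exact Metric.isOpen_ball.prod (Metric.isOpen_ball.prod Metric.isOpen_ball)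
  · refine (hS c).comp_contDiffOn (hsm.comp
      (f := fun p : ℝ × (E × (E × E)) ↦ (c * p.1, S c⁻¹ p.2)) ?_ ?_)
    · exact ((contDiff_const.mul contDiff_fst).prodMk ((hS _).comp contDiff_snd)).contDiffOn
    · exact fun p hp ↦ ⟨hIoo _ hp.1, hSN _ hp.2⟩
  · simp only [mul_zero, h0 _ (hSN z hz)]
    simp [S, smul_smul, mul_inv_cancel₀ hc0.ne']
  · exact (hd _ (hIoo t ht) _ (hSN z hz)).1.1
  · have h1 := (hd _ (hIoo t ht) _ (hSN z hz)).2
    have h2 := h1.scomp t ((hasDerivAt_id t).const_mul c)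
    refine (hasDerivAt_scale h2 c c).congr_deriv ?_
    simp [spray, S, smul_smul]

namespace IsFlowOn

variable {a : ℝ} {N : Set (E × (E × E))} {ψ : ℝ → E × (E × E) → E × (E × E)}

/-- A geodesic run backwards is a geodesic with the opposite velocity, with the same parallel
fields. Through this flow the expansion of `P₂` also yields that of `Q₂`. -/
lemma reversed (h : IsFlowOn Γ O a N ψ) :
    IsFlowOn Γ O a (reverse ⁻¹' N) (fun s z ↦ reverse (ψ (-s) (reverse z))) where
  isOpen := h.isOpen.preimage (contDiff_reverse (n := 0)).continuous
  contDiffOn := by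
    refine (contDiff_reverse (n := ∞)).comp_contDiffOn (h.contDiffOn.comp
      (f := fun p : ℝ × (E × (E × E)) ↦ (-p.1, reverse p.2)) ?_ ?_)
    · exact (contDiff_fst.neg.prodMk (contDiff_reverse.comp contDiff_snd)).contDiffOn
    · exact fun p hp ↦ ⟨⟨by linarith [hp.1.2], by linarith [hp.1.1]⟩, hp.2⟩
  zero z hz := by
    rw [neg_zero, h.zero _ hz, reverse_reverse]
  mem t ht z hz := h.mem (-t) ⟨by linarith [ht.2], by linarith [ht.1]⟩ _ hz
  hasDerivAt t ht z hz := by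
    have h1 := h.hasDerivAt (-t) ⟨by linarith [ht.2], by linarith [ht.1]⟩ _ hz
    have h2 := hasDerivAt_scale (h1.scomp t (hasDerivAt_neg t)) (-1) 1
    simp only [neg_smul, one_smul] at h2
    refine h2.congr_deriv ?_
    simp [spray, reverse]

/-- Both `t ↦ ψ t z` and `t ↦ ψ (t - s) (ψ s z)` are integral curves that agree at `t = s`; evaluate
them at `t = 0`. The condition `ψ s z ∈ N` cannot be dropped, since the second curve starts there.
-/
lemma neg_apply (h : IsFlowOn Γ O a N ψ) (hO : IsOpen O) (hΓ : ContDiffOn ℝ ∞ Γ O) {s : ℝ}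
    (hs : s ∈ Ioo (-a) a) {z : E × (E × E)} (hz : z ∈ N) (hz' : ψ s z ∈ N) :
    ψ (-s) (ψ s z) = z := by
  have ha : 0 < a := by linarith [hs.1, hs.2]
  have hJ0 : (0 : ℝ) ∈ Ioo (-a) a ∩ Ioo (s - a) (s + a) :=
    ⟨⟨by linarith, ha⟩, by linarith [hs.2], by linarith [hs.1]⟩
  have hJs : s ∈ Ioo (-a) a ∩ Ioo (s - a) (s + a) := ⟨hs, by linarith, by linarith⟩
  have key : EqOn (fun t ↦ ψ t z) (fun t ↦ ψ (t - s) (ψ s z))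
      (Ioo (-a) a ∩ Ioo (s - a) (s + a)) := by
    refine eqOn_of_hasDerivAt (hO.prod isOpen_univ) (contDiffOn_spray hΓ)
      (isOpen_Ioo.inter isOpen_Ioo) (ordConnected_Ioo.inter ordConnected_Ioo)
      (fun t ht ↦ ⟨⟨h.mem t ht.1 z hz, mem_univ _⟩, h.hasDerivAt t ht.1 z hz⟩)
      (fun t ht ↦ ?_) hJs ?_
    · have h1 := h.hasDerivAt (t - s) ⟨by linarith [ht.2.1], by linarith [ht.2.2]⟩ _ hz'
      exact h1.comp_sub_const t s
    · simp only [sub_self, h.zero _ hz']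
  have := key hJ0
  simp only [zero_sub, h.zero z hz] at this
  exact this.symm

end IsFlowOn

end Coordinates

/-! ### Taylor expansion of geodesics, parallel transport and two-step endpoints. -/

section Expansion

variable {E : Type*} [NormedAddCommGroup E] [NormedSpace ℝ E]
  {Γ : E → E →L[ℝ] E →L[ℝ] E} {O : Set E}

/-- The derivative of `-Γ_x(v, u)` along variations `x'`, `v'`, `u'` of the arguments. -/
def christoffelVariation (Γ : E → E →L[ℝ] E →L[ℝ] E) (x x' v v' u u' : E) : E :=
  -(fderiv ℝ Γ x x' v u + Γ x v' u + Γ x v u')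

/-- The third derivative at `0` of the geodesic from `x` with velocity `u`. -/
def geodesicJerk (Γ : E → E →L[ℝ] E →L[ℝ] E) (x u : E) : E :=
  christoffelVariation Γ x u u (-Γ x u u) u (-Γ x u u)

/-- The second derivative at `0` of the parallel transport of `v` along the geodesic from `x` with
velocity `u`. -/
def transportJerk (Γ : E → E →L[ℝ] E →L[ℝ] E) (x u v : E) : E :=
  christoffelVariation Γ x u v (-Γ x v u) u (-Γ x u u)

lemma hasDerivAt_cubic (c₀ c₁ c₂ c₃ : E) (s : ℝ) :
    HasDerivAt (fun σ : ℝ ↦ c₀ + σ • c₁ + (σ ^ 2 / 2) • c₂ + (σ ^ 3 / 6) • c₃)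
      (c₁ + s • c₂ + (s ^ 2 / 2) • c₃) s := by
  have h1 := (hasDerivAt_id s).smul_const c₁
  have h2 := (((hasDerivAt_id s).pow 2).div_const 2).smul_const c₂
  have h3 := (((hasDerivAt_id s).pow 3).div_const 6).smul_const c₃
  refine (((h1.const_add c₀).add h2).add h3).congr_deriv ?_
  simp only [id, one_smul]
  norm_num
  rw [show 3 * s ^ 2 / 6 = s ^ 2 / 2 by ring]

/-- Puts a derivative minus its quadratic Taylor polynomial in the form required by
`exists_pow_smul_of_hasDerivAt`, which then integrates the remainder. -/
lemma hasDerivAt_sub_cubic {f : ℝ → E} {f' d : E} {s : ℝ} (hf : HasDerivAt f f' s)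
    (c₀ c₁ c₂ c₃ : E) (hd : f' - (c₁ + s • c₂ + (s ^ 2 / 2) • c₃) = d) :
    HasDerivAt (fun σ : ℝ ↦ f σ - (c₀ + σ • c₁ + (σ ^ 2 / 2) • c₂ + (σ ^ 3 / 6) • c₃)) d s :=
  hd ▸ hf.sub (hasDerivAt_cubic c₀ c₁ c₂ c₃ s)

lemma contDiffOn_christoffelVariation {X : Type*} [NormedAddCommGroup X] [NormedSpace ℝ X]
    {D : Set X} (hO : IsOpen O) (hΓ : ContDiffOn ℝ ∞ Γ O) {x x' v v' u u' : X → E}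
    (hx : ContDiffOn ℝ ∞ x D) (hxO : MapsTo x D O) (hx' : ContDiffOn ℝ ∞ x' D)
    (hv : ContDiffOn ℝ ∞ v D) (hv' : ContDiffOn ℝ ∞ v' D)
    (hu : ContDiffOn ℝ ∞ u D) (hu' : ContDiffOn ℝ ∞ u' D) :
    ContDiffOn ℝ ∞ (fun p ↦ christoffelVariation Γ (x p) (x' p) (v p) (v' p) (u p) (u' p)) D :=
  (((contDiffOn_fderiv_christoffel_apply hO hΓ hx hxO hx' hv hu).add
    (contDiffOn_christoffel_apply hΓ hx hxO hv' hu)).add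
    (contDiffOn_christoffel_apply hΓ hx hxO hv hu')).neg

lemma contDiffOn_geodesicJerk {X : Type*} [NormedAddCommGroup X] [NormedSpace ℝ X]
    {D : Set X} (hO : IsOpen O) (hΓ : ContDiffOn ℝ ∞ Γ O) {x u : X → E}
    (hx : ContDiffOn ℝ ∞ x D) (hxO : MapsTo x D O) (hu : ContDiffOn ℝ ∞ u D) :
    ContDiffOn ℝ ∞ (fun p ↦ geodesicJerk Γ (x p) (u p)) D :=
  have h := (contDiffOn_christoffel_apply hΓ hx hxO hu hu).neg
  contDiffOn_christoffelVariation hO hΓ hx hxO hu hu h hu h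

lemma contDiffOn_transportJerk {X : Type*} [NormedAddCommGroup X] [NormedSpace ℝ X]
    {D : Set X} (hO : IsOpen O) (hΓ : ContDiffOn ℝ ∞ Γ O) {x u v : X → E}
    (hx : ContDiffOn ℝ ∞ x D) (hxO : MapsTo x D O) (hu : ContDiffOn ℝ ∞ u D)
    (hv : ContDiffOn ℝ ∞ v D) :
    ContDiffOn ℝ ∞ (fun p ↦ transportJerk Γ (x p) (u p) (v p)) D :=
  contDiffOn_christoffelVariation hO hΓ hx hxO hu hv
    (contDiffOn_christoffel_apply hΓ hx hxO hv hu).neg hu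
    (contDiffOn_christoffel_apply hΓ hx hxO hu hu).neg

lemma hasDerivAt_neg_christoffel (hO : IsOpen O) (hΓ : ContDiffOn ℝ ∞ Γ O) {x v u : ℝ → E}
    {x' v' u' : E} {t : ℝ} (hxO : x t ∈ O) (hx : HasDerivAt x x' t) (hv : HasDerivAt v v' t)
    (hu : HasDerivAt u u' t) :
    HasDerivAt (fun s ↦ -Γ (x s) (v s) (u s))
      (christoffelVariation Γ (x t) x' (v t) v' (u t) u') t :=
  (hasDerivAt_christoffel_apply hO hΓ hxO hx hv hu).neg

namespace IsFlowOn

variable {a : ℝ} {N : Set (E × (E × E))} {ψ : ℝ → E × (E × E) → E × (E × E)}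

lemma hasDerivAt_components (h : IsFlowOn Γ O a N ψ) {t : ℝ} (ht : t ∈ Ioo (-a) a)
    {z : E × (E × E)} (hz : z ∈ N) :
    HasDerivAt (fun τ ↦ (ψ τ z).1) (ψ t z).2.1 t ∧
    HasDerivAt (fun τ ↦ (ψ τ z).2.1) (-Γ (ψ t z).1 (ψ t z).2.1 (ψ t z).2.1) t ∧
    HasDerivAt (fun τ ↦ (ψ τ z).2.2) (-Γ (ψ t z).1 (ψ t z).2.2 (ψ t z).2.1) t := by
  have h0 := h.hasDerivAt t ht z hz
  have h2 := (ContinuousLinearMap.snd ℝ E (E × E)).hasFDerivAt.comp_hasDerivAt t h0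
  exact ⟨(ContinuousLinearMap.fst ℝ E (E × E)).hasFDerivAt.comp_hasDerivAt t h0,
    (ContinuousLinearMap.fst ℝ E E).hasFDerivAt.comp_hasDerivAt t h2,
    (ContinuousLinearMap.snd ℝ E E).hasFDerivAt.comp_hasDerivAt t h2⟩

variable [CompleteSpace E]

/-- Taylor expansions of geodesics and of parallel transport, with smooth remainders. -/
theorem exists_taylor (h : IsFlowOn Γ O a N ψ) (hO : IsOpen O) (hΓ : ContDiffOn ℝ ∞ Γ O)
    (ha : 0 < a) :
    ∃ rX rV : ℝ × (E × (E × E)) → E, ContDiffOn ℝ ∞ rX (Ioo (-a) a ×ˢ N) ∧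
      ContDiffOn ℝ ∞ rV (Ioo (-a) a ×ˢ N) ∧ ∀ s ∈ Ioo (-a) a, ∀ z ∈ N,
        (ψ s z).1 = z.1 + s • z.2.1 + (s ^ 2 / 2) • (-Γ z.1 z.2.1 z.2.1) +
          (s ^ 3 / 6) • geodesicJerk Γ z.1 z.2.1 + s ^ 4 • rX (s, z) ∧
        (ψ s z).2.2 = z.2.2 + s • (-Γ z.1 z.2.2 z.2.1) +
          (s ^ 2 / 2) • transportJerk Γ z.1 z.2.1 z.2.2 + s ^ 3 • rV (s, z) := by
  have h0a : (0 : ℝ) ∈ Ioo (-a) a := ⟨by linarith, ha⟩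
  have hx := h.contDiffOn.fst
  have hu := h.contDiffOn.snd.fst
  have hv := h.contDiffOn.snd.snd
  have hxO : MapsTo (fun p : ℝ × (E × (E × E)) ↦ (ψ p.1 p.2).1) (Ioo (-a) a ×ˢ N) O :=
    fun p hp ↦ h.mem _ hp.1 _ hp.2
  have hd := fun (z : E × (E × E)) (hz : z ∈ N) ↦ h.hasDerivAt_components h0a hz
  -- The right-hand sides of the geodesic and transport equations are expanded to second order. One
  -- integration gives the velocity and the transported field up to `s ^ 3`, and a further one the
  -- position up to `s ^ 4`. The zero cubic coefficients below only bring these expansions to the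
  -- common cubic form.
  obtain ⟨rU₀, hrU₀, hU₀⟩ := exists_taylor_two (h' := fun z ↦ geodesicJerk Γ z.1 z.2.1) h.isOpen
    (contDiffOn_christoffel_apply hΓ hx hxO hu hu).neg (fun z hz ↦ by
      have := hasDerivAt_neg_christoffel hO hΓ (h.mem 0 h0a z hz) (hd z hz).1 (hd z hz).2.1
        (hd z hz).2.1
      simpa only [h.zero z hz, geodesicJerk, transportJerk] using this)
  obtain ⟨rV₀, hrV₀, hV₀⟩ := exists_taylor_two (h' := fun z ↦ transportJerk Γ z.1 z.2.1 z.2.2)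
    h.isOpen (contDiffOn_christoffel_apply hΓ hx hxO hv hu).neg (fun z hz ↦ by
      have := hasDerivAt_neg_christoffel hO hΓ (h.mem 0 h0a z hz) (hd z hz).1 (hd z hz).2.2
        (hd z hz).2.1
      simpa only [h.zero z hz, geodesicJerk, transportJerk] using this)
  obtain ⟨rU, hrU, hU⟩ := exists_pow_smul_of_hasDerivAt (k := 2) h.isOpen hrU₀
    (q := fun p ↦ (ψ p.1 p.2).2.1 - (p.2.2.1 + p.1 • (-Γ p.2.1 p.2.2.1 p.2.2.1) +
      (p.1 ^ 2 / 2) • geodesicJerk Γ p.2.1 p.2.2.1 + (p.1 ^ 3 / 6) • (0 : E)))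
    (fun s hs z hz ↦ by
      refine hasDerivAt_sub_cubic (h.hasDerivAt_components hs hz).2.1
        z.2.1 (-Γ z.1 z.2.1 z.2.1) (geodesicJerk Γ z.1 z.2.1) 0 ?_
      have := hU₀ s hs z hz
      simp only [h.zero z hz] at this
      rw [this]
      simp)
    (fun z hz ↦ by simp [h.zero z hz])
  obtain ⟨rV, hrV, hV⟩ := exists_pow_smul_of_hasDerivAt (k := 2) h.isOpen hrV₀
    (q := fun p ↦ (ψ p.1 p.2).2.2 - (p.2.2.2 + p.1 • (-Γ p.2.1 p.2.2.2 p.2.2.1) +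
      (p.1 ^ 2 / 2) • transportJerk Γ p.2.1 p.2.2.1 p.2.2.2 + (p.1 ^ 3 / 6) • (0 : E)))
    (fun s hs z hz ↦ by
      refine hasDerivAt_sub_cubic (h.hasDerivAt_components hs hz).2.2
        z.2.2 (-Γ z.1 z.2.2 z.2.1) (transportJerk Γ z.1 z.2.1 z.2.2) 0 ?_
      have := hV₀ s hs z hz
      simp only [h.zero z hz] at this
      rw [this]
      simp)
    (fun z hz ↦ by simp [h.zero z hz])
  obtain ⟨rX, hrX, hX⟩ := exists_pow_smul_of_hasDerivAt (k := 3) h.isOpen hrU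
    (q := fun p ↦ (ψ p.1 p.2).1 - (p.2.1 + p.1 • p.2.2.1 +
      (p.1 ^ 2 / 2) • (-Γ p.2.1 p.2.2.1 p.2.2.1) + (p.1 ^ 3 / 6) • geodesicJerk Γ p.2.1 p.2.2.1))
    (fun s hs z hz ↦ by
      refine hasDerivAt_sub_cubic (h.hasDerivAt_components hs hz).1
        z.1 z.2.1 (-Γ z.1 z.2.1 z.2.1) (geodesicJerk Γ z.1 z.2.1) ?_
      have := hU s hs z hz
      simp only [smul_zero, add_zero] at this
      rw [← this])
    (fun z hz ↦ by simp [h.zero z hz])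
  refine ⟨rX, rV, hrX, hrV, fun s hs z hz ↦ ⟨?_, ?_⟩⟩
  · rw [← sub_eq_iff_eq_add']
    exact hX s hs z hz
  · rw [← sub_eq_iff_eq_add']
    simpa using hV s hs z hz

/-- Expansion of the endpoint of two consecutive sides. -/
theorem exists_two_step_taylor (h : IsFlowOn Γ O a N ψ) (hO : IsOpen O) (hΓ : ContDiffOn ℝ ∞ Γ O)
    {b : ℝ} (hb : 0 < b) (hba : b ≤ a) {W : Set (E × (E × E))} (hW : IsOpen W) (hWN : W ⊆ N)
    (hWN' : ∀ s ∈ Ioo (-b) b, ∀ z ∈ W, quarterTurn (ψ s z) ∈ N) :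
    ∃ r : ℝ × (E × (E × E)) → E, ContDiffOn ℝ ∞ r (Ioo (-b) b ×ˢ W) ∧
      ∀ s ∈ Ioo (-b) b, ∀ z ∈ W, (ψ s (quarterTurn (ψ s z))).1 =
        z.1 + s • (z.2.1 + z.2.2) +
        s ^ 2 • ((1 / 2 : ℝ) • (-Γ z.1 z.2.1 z.2.1) + -Γ z.1 z.2.2 z.2.1 +
          (1 / 2 : ℝ) • (-Γ z.1 z.2.2 z.2.2)) +
        s ^ 3 • ((1 / 6 : ℝ) • geodesicJerk Γ z.1 z.2.1 + (1 / 6 : ℝ) • geodesicJerk Γ z.1 z.2.2 +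
          (1 / 2 : ℝ) • transportJerk Γ z.1 z.2.1 z.2.2 +
          (1 / 2 : ℝ) • christoffelVariation Γ z.1 z.2.1 z.2.2 (-Γ z.1 z.2.2 z.2.1) z.2.2
            (-Γ z.1 z.2.2 z.2.1)) + s ^ 4 • r (s, z) := by
  have ha : 0 < a := hb.trans_le hba
  have hsub : Ioo (-b) b ⊆ Ioo (-a) a := Ioo_subset_Ioo (by linarith) hba
  have hD : Ioo (-b) b ×ˢ W ⊆ Ioo (-a) a ×ˢ N := prod_mono hsub hWN
  obtain ⟨rX, rV, hrX, hrV, hT⟩ := h.exists_taylor hO hΓ ha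
  have h0b : (0 : ℝ) ∈ Ioo (-b) b := ⟨by linarith, hb⟩
  have hψ := h.contDiffOn.mono hD
  have hx := hψ.fst
  have hv := hψ.snd.snd
  have hxO : MapsTo (fun p : ℝ × (E × (E × E)) ↦ (ψ p.1 p.2).1) (Ioo (-b) b ×ˢ W) O :=
    fun p hp ↦ h.mem _ (hsub hp.1) _ (hWN hp.2)
  have hd := fun (z : E × (E × E)) (hz : z ∈ W) ↦ h.hasDerivAt_components (hsub h0b) (hWN hz)
  -- The second side starts at the moving point `ψ s z` with velocity the transported `v`. Its
  -- acceleration enters with a factor `s ^ 2 / 2` and its jerk with `s ^ 3 / 6`, so orders one and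
  -- zero of their dependence on `s` contribute to the stated coefficients.
  obtain ⟨r₁, hr₁, h₁⟩ := exists_taylor_two
    (h' := fun z ↦ christoffelVariation Γ z.1 z.2.1 z.2.2 (-Γ z.1 z.2.2 z.2.1) z.2.2
            (-Γ z.1 z.2.2 z.2.1)) hW
    (contDiffOn_christoffel_apply hΓ hx hxO hv hv).neg (fun z hz ↦ by
      have := hasDerivAt_neg_christoffel hO hΓ (h.mem 0 (hsub h0b) z (hWN hz)) (hd z hz).1
        (hd z hz).2.2 (hd z hz).2.2
      simpa only [h.zero z (hWN hz)] using this)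
  obtain ⟨r₂, hr₂, h₂⟩ := exists_taylor_one hW (contDiffOn_geodesicJerk hO hΓ hx hxO hv)
  refine ⟨fun p ↦ rX (p.1, quarterTurn (ψ p.1 p.2)) + rX p + rV p + (1 / 2 : ℝ) • r₁ p +
    (1 / 6 : ℝ) • r₂ p, ?_, fun s hs z hz ↦ ?_⟩
  · refine (((?_ : ContDiffOn ℝ ∞ _ _).add (hrX.mono hD)).add (hrV.mono hD)).add
      (hr₁.const_smul _) |>.add (hr₂.const_smul _)
    exact hrX.comp (f := fun p : ℝ × (E × (E × E)) ↦ (p.1, quarterTurn (ψ p.1 p.2)))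
      (contDiffOn_fst.prodMk (contDiff_quarterTurn.comp_contDiffOn hψ))
      fun p hp ↦ ⟨hsub hp.1, hWN' _ hp.1 _ hp.2⟩
  · obtain ⟨e₁, -⟩ := hT s (hsub hs) _ (hWN' s hs z hz)
    obtain ⟨e₂, e₃⟩ := hT s (hsub hs) z (hWN hz)
    have e₄ := h₁ s hs z hz
    have e₅ := h₂ s hs z hz
    simp only [h.zero z (hWN hz)] at e₄ e₅
    rw [e₁]
    simp only [quarterTurn]
    -- The Christoffel terms at `ψ s z` are replaced before the components of `ψ s z`, which occur
    -- inside them.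
    rw [e₄, e₅, e₃, e₂]
    module

end IsFlowOn

end Expansion

/-! ### The gap `P₂ - Q₂` in coordinates, and its effect on a function. -/

section Gap

universe u

variable {E : Type u} [NormedAddCommGroup E] [NormedSpace ℝ E]
  {Γ : E → E →L[ℝ] E →L[ℝ] E} {O : Set E}

/-- The torsion `T(u, v)` in coordinates, at `z = (x, u, v)`. -/
def coordTorsion (Γ : E → E →L[ℝ] E →L[ℝ] E) (z : E × (E × E)) : E :=
  Γ z.1 z.2.2 z.2.1 - Γ z.1 z.2.1 z.2.2

/-- The curvature `R(u, v)w` in coordinates. -/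
def coordCurvature (Γ : E → E →L[ℝ] E →L[ℝ] E) (x u v w : E) : E :=
  fderiv ℝ Γ x u w v - fderiv ℝ Γ x v w u + Γ x (Γ x w v) u - Γ x (Γ x w u) v

/-- The coefficient of `s ^ 3` in the expansion of the endpoint of two consecutive sides. -/
def twoStepThird (Γ : E → E →L[ℝ] E →L[ℝ] E) (z : E × (E × E)) : E :=
  (1 / 6 : ℝ) • geodesicJerk Γ z.1 z.2.1 + (1 / 6 : ℝ) • geodesicJerk Γ z.1 z.2.2 +
    (1 / 2 : ℝ) • transportJerk Γ z.1 z.2.1 z.2.2 +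
    (1 / 2 : ℝ) • christoffelVariation Γ z.1 z.2.1 z.2.2 (-Γ z.1 z.2.2 z.2.1) z.2.2
      (-Γ z.1 z.2.2 z.2.1)

/-- Differentiate the symmetry relation along the line `x + t y`, which stays in the open set `O`
for small `t`. -/
lemma fderiv_christoffel_symm (hO : IsOpen O) (hΓ : ContDiffOn ℝ ∞ Γ O)
    (hsymm : ∀ x ∈ O, ∀ v u, Γ x v u = Γ x u v) {x : E} (hx : x ∈ O) (y v u : E) :
    fderiv ℝ Γ x y v u = fderiv ℝ Γ x y u v := by
  have hline : HasDerivAt (fun t : ℝ ↦ x + t • y) y 0 := by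
    simpa using ((hasDerivAt_id (0 : ℝ)).smul_const y).const_add x
  have h1 : ∀ v u : E, HasDerivAt (fun t : ℝ ↦ Γ (x + t • y) v u) (fderiv ℝ Γ x y v u) 0 := by
    intro v u
    have := hasDerivAt_christoffel_apply (x := fun t : ℝ ↦ x + t • y) (t := 0) hO hΓ (by simpa)
      hline (hasDerivAt_const 0 v) (hasDerivAt_const 0 u)
    simpa using this
  refine (h1 v u).unique ((h1 u v).congr_of_eventuallyEq ?_)
  filter_upwards [hline.continuousAt.eventually_mem (hO.mem_nhds (by simpa))] with t ht
  exact hsymm _ ht v u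

/-- The algebraic source of `-½ R(u, v)(u + v)`: after symmetry has brought the `Γ` and `DΓ` terms
to normal form, the identity is linear. -/
lemma twoStepThird_sub_swapVec (hO : IsOpen O) (hΓ : ContDiffOn ℝ ∞ Γ O)
    (hsymm : ∀ x ∈ O, ∀ v u, Γ x v u = Γ x u v) {z : E × (E × E)} (hz : z.1 ∈ O) :
    twoStepThird Γ z - twoStepThird Γ (swapVec z) =
      -((1 / 2 : ℝ) • coordCurvature Γ z.1 z.2.1 z.2.2 (z.2.1 + z.2.2)) := by
  obtain ⟨x, u, v⟩ := z
  have hs := hsymm x hz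
  have hds := fderiv_christoffel_symm hO hΓ hsymm hz
  simp only [twoStepThird, swapVec, geodesicJerk, transportJerk, christoffelVariation,
    coordCurvature, map_add, map_neg, neg_apply, add_apply]
  rw [hs v u, hs v (Γ x u v), hs v (Γ x u u), hs u (Γ x u v), hs u (Γ x v v), hds u v u, hds v v u]
  module

namespace IsFlowOn

variable {a : ℝ} {N : Set (E × (E × E))} {ψ : ℝ → E × (E × E) → E × (E × E)}

lemma contDiffOn_twoStepThird {W : Set (E × (E × E))} (hO : IsOpen O)
    (hΓ : ContDiffOn ℝ ∞ Γ O) (hW : ∀ z ∈ W, z.1 ∈ O) : ContDiffOn ℝ ∞ (twoStepThird Γ) W := by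
  have hx : ContDiffOn ℝ ∞ (fun z : E × (E × E) ↦ z.1) W := by fun_prop
  have hu : ContDiffOn ℝ ∞ (fun z : E × (E × E) ↦ z.2.1) W := by fun_prop
  have hv : ContDiffOn ℝ ∞ (fun z : E × (E × E) ↦ z.2.2) W := by fun_prop
  have hvu := (contDiffOn_christoffel_apply hΓ hx hW hv hu).neg
  exact ((((contDiffOn_geodesicJerk hO hΓ hx hW hu).const_smul _).add
    ((contDiffOn_geodesicJerk hO hΓ hx hW hv).const_smul _)).add
    ((contDiffOn_transportJerk hO hΓ hx hW hu hv).const_smul _)).add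
    ((contDiffOn_christoffelVariation hO hΓ hx hW hu hv hvu hv hvu).const_smul _)

lemma fst_mem (h : IsFlowOn Γ O a N ψ) (ha : 0 < a) {z : E × (E × E)} (hz : z ∈ N) : z.1 ∈ O := by
  have := h.mem 0 ⟨by linarith, ha⟩ z hz
  rwa [h.zero z hz] at this

/-- Expansion of the gap of a quadrilateral centered at its middle vertex. -/
theorem exists_gap_taylor [CompleteSpace E] (h : IsFlowOn Γ O a N ψ) (hO : IsOpen O)
    (hΓ : ContDiffOn ℝ ∞ Γ O) {b : ℝ} (hb : 0 < b) (hba : b ≤ a) {W : Set (E × (E × E))}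
    (hW : IsOpen W) (hWN : W ⊆ N) (hWN₁ : ∀ s ∈ Ioo (-b) b, ∀ z ∈ W, quarterTurn (ψ s z) ∈ N)
    (hWN₂ : ∀ z ∈ W, quarterTurnInv z ∈ N)
    (hWN₃ : ∀ s ∈ Ioo (-b) b, ∀ z ∈ W, quarterTurnInv (ψ (-s) (quarterTurnInv z)) ∈ N) :
    ∃ r : ℝ × (E × (E × E)) → E, ContDiffOn ℝ ∞ r (Ioo (-b) b ×ˢ W) ∧
      ∀ s ∈ Ioo (-b) b, ∀ z ∈ W, (ψ s (quarterTurn (ψ s z))).1 -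
        (ψ (-s) (quarterTurnInv (ψ (-s) (quarterTurnInv z)))).1 =
        s ^ 2 • (-coordTorsion Γ z) +
        s ^ 3 • (twoStepThird Γ z - twoStepThird Γ (swapVec z)) + s ^ 4 • r (s, z) := by
  have hss : ∀ z : E × (E × E), swapVec (swapVec z) = z := fun z ↦ rfl
  have hrs : ∀ z : E × (E × E), reverse (swapVec z) = quarterTurnInv z := fun z ↦ rfl
  have hrq : ∀ w : E × (E × E), reverse (quarterTurn (reverse w)) = quarterTurnInv w := fun w ↦ by
    simp [reverse, quarterTurn, quarterTurnInv]
  have hrs' : ∀ z : E × (E × E), reverse z = quarterTurnInv (swapVec z) := fun z ↦ rfl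
  obtain ⟨r₁, hr₁, h₁⟩ := h.exists_two_step_taylor hO hΓ hb hba hW hWN hWN₁
  -- `Q₂` is the two-step endpoint for the reversed flow from `(x, v, u)`: the initial data
  -- `quarterTurnInv z = (x, -v, u)` run for time `-s` follow the geodesic of `v` for time `s`.
  obtain ⟨r₂, hr₂, h₂⟩ := h.reversed.exists_two_step_taylor (W := swapVec ⁻¹' W) hO hΓ hb hba
    (hW.preimage (contDiff_swapVec (n := 0)).continuous)
    (fun z hz ↦ by
      change reverse z ∈ N
      rw [hrs']
      exact hWN₂ _ hz)
    (fun s hs z hz ↦ by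
      change reverse (quarterTurn (reverse _)) ∈ N
      rw [hrq, hrs']
      exact hWN₃ s hs _ hz)
  refine ⟨fun p ↦ r₁ p - r₂ (p.1, swapVec p.2), ?_, fun s hs z hz ↦ ?_⟩
  · exact hr₁.sub (hr₂.comp (f := fun p : ℝ × (E × (E × E)) ↦ (p.1, swapVec p.2))
      (contDiff_fst.prodMk (contDiff_swapVec.comp contDiff_snd)).contDiffOn
      fun p hp ↦ ⟨hp.1, hp.2⟩)
  · have e₁ := h₁ s hs z hz
    have e₂ := h₂ s hs (swapVec z) hz
    simp only [hrq, hrs] at e₂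
    rw [e₁, show (ψ (-s) (quarterTurnInv (ψ (-s) (quarterTurnInv z)))).1 = _ from e₂]
    simp only [coordTorsion, twoStepThird, swapVec]
    module

end IsFlowOn

/-- `f b - f a = L (a, b) (b - a)` with `L` smooth. -/
theorem exists_difference_quotient {U : Set E} (hU : IsOpen U) (hUc : Convex ℝ U) {f : E → ℝ}
    (hf : ContDiffOn ℝ ∞ f U) :
    ∃ L : E × E → E →L[ℝ] ℝ, ContDiffOn ℝ ∞ L (U ×ˢ U) ∧ (∀ x ∈ U, L (x, x) = fderiv ℝ f x) ∧
      ∀ x ∈ U, ∀ y ∈ U, f y - f x = L (x, y) (y - x) := by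
  have hf' : ContDiffOn ℝ ∞ (fderiv ℝ f) U := hf.fderiv_of_isOpen hU (by simp)
  have hmem : ∀ x ∈ U, ∀ y ∈ U, ∀ t : unitInterval, segmentCLM E (x, y - x) t ∈ U := by
    intro x hx y hy t
    rw [segmentCLM_apply]
    exact hUc.add_smul_sub_mem hx hy t.2
  have hint : ∀ x ∈ U, ∀ y ∈ U,
      moment (E →L[ℝ] ℝ) 0 (superpose (fderiv ℝ f) (segmentCLM E (x, y - x))) =
      ∫ t in (0 : ℝ)..1, fderiv ℝ f (x + t • (y - x)) := by
    intro x hx y hy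
    rw [moment_apply]
    refine intervalIntegral.integral_congr fun t ht ↦ ?_
    rw [uIcc_of_le zero_le_one] at ht
    simp only [IccExtend_of_mem _ _ ht, pow_zero, one_smul]
    rw [superpose_apply (K := unitInterval) hf'.continuousOn (α := segmentCLM E (x, y - x))
      (hmem x hx y hy)]
    rfl
  -- `L (x, y)` is the mean `∫₀¹ Df(x + t (y - x)) dt`; convexity keeps the segment in `U`.
  refine ⟨fun p ↦ moment (E →L[ℝ] ℝ) 0 (superpose (fderiv ℝ f) (segmentCLM E (p.1, p.2 - p.1))),
    ?_, fun x hx ↦ ?_, fun x hx y hy ↦ ?_⟩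
  · refine (moment (E →L[ℝ] ℝ) 0).contDiff.comp_contDiffOn
      ((contDiffOn_superpose hU hf').comp (f := fun p : E × E ↦ segmentCLM E (p.1, p.2 - p.1))
        ?_ fun p hp ↦ hmem p.1 hp.1 p.2 hp.2)
    exact ((segmentCLM E).contDiff.comp (by fun_prop :
      ContDiff ℝ ∞ fun p : E × E ↦ (p.1, p.2 - p.1))).contDiffOn
  · simp only
    rw [hint x hx x hx]
    simp
  · have hmem' : ∀ t ∈ Icc (0 : ℝ) 1, x + t • (y - x) ∈ U := fun t ht ↦
      hUc.add_smul_sub_mem hx hy ht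
    have hc : ContinuousOn (fun t : ℝ ↦ fderiv ℝ f (x + t • (y - x))) (uIcc 0 1) := by
      rw [uIcc_of_le zero_le_one]
      exact hf'.continuousOn.comp (by fun_prop) hmem'
    have h1 := intervalIntegral.integral_eq_sub_of_hasDerivAt (a := 0) (b := 1)
      (f := fun t : ℝ ↦ f (x + t • (y - x)))
      (f' := fun t ↦ fderiv ℝ f (x + t • (y - x)) (y - x)) (fun t ht ↦ by
        rw [uIcc_of_le zero_le_one] at ht
        refine hasDerivAt_comp_of_contDiffOn hU hf (hmem' t ht) ?_
        simpa using ((hasDerivAt_id t).smul_const (y - x)).const_add x)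
      (hc.clm_apply continuousOn_const).intervalIntegrable
    simp only [one_smul, add_sub_cancel, zero_smul, add_zero] at h1
    simp only
    rw [hint x hx y hy, ← h1, ContinuousLinearMap.intervalIntegral_apply hc.intervalIntegrable]

/-- If `P - Q` is `s ^ k c(z)` up to a multiple of `s ^ (k + 1)`, then `f P - f Q` is
`s ^ k Df(c)` up to a multiple of `s ^ (k + 1)`. -/
theorem exists_pow_expansion_comp {U : Set E} (hU : IsOpen U) (hUc : Convex ℝ U) {f : E → ℝ}
    (hf : ContDiffOn ℝ ∞ f U) {b : ℝ} (hb : 0 < b) {W : Set (E × (E × E))} (hW : IsOpen W)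
    {P Q r : ℝ × (E × (E × E)) → E} {c : E × (E × E) → E} {k : ℕ}
    (hP : ContDiffOn ℝ ∞ P (Ioo (-b) b ×ˢ W)) (hPU : MapsTo P (Ioo (-b) b ×ˢ W) U)
    (hQ : ContDiffOn ℝ ∞ Q (Ioo (-b) b ×ˢ W)) (hQU : MapsTo Q (Ioo (-b) b ×ˢ W) U)
    (hP0 : ∀ z ∈ W, P (0, z) = z.1) (hQ0 : ∀ z ∈ W, Q (0, z) = z.1)
    (hc : ContDiffOn ℝ ∞ c W) (hr : ContDiffOn ℝ ∞ r (Ioo (-b) b ×ˢ W))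
    (h : ∀ s ∈ Ioo (-b) b, ∀ z ∈ W,
      P (s, z) - Q (s, z) = s ^ k • c z + s ^ (k + 1) • r (s, z)) :
    ∃ g : ℝ × (E × (E × E)) → ℝ, ContDiffOn ℝ ∞ g (Ioo (-b) b ×ˢ W) ∧
      ∀ s ∈ Ioo (-b) b, ∀ z ∈ W, f (P (s, z)) - f (Q (s, z)) =
        s ^ k * fderiv ℝ f z.1 (c z) + s ^ (k + 1) * g (s, z) := by
  obtain ⟨L, hL, hL0, hLf⟩ := exists_difference_quotient hU hUc hf
  -- At `s = 0` both points are `z.1`, so `L (Q, P)` is `Df(z.1)` up to a smooth multiple of `s`.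
  have hLs : ContDiffOn ℝ ∞ (fun p ↦ L (Q p, P p)) (Ioo (-b) b ×ˢ W) :=
    hL.comp (hQ.prodMk hP) fun p hp ↦ ⟨hQU hp, hPU hp⟩
  obtain ⟨ρ, hρ, hρ'⟩ := exists_taylor_one hW hLs
  have h0b : (0 : ℝ) ∈ Ioo (-b) b := ⟨by linarith, hb⟩
  refine ⟨fun p ↦ ρ p (c p.2) + L (Q p, P p) (r p), ?_, fun s hs z hz ↦ ?_⟩
  · exact (hρ.clm_apply (hc.comp contDiffOn_snd fun p hp ↦ hp.2)).add (hLs.clm_apply hr)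
  · have hz1 : z.1 ∈ U := hP0 z hz ▸ hPU (show (0, z) ∈ Ioo (-b) b ×ˢ W from ⟨h0b, hz⟩)
    have e := hρ' s hs z hz
    simp only [hP0 z hz, hQ0 z hz, hL0 _ hz1] at e
    rw [hLf _ (hQU ⟨hs, hz⟩) _ (hPU ⟨hs, hz⟩), h s hs z hz, map_add, map_smul, map_smul]
    nth_rewrite 1 [e]
    simp only [add_apply, smul_apply, smul_eq_mul]
    ring

end Gap

/-! ### Iterated turns in coordinates. -/

section Orbits

universe u

variable {E : Type u} [NormedAddCommGroup E] [NormedSpace ℝ E]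
  {Γ : E → E →L[ℝ] E →L[ℝ] E} {O : Set E}

/-- `(s, z) ↦ (s, 𝕋_s z)` in coordinates, for the flow `ψ`. -/
def turnStep (ψ : ℝ → E × (E × E) → E × (E × E)) (p : ℝ × (E × (E × E))) : ℝ × (E × (E × E)) :=
  (p.1, quarterTurn (ψ p.1 p.2))

/-- `(s, z) ↦ (s, 𝕋_s⁻¹ z)` in coordinates, for the flow `ψ`. -/
def turnStepInv (ψ : ℝ → E × (E × E) → E × (E × E)) (p : ℝ × (E × (E × E))) :
    ℝ × (E × (E × E)) :=
  (p.1, ψ (-p.1) (quarterTurnInv p.2))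

/-- `(s, z) ↦ (𝕋_s)^i z` in coordinates, for the flow `ψ`. -/
def turnIter (ψ : ℝ → E × (E × E) → E × (E × E)) : ℤ → ℝ × (E × (E × E)) → E × (E × E)
  | Int.ofNat n, p => ((turnStep ψ)^[n] p).2
  | Int.negSucc n, p => ((turnStepInv ψ)^[n + 1] p).2

/-- All the iterates `(𝕋_s)^i z` for `-2 ≤ i ≤ 4` stay in `G`. -/
def StaysIn (ψ : ℝ → E × (E × E) → E × (E × E)) (G : Set (ℝ × (E × (E × E))))
    (p : ℝ × (E × (E × E))) : Prop :=
  (∀ n ≤ 4, (turnStep ψ)^[n] p ∈ G) ∧ ∀ n ≤ 2, (turnStepInv ψ)^[n] p ∈ G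

lemma contDiffOn_iterate {X : Type*} [NormedAddCommGroup X] [NormedSpace ℝ X] {F : X → X}
    {G D : Set X} (hF : ContDiffOn ℝ ∞ F G) {n : ℕ} (hD : ∀ m < n, ∀ p ∈ D, F^[m] p ∈ G) :
    ContDiffOn ℝ ∞ F^[n] D := by
  induction n with
  | zero => exact contDiffOn_id
  | succ n ih =>
    rw [Function.iterate_succ']
    exact hF.comp (ih fun m hm ↦ hD m (hm.trans n.lt_succ_self)) (hD n n.lt_succ_self)

/-- `F` need not preserve `G`, but its limit map `J` does. For turns, `G` is the slice `s = 0`,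
where a turn reduces to a quarter turn of the vectors. -/
lemma tendsto_iterate {X : Type*} [TopologicalSpace X] {F J : X → X} {G : Set X}
    (hF : ∀ x ∈ G, Tendsto F (𝓝 x) (𝓝 (J x))) (hJ : ∀ x ∈ G, J x ∈ G) (n : ℕ) :
    ∀ x ∈ G, Tendsto F^[n] (𝓝 x) (𝓝 (J^[n] x)) ∧ J^[n] x ∈ G := by
  induction n with
  | zero => exact fun x hx ↦ ⟨tendsto_id, hx⟩
  | succ n ih =>
    intro x hx
    rw [Function.iterate_succ', Function.iterate_succ', Function.comp_apply]
    exact ⟨(hF _ (ih x hx).2).comp (ih x hx).1, hJ _ (ih x hx).2⟩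

namespace IsFlowOn

variable {a : ℝ} {N : Set (E × (E × E))} {ψ : ℝ → E × (E × E) → E × (E × E)}

lemma contDiffOn_turnStep (h : IsFlowOn Γ O a N ψ) :
    ContDiffOn ℝ ∞ (turnStep ψ) (Ioo (-a) a ×ˢ N) :=
  contDiffOn_fst.prodMk (contDiff_quarterTurn.comp_contDiffOn h.contDiffOn)

lemma contDiffOn_turnStepInv (h : IsFlowOn Γ O a N ψ) (hN : ∀ z ∈ N, quarterTurnInv z ∈ N) :
    ContDiffOn ℝ ∞ (turnStepInv ψ) (Ioo (-a) a ×ˢ N) :=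
  contDiffOn_fst.prodMk (h.contDiffOn.comp
    (f := fun p : ℝ × (E × (E × E)) ↦ (-p.1, quarterTurnInv p.2))
    (contDiff_fst.neg.prodMk (contDiff_quarterTurnInv.comp contDiff_snd)).contDiffOn
    fun p hp ↦ ⟨⟨by linarith [hp.1.2], by linarith [hp.1.1]⟩, hN _ hp.2⟩)

/-- At `s = 0` every iterate is a quarter turn, which fixes the base point and preserves `N`;
finitely many open conditions persist nearby. -/
lemma eventually_staysIn (h : IsFlowOn Γ O a N ψ) (ha : 0 < a)
    (hN : ∀ z ∈ N, quarterTurn z ∈ N) (hN' : ∀ z ∈ N, quarterTurnInv z ∈ N) {U : Set E}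
    (hU : IsOpen U) {z₀ : E × (E × E)} (hz₀ : z₀ ∈ N) (hz₀U : z₀.1 ∈ U) :
    ∀ᶠ p in 𝓝 ((0 : ℝ), z₀), StaysIn ψ (Ioo (-a) a ×ˢ (N ∩ Prod.fst ⁻¹' U)) p := by
  have h0a : (0 : ℝ) ∈ Ioo (-a) a := ⟨by linarith, ha⟩
  set G : Set (ℝ × (E × (E × E))) := Ioo (-a) a ×ˢ (N ∩ Prod.fst ⁻¹' U) with hG
  have hGo : IsOpen G := isOpen_Ioo.prod (h.isOpen.inter (hU.preimage continuous_fst))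
  have hopen : IsOpen (Ioo (-a) a ×ˢ N) := isOpen_Ioo.prod h.isOpen
  have key : ∀ {F J : ℝ × (E × (E × E)) → ℝ × (E × (E × E))}, ContDiffOn ℝ ∞ F (Ioo (-a) a ×ˢ N) →
      (∀ z ∈ N, F (0, z) = J (0, z)) → (∀ p ∈ ({0} : Set ℝ) ×ˢ (N ∩ Prod.fst ⁻¹' U),
        J p ∈ ({0} : Set ℝ) ×ˢ (N ∩ Prod.fst ⁻¹' U)) → ∀ n : ℕ,
      ∀ᶠ p in 𝓝 ((0 : ℝ), z₀), F^[n] p ∈ G := by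
    intro F J hF hFJ hJ n
    have := tendsto_iterate (F := F) (J := J) (G := ({0} : Set ℝ) ×ˢ (N ∩ Prod.fst ⁻¹' U))
      (by
        rintro ⟨s, z⟩ ⟨hs, hz⟩
        obtain rfl : s = 0 := hs
        rw [← hFJ z hz.1]
        exact hF.continuousOn.continuousAt (hopen.mem_nhds ⟨h0a, hz.1⟩)) hJ n
      ((0 : ℝ), z₀) ⟨rfl, hz₀, hz₀U⟩
    refine this.1.eventually_mem (hGo.mem_nhds ?_)
    obtain ⟨h1, h2⟩ := this.2
    rw [mem_singleton_iff] at h1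
    exact ⟨by rw [h1]; exact h0a, h2⟩
  have h1 := key (J := fun p ↦ (p.1, quarterTurn p.2)) h.contDiffOn_turnStep
    (fun z hz ↦ by simp [turnStep, h.zero z hz]) fun p hp ↦ ⟨hp.1, hN _ hp.2.1, hp.2.2⟩
  have h2 := key (J := fun p ↦ (p.1, quarterTurnInv p.2)) (h.contDiffOn_turnStepInv hN')
    (fun z hz ↦ by simp [turnStepInv, h.zero _ (hN' z hz)])
    fun p hp ↦ ⟨hp.1, hN' _ hp.2.1, hp.2.2⟩
  have h3 := (eventually_all_finite (finite_Iic 4)).2 fun n _ ↦ h1 n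
  have h4 := (eventually_all_finite (finite_Iic 2)).2 fun n _ ↦ h2 n
  filter_upwards [h3, h4] with p hp hp' using ⟨hp, hp'⟩

lemma exists_staysIn (h : IsFlowOn Γ O a N ψ) (ha : 0 < a)
    (hN : ∀ z ∈ N, quarterTurn z ∈ N) (hN' : ∀ z ∈ N, quarterTurnInv z ∈ N) {U : Set E}
    (hU : IsOpen U) {z₀ : E × (E × E)} (hz₀ : z₀ ∈ N) (hz₀U : z₀.1 ∈ U)
    {S : Set (ℝ × (E × (E × E)))} (hS : S ∈ 𝓝 ((0 : ℝ), z₀)) :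
    ∃ (b : ℝ) (W : Set (E × (E × E))), 0 < b ∧ b ≤ a ∧ IsOpen W ∧ z₀ ∈ W ∧
      ∀ p ∈ Ioo (-b) b ×ˢ W, StaysIn ψ (Ioo (-a) a ×ˢ (N ∩ Prod.fst ⁻¹' U)) p ∧ p ∈ S := by
  have hev := (h.eventually_staysIn ha hN hN' hU hz₀ hz₀U).and hS
  rw [nhds_prod_eq, Filter.eventually_prod_iff] at hev
  obtain ⟨pa, hpa, pb, hpb, hab⟩ := hev
  obtain ⟨ε, hε, hball⟩ := Metric.eventually_nhds_iff_ball.1 hpa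
  obtain ⟨W, hW, hWo, hzW⟩ := eventually_nhds_iff.1 hpb
  refine ⟨min ε a, W, lt_min hε ha, min_le_right _ _, hWo, hzW, fun p hp ↦ ?_⟩
  refine hab (hball _ ?_) (hW _ hp.2)
  rw [mem_ball_zero_iff, Real.norm_eq_abs, abs_lt]
  exact ⟨by linarith [hp.1.1, min_le_left ε a], by linarith [hp.1.2, min_le_left ε a]⟩

lemma turnStep_turnStepInv (h : IsFlowOn Γ O a N ψ) (hO : IsOpen O) (hΓ : ContDiffOn ℝ ∞ Γ O)
    (hN' : ∀ z ∈ N, quarterTurnInv z ∈ N) {p : ℝ × (E × (E × E))} (hp : p ∈ Ioo (-a) a ×ˢ N)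
    (hp' : turnStepInv ψ p ∈ Ioo (-a) a ×ˢ N) : turnStep ψ (turnStepInv ψ p) = p := by
  have h1 := h.neg_apply hO hΓ (s := -p.1) ⟨by linarith [hp.1.2], by linarith [hp.1.1]⟩
    (hN' _ hp.2) hp'.2
  rw [neg_neg] at h1
  simp [turnStep, turnStepInv, h1]

/-- Allows the starting triple to be recovered from its second iterate in
`exists_shifted_congruence`. -/
lemma turnStepInv_turnStep (h : IsFlowOn Γ O a N ψ) (hO : IsOpen O) (hΓ : ContDiffOn ℝ ∞ Γ O)
    (hN' : ∀ z ∈ N, quarterTurnInv z ∈ N) {p : ℝ × (E × (E × E))} (hp : p ∈ Ioo (-a) a ×ˢ N)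
    (hp' : turnStep ψ p ∈ Ioo (-a) a ×ˢ N) : turnStepInv ψ (turnStep ψ p) = p := by
  have h0 : ψ p.1 p.2 ∈ N := by simpa [turnStep] using hN' _ hp'.2
  simp [turnStep, turnStepInv, h.neg_apply hO hΓ hp.1 hp.2 h0]

/-- The iterates `(𝕋_s)^i z`: smoothness, range, and the recursion. -/
theorem turnIter_spec (h : IsFlowOn Γ O a N ψ) (hO : IsOpen O) (hΓ : ContDiffOn ℝ ∞ Γ O)
    (hN' : ∀ z ∈ N, quarterTurnInv z ∈ N) {U : Set E}
    {D : Set (ℝ × (E × (E × E)))}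
    (hD : ∀ p ∈ D, StaysIn ψ (Ioo (-a) a ×ˢ (N ∩ Prod.fst ⁻¹' U)) p) :
    (∀ i ∈ Icc (-2 : ℤ) 4, ContDiffOn ℝ ∞ (turnIter ψ i) D ∧
      ∀ p ∈ D, turnIter ψ i p ∈ N ∧ (turnIter ψ i p).1 ∈ U) ∧
    ∀ i : ℤ, -2 ≤ i → i < 4 → ∀ p ∈ D,
      turnIter ψ (i + 1) p = quarterTurn (ψ p.1 (turnIter ψ i p)) := by
  have hsub : Ioo (-a) a ×ˢ (N ∩ Prod.fst ⁻¹' U) ⊆ Ioo (-a) a ×ˢ N :=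
    prod_mono_right inter_subset_left
  have hfst : ∀ (n : ℕ) (p : ℝ × (E × (E × E))), ((turnStep ψ)^[n] p).1 = p.1 := by
    intro n p
    induction n with
    | zero => rfl
    | succ n ih => rw [Function.iterate_succ', Function.comp_apply]; exact ih
  have hfst' : ∀ (n : ℕ) (p : ℝ × (E × (E × E))), ((turnStepInv ψ)^[n] p).1 = p.1 := by
    intro n p
    induction n with
    | zero => rfl
    | succ n ih => rw [Function.iterate_succ', Function.comp_apply]; exact ih
  refine ⟨fun i hi ↦ ?_, fun i hi hi' p hp ↦ ?_⟩
  · obtain ⟨h1, h2⟩ := hi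
    rcases i with n | n
    · have hn : n ≤ 4 := by simpa using h2
      refine ⟨ContDiffOn.snd (contDiffOn_iterate h.contDiffOn_turnStep
        fun m hm p hp ↦ hsub ((hD p hp).1 m (by omega))), fun p hp ↦ ?_⟩
      exact ((hD p hp).1 n hn).2
    · have hn : n + 1 ≤ 2 := by omega
      refine ⟨ContDiffOn.snd (contDiffOn_iterate (h.contDiffOn_turnStepInv hN')
        fun m hm p hp ↦ hsub ((hD p hp).2 m (by omega))), fun p hp ↦ ?_⟩
      exact ((hD p hp).2 _ hn).2
  · rcases i with n | n
    · change ((turnStep ψ)^[n + 1] p).2 = quarterTurn (ψ p.1 ((turnStep ψ)^[n] p).2)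
      rw [Function.iterate_succ', Function.comp_apply]
      conv_rhs => rw [← hfst n p]
      rfl
    · have hn : n + 1 ≤ 2 := by omega
      -- `Int.negSucc n` is `-(n + 1)`, so raising the index by one leaves `n` inverse steps. The
      -- case `n = 0` passes to the nonnegative branch of `turnIter`.
      have e1 : turnIter ψ (Int.negSucc n + 1) p = ((turnStepInv ψ)^[n] p).2 := by
        rcases n with _ | n
        · rfl
        · rfl
      have e2 := h.turnStep_turnStepInv hO hΓ hN' (hsub ((hD p hp).2 n (by omega)))
        (by
          rw [← Function.iterate_succ_apply' (turnStepInv ψ)]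
          exact hsub ((hD p hp).2 (n + 1) hn))
      rw [← Function.iterate_succ_apply' (turnStepInv ψ)] at e2
      rw [e1, ← e2]
      change quarterTurn (ψ ((turnStepInv ψ)^[n + 1] p).1 _) = _
      rw [hfst']
      rfl

lemma turnIter_zero (h : IsFlowOn Γ O a N ψ) (hN : ∀ z ∈ N, quarterTurn z ∈ N)
    (hN' : ∀ z ∈ N, quarterTurnInv z ∈ N) {z : E × (E × E)} (hzN : z ∈ N) :
    turnIter ψ 2 (0, z) = quarterTurn (quarterTurn z) ∧
      turnIter ψ (-2) (0, z) = quarterTurnInv (quarterTurnInv z) := by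
  constructor
  · change quarterTurn (ψ 0 (quarterTurn (ψ 0 z))) = _
    rw [h.zero z hzN, h.zero _ (hN z hzN)]
  · change ψ (-0) (quarterTurnInv (ψ (-0) (quarterTurnInv z))) = _
    rw [neg_zero, h.zero _ (hN' z hzN), h.zero _ (hN' _ (hN' z hzN))]

variable [CompleteSpace E]

/-- The congruences for the quadrilateral centered at its middle vertex. -/
theorem exists_gap_congruence (h : IsFlowOn Γ O a N ψ) (hO : IsOpen O) (hΓ : ContDiffOn ℝ ∞ Γ O)
    (ha : 0 < a) (hN : ∀ z ∈ N, quarterTurn z ∈ N) (hN' : ∀ z ∈ N, quarterTurnInv z ∈ N)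
    {U : Set E} (hU : IsOpen U) (hUc : Convex ℝ U) {f : E → ℝ}
    (hf : ContDiffOn ℝ ∞ f U) {b : ℝ} (hb : 0 < b) (hba : b ≤ a) {W : Set (E × (E × E))}
    (hW : IsOpen W)
    (hD : ∀ p ∈ Ioo (-b) b ×ˢ W, StaysIn ψ (Ioo (-a) a ×ˢ (N ∩ Prod.fst ⁻¹' U)) p) :
    (∃ g : ℝ × (E × (E × E)) → ℝ, ContDiffOn ℝ ∞ g (Ioo (-b) b ×ˢ W) ∧
      ∀ s ∈ Ioo (-b) b, ∀ z ∈ W, f (turnIter ψ 2 (s, z)).1 - f (turnIter ψ (-2) (s, z)).1 =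
        s ^ 2 * fderiv ℝ f z.1 (-coordTorsion Γ z) + s ^ 3 * g (s, z)) ∧
    ((∀ x ∈ O, ∀ v u, Γ x v u = Γ x u v) →
      ∃ g : ℝ × (E × (E × E)) → ℝ, ContDiffOn ℝ ∞ g (Ioo (-b) b ×ˢ W) ∧
      ∀ s ∈ Ioo (-b) b, ∀ z ∈ W, f (turnIter ψ 2 (s, z)).1 - f (turnIter ψ (-2) (s, z)).1 =
        s ^ 3 * fderiv ℝ f z.1
          (-((1 / 2 : ℝ) • coordCurvature Γ z.1 z.2.1 z.2.2 (z.2.1 + z.2.2))) +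
          s ^ 4 * g (s, z)) := by
  have h0b : (0 : ℝ) ∈ Ioo (-b) b := ⟨by linarith, hb⟩
  have hWN : W ⊆ N := fun z hz ↦ ((hD (0, z) ⟨h0b, hz⟩).1 0 (by omega)).2.1
  have hWO : ∀ z ∈ W, z.1 ∈ O := fun z hz ↦ h.fst_mem ha (hWN hz)
  obtain ⟨r, hr, hr'⟩ := h.exists_gap_taylor hO hΓ hb hba hW hWN
    (fun s hs z hz ↦ ((hD (s, z) ⟨hs, hz⟩).1 1 (by omega)).2.1)
    (fun z hz ↦ hN' z (hWN hz))
    (fun s hs z hz ↦ hN' _ ((hD (s, z) ⟨hs, hz⟩).2 1 (by omega)).2.1)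
  obtain ⟨hspec, -⟩ := h.turnIter_spec hO hΓ hN' hD
  have h2 := hspec 2 (by simp)
  have h3 := hspec (-2) (by simp)
  have hz2 : ∀ z ∈ W, (turnIter ψ 2 (0, z)).1 = z.1 := fun z hz ↦ by
    rw [(h.turnIter_zero hN hN' (hWN hz)).1]; rfl
  have hz3 : ∀ z ∈ W, (turnIter ψ (-2) (0, z)).1 = z.1 := fun z hz ↦ by
    rw [(h.turnIter_zero hN hN' (hWN hz)).2]; rfl
  have hx : ContDiffOn ℝ ∞ (fun z : E × (E × E) ↦ z.1) W := by fun_prop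
  have hu : ContDiffOn ℝ ∞ (fun z : E × (E × E) ↦ z.2.1) W := by fun_prop
  have hv : ContDiffOn ℝ ∞ (fun z : E × (E × E) ↦ z.2.2) W := by fun_prop
  have hthird := contDiffOn_twoStepThird (W := W) hO hΓ hWO
  have hthird' : ContDiffOn ℝ ∞ (fun z ↦ twoStepThird Γ (swapVec z)) W :=
    (contDiffOn_twoStepThird (W := swapVec ⁻¹' W) hO hΓ fun z hz ↦ hWO (swapVec z) hz).comp
      contDiff_swapVec.contDiffOn fun z hz ↦ hz
  have hT : ContDiffOn ℝ ∞ (fun z ↦ -coordTorsion Γ z) W :=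
    ((contDiffOn_christoffel_apply hΓ hx hWO hv hu).sub
      (contDiffOn_christoffel_apply hΓ hx hWO hu hv)).neg
  constructor
  · refine exists_pow_expansion_comp hU hUc hf hb hW (k := 2) h2.1.fst (fun p hp ↦ (h2.2 p hp).2)
      h3.1.fst (fun p hp ↦ (h3.2 p hp).2) hz2 hz3 hT
      -- Modulo `s ^ 3`, the cubic coefficient and the remainder merge into one.
      (r := fun p ↦ (twoStepThird Γ p.2 - twoStepThird Γ (swapVec p.2)) + p.1 • r p)
      (((hthird.sub hthird').comp contDiffOn_snd fun p hp ↦ hp.2).add (contDiffOn_fst.smul hr))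
      fun s hs z hz ↦ ?_
    refine (hr' s hs z hz).trans ?_
    simp only
    module
  · intro hsymm
    have e : ∀ z ∈ W, twoStepThird Γ z - twoStepThird Γ (swapVec z) =
      -((1 / 2 : ℝ) • coordCurvature Γ z.1 z.2.1 z.2.2 (z.2.1 + z.2.2)) := fun z hz ↦
      twoStepThird_sub_swapVec hO hΓ hsymm (hWO z hz)
    refine exists_pow_expansion_comp hU hUc hf hb hW (k := 3) h2.1.fst (fun p hp ↦ (h2.2 p hp).2)
      h3.1.fst (fun p hp ↦ (h3.2 p hp).2) hz2 hz3
      ((hthird.sub hthird').congr fun z hz ↦ (e z hz).symm) hr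
      fun s hs z hz ↦ ?_
    refine (hr' s hs z hz).trans ?_
    rw [e z hz, coordTorsion, hsymm _ (hWO z hz)]
    simp

end IsFlowOn

end Orbits

/-! ### Parity and smoothness of the coordinate tensors. -/

section CoordinateTensors

variable {E : Type*} [NormedAddCommGroup E] [NormedSpace ℝ E]

/-- Oddness under the half turn `(u, v) ↦ (-u, -v)`, the reason for the opposite curvature signs of
`P₂ - Q₂` and `P₄ - P₀`. -/
lemma coordCurvature_neg (Γ : E → E →L[ℝ] E →L[ℝ] E) (x u v w : E) :
    coordCurvature Γ x (-u) (-v) (-w) = -coordCurvature Γ x u v w := by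
  have h (y : E) : fderiv ℝ Γ x (-y) = -fderiv ℝ Γ x y := (fderiv ℝ Γ x).map_neg y
  simp only [coordCurvature, h, map_neg, neg_apply]
  module

lemma contDiffOn_coordCurvature {Γ : E → E →L[ℝ] E →L[ℝ] E} {O : Set E} (hO : IsOpen O)
    (hΓ : ContDiffOn ℝ ∞ Γ O) :
    ContDiffOn ℝ ∞ (fun z : E × (E × E) ↦ coordCurvature Γ z.1 z.2.1 z.2.2 (z.2.1 + z.2.2))
      (Prod.fst ⁻¹' O) := by
  have hx : ContDiffOn ℝ ∞ (fun z : E × (E × E) ↦ z.1) (Prod.fst ⁻¹' O) := by fun_prop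
  have hu : ContDiffOn ℝ ∞ (fun z : E × (E × E) ↦ z.2.1) (Prod.fst ⁻¹' O) := by fun_prop
  have hv : ContDiffOn ℝ ∞ (fun z : E × (E × E) ↦ z.2.2) (Prod.fst ⁻¹' O) := by fun_prop
  have hw := hu.add hv
  have hm : MapsTo (fun z : E × (E × E) ↦ z.1) (Prod.fst ⁻¹' O) O := fun _ hz ↦ hz
  exact (((contDiffOn_fderiv_christoffel_apply hO hΓ hx hm hu hw hv).sub
    (contDiffOn_fderiv_christoffel_apply hO hΓ hx hm hv hw hu)).add
    (contDiffOn_christoffel_apply hΓ hx hm (contDiffOn_christoffel_apply hΓ hx hm hw hv) hu)).sub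
    (contDiffOn_christoffel_apply hΓ hx hm (contDiffOn_christoffel_apply hΓ hx hm hw hu) hv)

lemma contDiffOn_coordTorsion {Γ : E → E →L[ℝ] E →L[ℝ] E} {O : Set E} (hΓ : ContDiffOn ℝ ∞ Γ O) :
    ContDiffOn ℝ ∞ (coordTorsion Γ) (Prod.fst ⁻¹' O) := by
  have hx : ContDiffOn ℝ ∞ (fun z : E × (E × E) ↦ z.1) (Prod.fst ⁻¹' O) := by fun_prop
  have hu : ContDiffOn ℝ ∞ (fun z : E × (E × E) ↦ z.2.1) (Prod.fst ⁻¹' O) := by fun_prop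
  have hv : ContDiffOn ℝ ∞ (fun z : E × (E × E) ↦ z.2.2) (Prod.fst ⁻¹' O) := by fun_prop
  have hm : MapsTo (fun z : E × (E × E) ↦ z.1) (Prod.fst ⁻¹' O) O := fun _ hz ↦ hz
  exact (contDiffOn_christoffel_apply hΓ hx hm hv hu).sub
    (contDiffOn_christoffel_apply hΓ hx hm hu hv)

end CoordinateTensors

/-! ### The congruences in coordinates, for both quadrilaterals. -/

section CoordinateCongruences

universe u

variable {E : Type u} [NormedAddCommGroup E] [NormedSpace ℝ E] [CompleteSpace E]
  {Γ : E → E →L[ℝ] E →L[ℝ] E} {O : Set E}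

namespace IsFlowOn

variable {a : ℝ} {N : Set (E × (E × E))} {ψ : ℝ → E × (E × E) → E × (E × E)}

/-- An expansion of the gap of a quadrilateral centered at its middle vertex gives one of the gap
of a quadrilateral based at its initial vertex. -/
theorem exists_shifted_congruence (h : IsFlowOn Γ O a N ψ) (hO : IsOpen O)
    (hΓ : ContDiffOn ℝ ∞ Γ O) (hN : ∀ z ∈ N, quarterTurn z ∈ N)
    (hN' : ∀ z ∈ N, quarterTurnInv z ∈ N) {U : Set E} (hU : IsOpen U) {f : E → ℝ}
    (hf : ContDiffOn ℝ ∞ f U) {b b' : ℝ} (hb : 0 < b) {W W' : Set (E × (E × E))} (hW : IsOpen W)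
    (hD : ∀ p ∈ Ioo (-b) b ×ˢ W, StaysIn ψ (Ioo (-a) a ×ˢ (N ∩ Prod.fst ⁻¹' U)) p)
    (hD' : ∀ p ∈ Ioo (-b) b ×ˢ W, (turnStep ψ)^[2] p ∈ Ioo (-b') b' ×ˢ W')
    {c : E × (E × E) → E} (hc : ContDiffOn ℝ ∞ c N) {k : ℕ} {g : ℝ × (E × (E × E)) → ℝ}
    (hg : ContDiffOn ℝ ∞ g (Ioo (-b') b' ×ˢ W'))
    (hg' : ∀ s ∈ Ioo (-b') b', ∀ z ∈ W',
      f (turnIter ψ 2 (s, z)).1 - f (turnIter ψ (-2) (s, z)).1 =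
        s ^ k * fderiv ℝ f z.1 (c z) + s ^ (k + 1) * g (s, z)) :
    ∃ g' : ℝ × (E × (E × E)) → ℝ, ContDiffOn ℝ ∞ g' (Ioo (-b) b ×ˢ W) ∧
      ∀ s ∈ Ioo (-b) b, ∀ z ∈ W, f (turnIter ψ 4 (s, z)).1 - f z.1 =
        s ^ k * fderiv ℝ f z.1 (c (quarterTurn (quarterTurn z))) + s ^ (k + 1) * g' (s, z) := by
  have h0b : (0 : ℝ) ∈ Ioo (-b) b := ⟨by linarith, hb⟩
  have hWN : W ⊆ N := fun z hz ↦ ((hD (0, z) ⟨h0b, hz⟩).1 0 (by omega)).2.1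
  have hsub : Ioo (-a) a ×ˢ (N ∩ Prod.fst ⁻¹' U) ⊆ Ioo (-a) a ×ˢ N :=
    prod_mono_right inter_subset_left
  have hF2 : ContDiffOn ℝ ∞ (turnStep ψ)^[2] (Ioo (-b) b ×ˢ W) :=
    contDiffOn_iterate h.contDiffOn_turnStep fun m hm p hp ↦ hsub ((hD p hp).1 m (by omega))
  have h2 := (h.turnIter_spec hO hΓ hN' hD).1 2 (by simp)
  obtain ⟨L, hL, hL'⟩ : ∃ L : ℝ × (E × (E × E)) → E →L[ℝ] ℝ, ContDiffOn ℝ ∞ L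
      (Ioo (-b) b ×ˢ W) ∧ ∀ p, L p = fderiv ℝ f (turnIter ψ 2 p).1 :=
    ⟨_, (hf.fderiv_of_isOpen hU (m := ∞) (by simp)).comp h2.1.fst fun p hp ↦ (h2.2 p hp).2,
      fun _ ↦ rfl⟩
  have hC : ContDiffOn ℝ ∞ (fun p ↦ c (turnIter ψ 2 p)) (Ioo (-b) b ×ˢ W) :=
    hc.comp h2.1 fun p hp ↦ (h2.2 p hp).1
  obtain ⟨ρL, hρL, eL⟩ := exists_taylor_one hW hL
  obtain ⟨ρC, hρC, eC⟩ := exists_taylor_one hW hC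
  refine ⟨fun p ↦ ρL p (c (turnIter ψ 2 p)) + L (0, p.2) (ρC p) + g ((turnStep ψ)^[2] p), ?_,
    fun s hs z hz ↦ ?_⟩
  · refine ((hρL.clm_apply hC).add (ContDiffOn.clm_apply ?_ hρC)).add (hg.comp hF2 hD')
    exact hL.comp (f := fun p : ℝ × (E × (E × E)) ↦ ((0 : ℝ), p.2)) (by fun_prop)
      fun p hp ↦ ⟨h0b, hp.2⟩
  · have hp : (s, z) ∈ Ioo (-b) b ×ˢ W := ⟨hs, hz⟩
    have hst := hD _ hp
    -- Seen from the middle vertex, two backward turns lead back to the start, and two forward turns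
    -- reach `P₄`.
    have e1 : turnIter ψ (-2) ((turnStep ψ)^[2] (s, z)) = z := by
      change (turnStepInv ψ (turnStepInv ψ (turnStep ψ (turnStep ψ (s, z))))).2 = z
      rw [h.turnStepInv_turnStep hO hΓ hN' (p := turnStep ψ (s, z)) (hsub (hst.1 1 (by omega)))
          (hsub (hst.1 2 (by omega))),
        h.turnStepInv_turnStep hO hΓ hN' (p := (s, z)) (hsub (hst.1 0 (by omega)))
          (hsub (hst.1 1 (by omega)))]
    have e2 : turnIter ψ 2 ((turnStep ψ)^[2] (s, z)) = turnIter ψ 4 (s, z) := rfl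
    have e3 : (turnStep ψ)^[2] (s, z) = (s, turnIter ψ 2 (s, z)) := rfl
    have e4 := hg' s (hD' _ hp).1 (turnIter ψ 2 (s, z)) (hD' _ hp).2
    rw [← e3, e1, e2] at e4
    rw [e4, ← hL']
    have e5 := eL s hs z hz
    have e6 := eC s hs z hz
    have e7 : L (0, z) = fderiv ℝ f z.1 := by
      rw [hL', (h.turnIter_zero hN hN' (hWN hz)).1]
      rfl
    simp only [(h.turnIter_zero hN hN' (hWN hz)).1] at e6
    -- Both `Df` and `c` are evaluated at the moving middle vertex; each is exchanged for its value
    -- at `s = 0` up to a smooth multiple of `s`.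
    have e8 : L (s, z) (c (turnIter ψ 2 (s, z))) =
        fderiv ℝ f z.1 (c (quarterTurn (quarterTurn z))) + s * (L (0, z) (ρC (s, z))) +
          s * ρL (s, z) (c (turnIter ψ 2 (s, z))) := by
      rw [e5]
      simp only [add_apply, smul_apply, smul_eq_mul]
      nth_rewrite 1 [e6]
      rw [map_add, map_smul, e7, smul_eq_mul]
    rw [e8]
    ring

end IsFlowOn

/-- The congruences for the gaps of geodesic quadrilaterals, in coordinates. -/
theorem exists_coordinate_congruences (hO : IsOpen O) (hΓ : ContDiffOn ℝ ∞ Γ O) {x₀ : E}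
    (hx₀ : x₀ ∈ O) (u₀ v₀ : E) {U : Set E} (hU : IsOpen U) (hUc : Convex ℝ U) (hxU : x₀ ∈ U)
    {f : E → ℝ} (hf : ContDiffOn ℝ ∞ f U) :
    ∃ (a b : ℝ) (N W : Set (E × (E × E))) (ψ : ℝ → E × (E × E) → E × (E × E)),
      0 < b ∧ b ≤ a ∧ IsFlowOn Γ O a N ψ ∧ (∀ z ∈ N, quarterTurnInv z ∈ N) ∧
      IsOpen W ∧ (x₀, (u₀, v₀)) ∈ W ∧
      (∀ p ∈ Ioo (-b) b ×ˢ W, StaysIn ψ (Ioo (-a) a ×ˢ (N ∩ Prod.fst ⁻¹' U)) p) ∧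
      (∃ g : ℝ × (E × (E × E)) → ℝ, ContDiffOn ℝ ∞ g (Ioo (-b) b ×ˢ W) ∧
        ∀ s ∈ Ioo (-b) b, ∀ z ∈ W, f (turnIter ψ 2 (s, z)).1 - f (turnIter ψ (-2) (s, z)).1 =
          s ^ 2 * fderiv ℝ f z.1 (-coordTorsion Γ z) + s ^ 3 * g (s, z)) ∧
      (∃ g : ℝ × (E × (E × E)) → ℝ, ContDiffOn ℝ ∞ g (Ioo (-b) b ×ˢ W) ∧
        ∀ s ∈ Ioo (-b) b, ∀ z ∈ W, f (turnIter ψ 4 (s, z)).1 - f z.1 =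
          s ^ 2 * fderiv ℝ f z.1 (-coordTorsion Γ z) + s ^ 3 * g (s, z)) ∧
      ((∀ x ∈ O, ∀ v u, Γ x v u = Γ x u v) →
        (∃ g : ℝ × (E × (E × E)) → ℝ, ContDiffOn ℝ ∞ g (Ioo (-b) b ×ˢ W) ∧
        ∀ s ∈ Ioo (-b) b, ∀ z ∈ W, f (turnIter ψ 2 (s, z)).1 - f (turnIter ψ (-2) (s, z)).1 =
          s ^ 3 * fderiv ℝ f z.1
            (-((1 / 2 : ℝ) • coordCurvature Γ z.1 z.2.1 z.2.2 (z.2.1 + z.2.2))) +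
            s ^ 4 * g (s, z)) ∧
        (∃ g : ℝ × (E × (E × E)) → ℝ, ContDiffOn ℝ ∞ g (Ioo (-b) b ×ˢ W) ∧
        ∀ s ∈ Ioo (-b) b, ∀ z ∈ W, f (turnIter ψ 4 (s, z)).1 - f z.1 =
          s ^ 3 * fderiv ℝ f z.1
            ((1 / 2 : ℝ) • coordCurvature Γ z.1 z.2.1 z.2.2 (z.2.1 + z.2.2)) +
            s ^ 4 * g (s, z))) := by
  -- One radius for both vectors makes `N` invariant under quarter turns; `R` exceeds the norms of
  -- `u₀` and `v₀`.
  set R : ℝ := max ‖u₀‖ ‖v₀‖ + 1 with hR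
  have hR0 : 0 < R := by positivity
  obtain ⟨a, V, ψ, ha, hxV, hψ⟩ := exists_isFlowOn hO hΓ hx₀ hR0
  set N : Set (E × (E × E)) := V ×ˢ (Metric.ball 0 R ×ˢ Metric.ball 0 R) with hNdef
  have hN : ∀ z ∈ N, quarterTurn z ∈ N := by
    rintro ⟨x, u, v⟩ ⟨hx, hu, hv⟩
    exact ⟨hx, hv, by simpa [quarterTurn] using hu⟩
  have hN' : ∀ z ∈ N, quarterTurnInv z ∈ N := by
    rintro ⟨x, u, v⟩ ⟨hx, hu, hv⟩
    exact ⟨hx, by simpa [quarterTurnInv] using hv, hu⟩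
  have hz₀ : (x₀, (u₀, v₀)) ∈ N := by
    refine ⟨hxV, ?_, ?_⟩ <;> rw [mem_ball_zero_iff]
    · exact (le_max_left _ _).trans_lt (lt_add_one _)
    · exact (le_max_right _ _).trans_lt (lt_add_one _)
  -- The centered expansion is also needed near `(x₀, -u₀, -v₀)`, the value at `s = 0` of the second
  -- iterate. The final `W` is shrunk so that second iterates fall into `W₂`.
  obtain ⟨b₂, W₂, hb₂, hba₂, hW₂, hzW₂, hD₂⟩ := hψ.exists_staysIn ha hN hN' hU
    (z₀ := quarterTurn (quarterTurn (x₀, (u₀, v₀)))) (hN _ (hN _ hz₀)) hxU univ_mem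
  have hG := isOpen_Ioo.prod hψ.isOpen (s := Ioo (-a) a)
  have h0a : (0 : ℝ) ∈ Ioo (-a) a := ⟨by linarith, ha⟩
  have hS : (turnStep ψ)^[2] ⁻¹' (Ioo (-b₂) b₂ ×ˢ W₂) ∈ 𝓝 ((0 : ℝ), (x₀, (u₀, v₀))) := by
    have hc : ∀ z ∈ N, Tendsto (turnStep ψ) (𝓝 (0, z)) (𝓝 (0, quarterTurn z)) := fun z hz ↦ by
      have := hψ.contDiffOn_turnStep.continuousOn.continuousAt (hG.mem_nhds
        (show ((0 : ℝ), z) ∈ Ioo (-a) a ×ˢ N from ⟨h0a, hz⟩))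
      have e : turnStep ψ (0, z) = (0, quarterTurn z) := by simp [turnStep, hψ.zero z hz]
      rw [← e]
      exact this
    exact ((hc _ (hN _ hz₀)).comp (hc _ hz₀)) ((isOpen_Ioo.prod hW₂).mem_nhds
      ⟨⟨by linarith, hb₂⟩, hzW₂⟩)
  obtain ⟨b, W, hb, hba, hW, hzW, hD⟩ := hψ.exists_staysIn ha hN hN' hU hz₀ hxU hS
  obtain ⟨hA₁, hA₂⟩ := hψ.exists_gap_congruence hO hΓ ha hN hN' hU hUc hf hb hba hW
    fun p hp ↦ (hD p hp).1
  obtain ⟨⟨g₁, hg₁, hB₁⟩, hB₂⟩ := hψ.exists_gap_congruence hO hΓ ha hN hN' hU hUc hf hb₂ hba₂ hW₂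
    fun p hp ↦ (hD₂ p hp).1
  have hNO : ∀ z ∈ N, z.1 ∈ O := fun z hz ↦ hψ.fst_mem ha hz
  have hT : ContDiffOn ℝ ∞ (fun z ↦ -coordTorsion Γ z) N :=
    ((contDiffOn_coordTorsion hΓ).mono hNO).neg
  refine ⟨a, b, N, W, ψ, hb, hba, hψ, hN', hW, hzW, fun p hp ↦ (hD p hp).1, hA₁, ?_,
    fun hsymm ↦ ⟨hA₂ hsymm, ?_⟩⟩
  · obtain ⟨g, hg, hg'⟩ := hψ.exists_shifted_congruence hO hΓ hN hN' hU hf hb hW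
      (fun p hp ↦ (hD p hp).1) (fun p hp ↦ (hD p hp).2) hT hg₁ hB₁
    refine ⟨g, hg, fun s hs z hz ↦ (hg' s hs z hz).trans ?_⟩
    simp [coordTorsion, quarterTurn]
  · obtain ⟨g₂, hg₂, hB₂⟩ := hB₂ hsymm
    have hR : ContDiffOn ℝ ∞ (fun z : E × (E × E) ↦
        -((1 / 2 : ℝ) • coordCurvature Γ z.1 z.2.1 z.2.2 (z.2.1 + z.2.2))) N :=
      (((contDiffOn_coordCurvature hO hΓ).mono hNO).const_smul _).neg
    obtain ⟨g, hg, hg'⟩ := hψ.exists_shifted_congruence hO hΓ hN hN' hU hf hb hW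
      (fun p hp ↦ (hD p hp).1) (fun p hp ↦ (hD p hp).2) hR hg₂ hB₂
    refine ⟨g, hg, fun s hs z hz ↦ (hg' s hs z hz).trans ?_⟩
    simp only [quarterTurn, ← neg_add, coordCurvature_neg, smul_neg, neg_neg]

end CoordinateCongruences

/-! ### Vector fields in a chart and the Christoffel map of a connection. -/

section ChartRepresentation

variable {E : Type*} [NormedAddCommGroup E] [NormedSpace ℝ E]
  {M : Type*} [TopologicalSpace M] [ChartedSpace E M] [IsManifold 𝓘(ℝ, E) ∞ M]

/-- The components of a tangent vector at `y` in the preferred chart at `x₀`. -/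
def tanCoord (x₀ y : M) : TangentSpace 𝓘(ℝ, E) y →L[ℝ] E :=
  (trivializationAt E (TangentSpace 𝓘(ℝ, E) : M → Type _) x₀).continuousLinearMapAt ℝ y

/-- The tangent vector at `y` with given components in the preferred chart at `x₀`. -/
def tanVec (x₀ y : M) : E →L[ℝ] TangentSpace 𝓘(ℝ, E) y :=
  (trivializationAt E (TangentSpace 𝓘(ℝ, E) : M → Type _) x₀).symmL ℝ y

/-- The components of a vector field in the preferred chart at `x₀`. -/
def localRep (x₀ : M) (σ : Π y : M, TangentSpace 𝓘(ℝ, E) y) (ξ : E) : E :=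
  tanCoord x₀ ((chartAt E x₀).symm ξ) (σ ((chartAt E x₀).symm ξ))

variable {x₀ y : M}

lemma tanCoord_tanVec (hy : y ∈ (chartAt E x₀).source) (w : E) :
    tanCoord x₀ y (tanVec x₀ y w) = w :=
  Trivialization.continuousLinearMapAt_symmL _ hy w

lemma tanVec_tanCoord (hy : y ∈ (chartAt E x₀).source) (X : TangentSpace 𝓘(ℝ, E) y) :
    tanVec x₀ y (tanCoord x₀ y X) = X :=
  Trivialization.symmL_continuousLinearMapAt _ hy X

lemma tanCoord_injective (hy : y ∈ (chartAt E x₀).source) :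
    Function.Injective (tanCoord (E := E) x₀ y) :=
  Function.LeftInverse.injective (g := tanVec x₀ y) fun X ↦ tanVec_tanCoord hy X

lemma trivializationAt_snd (hy : y ∈ (chartAt E x₀).source) (X : TangentSpace 𝓘(ℝ, E) y) :
    (trivializationAt E (TangentSpace 𝓘(ℝ, E) : M → Type _) x₀ ⟨y, X⟩).2 = tanCoord x₀ y X := by
  rw [tanCoord, Trivialization.continuousLinearMapAt_apply, Trivialization.coe_linearMapAt_of_mem]
  exact hy

lemma tanCoord_eq_mfderiv (hy : y ∈ (chartAt E x₀).source) :
    tanCoord x₀ y = mfderiv 𝓘(ℝ, E) 𝓘(ℝ, E) (chartAt E x₀) y :=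
  TangentBundle.continuousLinearMapAt_trivializationAt hy

lemma localRep_chartAt (σ : Π y : M, TangentSpace 𝓘(ℝ, E) y) (hy : y ∈ (chartAt E x₀).source) :
    localRep x₀ σ (chartAt E x₀ y) = tanCoord x₀ y (σ y) := by
  rw [localRep, (chartAt E x₀).left_inv hy]

lemma mdifferentiableAt_iff_comp_symm {F : Type*} [NormedAddCommGroup F] [NormedSpace ℝ F]
    {g : M → F} (hy : y ∈ (chartAt E x₀).source) :
    MDifferentiableAt 𝓘(ℝ, E) 𝓘(ℝ, F) g y ↔
      DifferentiableAt ℝ (g ∘ (chartAt E x₀).symm) (chartAt E x₀ y) := by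
  have hφ : MDifferentiableAt 𝓘(ℝ, E) 𝓘(ℝ, E) (chartAt E x₀) y :=
    mdifferentiableAt_atlas (chart_mem_atlas E x₀) hy
  have hφ' : MDifferentiableAt 𝓘(ℝ, E) 𝓘(ℝ, E) (chartAt E x₀).symm (chartAt E x₀ y) :=
    mdifferentiableAt_atlas_symm (chart_mem_atlas E x₀) ((chartAt E x₀).map_source hy)
  rw [← mdifferentiableAt_iff_differentiableAt]
  constructor
  · intro h
    exact MDifferentiableAt.comp (I' := 𝓘(ℝ, E)) _ (by rwa [(chartAt E x₀).left_inv hy]) hφ'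
  · intro h
    refine (MDifferentiableAt.comp (I' := 𝓘(ℝ, E)) _ h hφ).congr_of_eventuallyEq ?_
    filter_upwards [(chartAt E x₀).open_source.mem_nhds hy] with z hz
    simp [(chartAt E x₀).left_inv hz]

lemma dirDeriv_eq_fderiv {F : Type*} [NormedAddCommGroup F] [NormedSpace ℝ F]
    {g : M → F} (hy : y ∈ (chartAt E x₀).source) (hg : MDifferentiableAt 𝓘(ℝ, E) 𝓘(ℝ, F) g y)
    (X : TangentSpace 𝓘(ℝ, E) y) :
    dirDeriv g y X = fderiv ℝ (g ∘ (chartAt E x₀).symm) (chartAt E x₀ y) (tanCoord x₀ y X) := by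
  have hφ : MDifferentiableAt 𝓘(ℝ, E) 𝓘(ℝ, E) (chartAt E x₀) y :=
    mdifferentiableAt_atlas (chart_mem_atlas E x₀) hy
  have h := ((mdifferentiableAt_iff_comp_symm hy).1 hg).mdifferentiableAt
  have e : g =ᶠ[𝓝 y] (g ∘ (chartAt E x₀).symm) ∘ chartAt E x₀ := by
    filter_upwards [(chartAt E x₀).open_source.mem_nhds hy] with z hz
    simp [(chartAt E x₀).left_inv hz]
  have e2 := (mfderiv_comp y h hφ)
  rw [← e.mfderiv_eq, mfderiv_eq_fderiv] at e2
  rw [tanCoord_eq_mfderiv hy]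
  exact congr($e2 X)

lemma mdifferentiableAt_section_iff_localRep {σ : Π y : M, TangentSpace 𝓘(ℝ, E) y}
    (hy : y ∈ (chartAt E x₀).source) :
    MDifferentiableAt 𝓘(ℝ, E) (𝓘(ℝ, E).prod 𝓘(ℝ, E))
      (fun z ↦ (⟨z, σ z⟩ : TotalSpace E (TangentSpace 𝓘(ℝ, E) : M → Type _))) y ↔
      DifferentiableAt ℝ (localRep x₀ σ) (chartAt E x₀ y) := by
  rw [(trivializationAt E (TangentSpace 𝓘(ℝ, E) : M → Type _) x₀).mdifferentiableAt_section_iff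
    𝓘(ℝ, E) σ hy, mdifferentiableAt_iff_comp_symm hy]
  refine Filter.EventuallyEq.differentiableAt_iff ?_
  filter_upwards [(chartAt E x₀).open_target.mem_nhds ((chartAt E x₀).map_source hy)] with ξ hξ
  exact trivializationAt_snd ((chartAt E x₀).map_target hξ) _

lemma contMDiffOn_iff_comp_symm {F : Type*} [NormedAddCommGroup F] [NormedSpace ℝ F]
    {g : M → F} {s : Set M} (hs : s ⊆ (chartAt E x₀).source) :
    ContMDiffOn 𝓘(ℝ, E) 𝓘(ℝ, F) ∞ g s ↔
      ContDiffOn ℝ ∞ (g ∘ (chartAt E x₀).symm) (chartAt E x₀ '' s) := by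
  rw [contMDiffOn_iff_of_mem_maximalAtlas' (IsManifold.chart_mem_maximalAtlas x₀)
    (IsManifold.chart_mem_maximalAtlas (g x₀)) hs (fun _ _ ↦ mem_univ _)]
  rfl

/-- The vector field with constant components in the preferred chart at `x₀`. -/
def constField (x₀ : M) (w : E) (y : M) : TangentSpace 𝓘(ℝ, E) y := tanVec x₀ y w

lemma localRep_constField (x₀ : M) (w : E) {ξ : E} (hξ : ξ ∈ (chartAt E x₀).target) :
    localRep x₀ (constField x₀ w) ξ = w :=
  tanCoord_tanVec ((chartAt E x₀).map_target hξ) w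

/-- Brings the extensions used in `curvature` and `covDerivAlong` to constant-coefficient fields,
but only in the chart at the base point `x` itself. -/
lemma extend_eq_constField {x : M} (v : TangentSpace 𝓘(ℝ, E) x) (hy : y ∈ (chartAt E x).source) :
    FiberBundle.extend E v y = constField x (tanCoord x x v) y := by
  rw [FiberBundle.extend, trivializationAt_snd (mem_chart_source E x)]
  exact (Trivialization.symmL_apply _ hy _).symm

lemma contMDiffOn_section_iff_localRep {σ : Π y : M, TangentSpace 𝓘(ℝ, E) y} {s : Set M}
    (ho : IsOpen s) (hs : s ⊆ (chartAt E x₀).source) :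
    ContMDiffOn 𝓘(ℝ, E) (𝓘(ℝ, E).prod 𝓘(ℝ, E)) ∞
      (fun z ↦ (⟨z, σ z⟩ : TotalSpace E (TangentSpace 𝓘(ℝ, E) : M → Type _))) s ↔
      ContDiffOn ℝ ∞ (localRep x₀ σ) (chartAt E x₀ '' s) := by
  rw [(trivializationAt E (TangentSpace 𝓘(ℝ, E) : M → Type _) x₀).contMDiffOn_section_iff
    ho hs, contMDiffOn_iff_comp_symm hs]
  refine contDiffOn_congr ?_
  rintro _ ⟨z, hz, rfl⟩
  exact trivializationAt_snd ((chartAt E x₀).map_target ((chartAt E x₀).map_source (hs hz))) _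

lemma contMDiffOn_constField (x₀ : M) (w : E) :
    ContMDiffOn 𝓘(ℝ, E) (𝓘(ℝ, E).prod 𝓘(ℝ, E)) ∞
      (fun z ↦ (⟨z, constField x₀ w z⟩ : TotalSpace E (TangentSpace 𝓘(ℝ, E) : M → Type _)))
      (chartAt E x₀).source := by
  rw [contMDiffOn_section_iff_localRep (chartAt E x₀).open_source subset_rfl]
  refine (contDiffOn_const (c := w)).congr ?_
  rintro _ ⟨z, hz, rfl⟩
  exact localRep_constField x₀ w ((chartAt E x₀).map_source hz)

lemma mdifferentiableAt_constField (w : E) (hy : y ∈ (chartAt E x₀).source) :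
    MDifferentiableAt 𝓘(ℝ, E) (𝓘(ℝ, E).prod 𝓘(ℝ, E))
      (fun z ↦ (⟨z, constField x₀ w z⟩ : TotalSpace E (TangentSpace 𝓘(ℝ, E) : M → Type _))) y :=
  ((contMDiffOn_constField x₀ w).contMDiffAt
    ((chartAt E x₀).open_source.mem_nhds hy)).mdifferentiableAt (by simp)

/-- The flat covariant derivative of the preferred chart at `x₀`. -/
def flatDeriv (x₀ : M) (σ : Π y : M, TangentSpace 𝓘(ℝ, E) y) (y : M) :
    TangentSpace 𝓘(ℝ, E) y →L[ℝ] TangentSpace 𝓘(ℝ, E) y :=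
  (tanVec x₀ y).comp ((fderiv ℝ (localRep x₀ σ) (chartAt E x₀ y)).comp (tanCoord x₀ y))

lemma isCovariantDerivativeOn_flatDeriv (x₀ : M) :
    IsCovariantDerivativeOn E (I := 𝓘(ℝ, E)) (flatDeriv x₀) (chartAt E x₀).source where
  add {σ σ' y} hσ hσ' hy := by
    have h := (mdifferentiableAt_section_iff_localRep hy).1 hσ
    have h' := (mdifferentiableAt_section_iff_localRep hy).1 hσ'
    have e : localRep x₀ (σ + σ') = localRep x₀ σ + localRep x₀ σ' := by
      funext ξ
      simp [localRep]
    ext X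
    simp [flatDeriv, e, fderiv_add h h']
  leibniz {σ g y} hσ hg hy := by
    have h := (mdifferentiableAt_section_iff_localRep hy).1 hσ
    have h' := (mdifferentiableAt_iff_comp_symm hy).1 hg
    have e : localRep x₀ (g • σ) = fun ξ ↦ (g ∘ (chartAt E x₀).symm) ξ • localRep x₀ σ ξ := by
      funext ξ
      simp [localRep]
    ext X
    have e2 := dirDeriv_eq_fderiv hy hg X
    rw [dirDeriv] at e2
    simp only [flatDeriv, e, ContinuousLinearMap.comp_apply, fderiv_fun_smul h' h]
    simp [e2, (chartAt E x₀).left_inv hy, localRep_chartAt σ hy, tanVec_tanCoord hy]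

variable [FiniteDimensional ℝ E]
  (cov : CovariantDerivative 𝓘(ℝ, E) E (TangentSpace 𝓘(ℝ, E) : M → Type _))

/-- Smoothness of the connection is applied to a globally smooth field, obtained from `σ` by a bump
function equal to `1` near the point; locality of the covariant derivative removes the cutoff. -/
lemma contMDiffOn_cov_apply [T2Space M] [CovariantDerivative.ContMDiffCovariantDerivative cov ∞]
    {s : Set M} (hs : IsOpen s) {σ X : Π y : M, TangentSpace 𝓘(ℝ, E) y}
    (hσ : ContMDiffOn 𝓘(ℝ, E) (𝓘(ℝ, E).prod 𝓘(ℝ, E)) ∞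
      (fun z ↦ (⟨z, σ z⟩ : TotalSpace E (TangentSpace 𝓘(ℝ, E) : M → Type _))) s)
    (hX : ContMDiffOn 𝓘(ℝ, E) (𝓘(ℝ, E).prod 𝓘(ℝ, E)) ∞
      (fun z ↦ (⟨z, X z⟩ : TotalSpace E (TangentSpace 𝓘(ℝ, E) : M → Type _))) s) :
    ContMDiffOn 𝓘(ℝ, E) (𝓘(ℝ, E).prod 𝓘(ℝ, E)) ∞
      (fun z ↦ (⟨z, cov σ z (X z)⟩ : TotalSpace E (TangentSpace 𝓘(ℝ, E) : M → Type _))) s := by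
  intro y hy
  refine ContMDiffAt.contMDiffWithinAt ?_
  obtain ⟨χ, -, hχ⟩ := (SmoothBumpFunction.nhds_basis_tsupport (I := 𝓘(ℝ, E)) y).mem_iff.1
    (hs.mem_nhds hy)
  have hχσ := ContMDiffOn.smul_section_of_tsupport (χ.contMDiff.contMDiffOn (s := s)) hs hχ hσ
  have h1 := (CovariantDerivative.ContMDiffCovariantDerivative.contMDiff
    (cov := cov) (k := ∞)).contMDiff (σ := (χ : M → ℝ) • σ) (by simpa using hχσ.contMDiffOn)
  have h2 := (h1.contMDiffAt univ_mem).clm_bundle_apply (hX.contMDiffAt (hs.mem_nhds hy))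
  refine h2.congr_of_eventuallyEq ?_
  have h3 : ∀ᶠ z in 𝓝 y, χ z = 1 := χ.eventuallyEq_one
  filter_upwards [h3.eventually_nhds, hs.mem_nhds hy] with z hz hzs
  have : cov σ z = cov ((χ : M → ℝ) • σ) z := by
    refine cov.isCovariantDerivativeOnUniv.congr_of_eventuallyEq
      ((hσ.contMDiffAt (hs.mem_nhds hzs)).mdifferentiableAt (by simp))
      (hχσ.contMDiffAt.mdifferentiableAt (by simp)) univ_mem ?_
    filter_upwards [hz] with z' hz'
    simp [hz']
  rw [this]

/-- `Γ` is the Christoffel map of `cov` in the preferred chart at `x₀`. -/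
structure IsChristoffel (x₀ : M) (Γ : E → E →L[ℝ] E →L[ℝ] E) : Prop where
  contDiffOn : ContDiffOn ℝ ∞ Γ (chartAt E x₀).target
  tanCoord_cov : ∀ {y : M} {σ : Π y : M, TangentSpace 𝓘(ℝ, E) y}, y ∈ (chartAt E x₀).source →
    MDifferentiableAt 𝓘(ℝ, E) (𝓘(ℝ, E).prod 𝓘(ℝ, E))
      (fun z ↦ (⟨z, σ z⟩ : TotalSpace E (TangentSpace 𝓘(ℝ, E) : M → Type _))) y →
    ∀ X : TangentSpace 𝓘(ℝ, E) y, tanCoord x₀ y (cov σ y X) =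
      fderiv ℝ (localRep x₀ σ) (chartAt E x₀ y) (tanCoord x₀ y X) +
        Γ (chartAt E x₀ y) (tanCoord x₀ y (σ y)) (tanCoord x₀ y X)

/-- The difference of two covariant derivatives is tensorial; here the second is the flat one of the
chart. In finite dimension a bilinear map is continuous, and smoothness of `Γ` may be tested on
fixed vectors. -/
theorem exists_isChristoffel [T2Space M] [CovariantDerivative.ContMDiffCovariantDerivative cov ∞]
    (x₀ : M) : ∃ Γ : E → E →L[ℝ] E →L[ℝ] E, IsChristoffel cov x₀ Γ := by
  let D := IsCovariantDerivativeOn.difference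
    (cov.isCovariantDerivativeOn (s := (chartAt E x₀).source))
    (isCovariantDerivativeOn_flatDeriv x₀)
  have hD : ∀ (y : M) (σ : Π y : M, TangentSpace 𝓘(ℝ, E) y), y ∈ (chartAt E x₀).source →
      MDifferentiableAt 𝓘(ℝ, E) (𝓘(ℝ, E).prod 𝓘(ℝ, E))
        (fun z ↦ (⟨z, σ z⟩ : TotalSpace E (TangentSpace 𝓘(ℝ, E) : M → Type _))) y →
      ∀ X : TangentSpace 𝓘(ℝ, E) y, cov σ y X = flatDeriv x₀ σ y X + D y (σ y) X := by
    intro y σ hy hσ X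
    have := IsCovariantDerivativeOn.difference_apply
      (cov.isCovariantDerivativeOn (s := (chartAt E x₀).source))
      (isCovariantDerivativeOn_flatDeriv x₀) hy hσ
    simp [D, this]
  let Γ : E → E →L[ℝ] E →L[ℝ] E := fun ξ ↦ LinearMap.toContinuousBilinearMap
    (LinearMap.mk₂ ℝ (fun w a ↦ tanCoord x₀ ((chartAt E x₀).symm ξ)
      (D ((chartAt E x₀).symm ξ) (tanVec x₀ _ w) (tanVec x₀ _ a)))
      (fun _ _ _ ↦ by simp) (fun _ _ _ ↦ by simp) (fun _ _ _ ↦ by simp) (fun _ _ _ ↦ by simp))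
  have hΓ : ∀ (y : M), y ∈ (chartAt E x₀).source → ∀ w X : TangentSpace 𝓘(ℝ, E) y,
      Γ (chartAt E x₀ y) (tanCoord x₀ y w) (tanCoord x₀ y X) = tanCoord x₀ y (D y w X) := by
    intro y hy w X
    -- The point is made a variable because `(chartAt E x₀).symm (chartAt E x₀ y)` equals `y` only
    -- propositionally, while the tangent spaces depend on it.
    have : ∀ y' : M, y' = y → ∀ w a : E, tanCoord x₀ y' (D y' (tanVec x₀ _ w) (tanVec x₀ _ a)) =
      tanCoord x₀ y (D y (tanVec x₀ _ w) (tanVec x₀ _ a)) := by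
      rintro _ rfl w a
      rfl
    have h2 := this _ ((chartAt E x₀).left_inv hy) (tanCoord x₀ y w) (tanCoord x₀ y X)
    rw [tanVec_tanCoord hy, tanVec_tanCoord hy] at h2
    exact h2
  refine ⟨Γ, ?_, fun {y σ} hy hσ X ↦ ?_⟩
  · rw [contDiffOn_clm_apply]
    intro w
    rw [contDiffOn_clm_apply]
    intro a
    -- A field with constant components has zero flat derivative, so `Γ ξ w a` is the component of
    -- its covariant derivative.
    have h := contMDiffOn_cov_apply cov (chartAt E x₀).open_source (contMDiffOn_constField x₀ w)
      (contMDiffOn_constField x₀ a)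
    rw [contMDiffOn_section_iff_localRep (chartAt E x₀).open_source subset_rfl,
      OpenPartialHomeomorph.image_source_eq_target] at h
    refine h.congr fun ξ hξ ↦ ?_
    have hy := (chartAt E x₀).map_target hξ
    have h1 := hD _ _ hy (mdifferentiableAt_constField w hy) (tanVec x₀ _ a)
    have h2 : localRep x₀ (constField x₀ w) =ᶠ[𝓝 ξ] fun _ ↦ w := by
      filter_upwards [(chartAt E x₀).open_target.mem_nhds hξ] with η hη
      exact localRep_constField x₀ w hη
    rw [localRep, constField, h1, flatDeriv, (chartAt E x₀).right_inv hξ, h2.fderiv_eq]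
    simp [Γ, constField]
  · rw [hD y σ hy hσ X, map_add, hΓ y hy, flatDeriv]
    simp [tanCoord_tanVec hy]

end ChartRepresentation

/-! ### Covariant derivatives along curves, in an arbitrary chart. -/

section ChristoffelFormulas

variable {E : Type*} [NormedAddCommGroup E] [NormedSpace ℝ E]
  {M : Type*} [TopologicalSpace M] [ChartedSpace E M] [IsManifold 𝓘(ℝ, E) ∞ M] {x₀ : M}

lemma hasDerivAt_chartAt_comp {γ : ℝ → M} {t : ℝ} (hγ : MDifferentiableAt 𝓘(ℝ, ℝ) 𝓘(ℝ, E) γ t)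
    (ht : γ t ∈ (chartAt E x₀).source) :
    HasDerivAt (chartAt E x₀ ∘ γ) (tanCoord x₀ (γ t) (velocity γ t)) t := by
  have hφ : MDifferentiableAt 𝓘(ℝ, E) 𝓘(ℝ, E) (chartAt E x₀) (γ t) :=
    mdifferentiableAt_atlas (chart_mem_atlas E x₀) ht
  have h1 := (hφ.comp t hγ).differentiableAt.hasDerivAt
  have h2 := mfderiv_comp t hφ hγ
  rw [mfderiv_eq_fderiv] at h2
  have h3 : deriv (chartAt E x₀ ∘ γ) t = tanCoord x₀ (γ t) (velocity γ t) := by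
    rw [← fderiv_apply_one_eq_deriv, tanCoord_eq_mfderiv ht]
    exact congr($h2 (1 : ℝ))
  rwa [h3] at h1

lemma differentiableAt_coordChange {x y : M} (hx : y ∈ (chartAt E x).source)
    [FiniteDimensional ℝ E] (hx₀ : y ∈ (chartAt E x₀).source) :
    DifferentiableAt ℝ (fun ξ ↦ (tanCoord (E := E) x₀ ((chartAt E x₀).symm ξ)).comp
      (tanVec (E := E) x ((chartAt E x₀).symm ξ))) (chartAt E x₀ y) := by
  have hs := (chartAt E x₀).open_source.inter (chartAt E x).open_source
  have h : ContDiffOn ℝ ∞ (fun ξ ↦ (tanCoord (E := E) x₀ ((chartAt E x₀).symm ξ)).comp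
      (tanVec (E := E) x ((chartAt E x₀).symm ξ)))
      (chartAt E x₀ '' ((chartAt E x₀).source ∩ (chartAt E x).source)) := by
    rw [contDiffOn_clm_apply]
    intro w
    exact (contMDiffOn_section_iff_localRep hs inter_subset_left).1
      ((contMDiffOn_constField x w).mono inter_subset_right)
  refine (h.contDiffAt (((chartAt E x₀).isOpen_image_of_subset_source hs
    inter_subset_left).mem_nhds (mem_image_of_mem _ ⟨hx₀, hx⟩))).differentiableAt (by simp)

variable [FiniteDimensional ℝ E]
  {cov : CovariantDerivative 𝓘(ℝ, E) E (TangentSpace 𝓘(ℝ, E) : M → Type _)}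
  {Γ : E → E →L[ℝ] E →L[ℝ] E}

namespace IsChristoffel

/-- `covDerivAlong` is defined in the chart at `γ t`, which moves with `t`; this transfers it to the
fixed chart at `x₀`. The derivative of the coordinate change is absorbed by the covariant derivative
of the field with constant components in the chart at `γ t`. -/
lemma hasDerivAt_tanCoord (h : IsChristoffel cov x₀ Γ) {γ : ℝ → M}
    {V : Π t : ℝ, TangentSpace 𝓘(ℝ, E) (γ t)} {t : ℝ}
    (hV : MDifferentiableAt 𝓘(ℝ, ℝ) (𝓘(ℝ, E).prod 𝓘(ℝ, E))
      (fun t ↦ (⟨γ t, V t⟩ : TotalSpace E (TangentSpace 𝓘(ℝ, E) : M → Type _))) t)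
    (ht : γ t ∈ (chartAt E x₀).source) :
    HasDerivAt (fun τ ↦ tanCoord x₀ (γ τ) (V τ)) (tanCoord x₀ (γ t) (covDerivAlong cov γ V t) -
      Γ (chartAt E x₀ (γ t)) (tanCoord x₀ (γ t) (V t)) (tanCoord x₀ (γ t) (velocity γ t))) t := by
  set x := γ t with hx
  have hxx : x ∈ (chartAt E x).source := mem_chart_source E x
  obtain ⟨hγ, hV'⟩ := ((trivializationAt E (TangentSpace 𝓘(ℝ, E) : M → Type _)
    x).mdifferentiableAt_totalSpace_iff 𝓘(ℝ, E) _ hxx).1 hV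
  replace hγ : MDifferentiableAt 𝓘(ℝ, ℝ) 𝓘(ℝ, E) γ t := hγ
  set W : ℝ → E := fun τ ↦
    (trivializationAt E (TangentSpace 𝓘(ℝ, E) : M → Type _) x ⟨γ τ, V τ⟩).2 with hW
  have hW' : HasDerivAt W (deriv W t) t := hV'.differentiableAt.hasDerivAt
  -- `B` changes components from the chart at `x = γ t` to the chart at `x₀`; the product rule is
  -- applied to `B` times the components `W`.
  set B : E → E →L[ℝ] E := fun ξ ↦ (tanCoord x₀ ((chartAt E x₀).symm ξ)).comp
      (tanVec x ((chartAt E x₀).symm ξ)) with hB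
  have hB' : HasFDerivAt B (fderiv ℝ B (chartAt E x₀ x)) (chartAt E x₀ x) :=
    (differentiableAt_coordChange hxx ht).hasFDerivAt
  have hBy (y : M) (hy : y ∈ (chartAt E x₀).source) (a : E) :
      B (chartAt E x₀ y) a = tanCoord x₀ y (tanVec x y a) := by
    simp only [hB, ContinuousLinearMap.comp_apply]
    rw [(chartAt E x₀).left_inv hy]
  have h1 := hB'.comp_hasDerivAt t (hasDerivAt_chartAt_comp hγ ht)
  have h2 := h1.clm_apply hW'
  have hWt : W t = tanCoord x x (V t) := trivializationAt_snd hxx _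
  have hB2 : HasFDerivAt (fun ξ ↦ B ξ (W t)) ((fderiv ℝ B (chartAt E x₀ x)).flip (W t))
      (chartAt E x₀ x) := by
    simpa using hB'.clm_apply (hasFDerivAt_const (W t) _)
  have h3 := h.tanCoord_cov ht (FiberBundle.mdifferentiableAt_extend (F := E) 𝓘(ℝ, E) (V t))
    (velocity γ t)
  have h4 : localRep x₀ (FiberBundle.extend E (V t)) =ᶠ[𝓝 (chartAt E x₀ x)] fun ξ ↦ B ξ (W t) := by
    have : ∀ᶠ ξ in 𝓝 (chartAt E x₀ x), (chartAt E x₀).symm ξ ∈ (chartAt E x).source :=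
      ((chartAt E x₀).continuousAt_symm ((chartAt E x₀).map_source ht)).eventually_mem
        ((chartAt E x).open_source.mem_nhds (by rwa [(chartAt E x₀).left_inv ht]))
    filter_upwards [this] with ξ hξ
    simp only [localRep, hB, hWt]
    rw [extend_eq_constField _ hξ]
    rfl
  rw [h4.fderiv_eq, hB2.fderiv] at h3
  have h5 : tanCoord x₀ x (covDerivAlong cov γ V t) -
      Γ (chartAt E x₀ x) (tanCoord x₀ x (V t)) (tanCoord x₀ x (velocity γ t)) =
      (fderiv ℝ B (chartAt E x₀ x)) (tanCoord x₀ (γ t) (velocity γ t)) (W t) +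
        (B ∘ chartAt E x₀ ∘ γ) t (deriv W t) := by
    have : covDerivAlong cov γ V t = tanVec x x (deriv W t) +
        cov (FiberBundle.extend E (V t)) (γ t) (velocity γ t) := by
      rw [covDerivAlong, tanVec, Trivialization.symmL_apply _ hxx]
    rw [this, map_add, h3, FiberBundle.extend_apply_self, ← hBy x ht]
    simp only [ContinuousLinearMap.flip_apply, Function.comp_apply, ← hx]
    abel
  rw [h5]
  refine h2.congr_of_eventuallyEq ?_
  have : ∀ᶠ τ in 𝓝 t, γ τ ∈ (chartAt E x₀).source ∩ (chartAt E x).source :=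
    hγ.continuousAt.eventually_mem (((chartAt E x₀).open_source.inter
      (chartAt E x).open_source).mem_nhds ⟨ht, hxx⟩)
  filter_upwards [this] with τ hτ
  simp only [Function.comp_apply, hW]
  rw [hBy _ hτ.1, trivializationAt_snd hτ.2, tanVec_tanCoord hτ.2]

end IsChristoffel

end ChristoffelFormulas

/-! ### Differentiating a covariant derivative. -/

section CovariantSecondDerivative

variable {E : Type*} [NormedAddCommGroup E] [NormedSpace ℝ E]
  {Γ : E → E →L[ℝ] E →L[ℝ] E} {O : Set E}

lemma hasDerivAt_add_smul (x a : E) : HasDerivAt (fun t : ℝ ↦ x + t • a) a 0 := by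
  simpa using ((hasDerivAt_id (0 : ℝ)).smul_const a).const_add x

/-- The derivative of the coordinate expression of `∇_Y Z`. -/
lemma fderiv_covariant (hO : IsOpen O) (hΓ : ContDiffOn ℝ ∞ Γ O) {Y Z : E → E}
    (hY : ContDiffOn ℝ ∞ Y O) (hZ : ContDiffOn ℝ ∞ Z O) {x : E} (hx : x ∈ O) (a : E) :
    fderiv ℝ (fun ξ ↦ fderiv ℝ Z ξ (Y ξ) + Γ ξ (Z ξ) (Y ξ)) x a =
      fderiv ℝ (fderiv ℝ Z) x a (Y x) + fderiv ℝ Z x (fderiv ℝ Y x a) +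
        (fderiv ℝ Γ x a (Z x) (Y x) + Γ x (fderiv ℝ Z x a) (Y x) +
          Γ x (Z x) (fderiv ℝ Y x a)) := by
  have hdZ := hZ.fderiv_of_isOpen hO (m := ∞) (by simp)
  have hF : ContDiffOn ℝ ∞ (fun ξ ↦ fderiv ℝ Z ξ (Y ξ) + Γ ξ (Z ξ) (Y ξ)) O :=
    (hdZ.clm_apply hY).add (contDiffOn_christoffel_apply hΓ contDiffOn_id (mapsTo_id _) hZ hY)
  have hl := hasDerivAt_add_smul x a
  have hx0 : x + (0 : ℝ) • a ∈ O := by simpa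
  have h1 := hasDerivAt_comp_of_contDiffOn hO hF hx0 hl
  have h2 := (hasDerivAt_comp_of_contDiffOn hO hdZ hx0 hl).clm_apply
    (hasDerivAt_comp_of_contDiffOn hO hY hx0 hl)
  have h3 := hasDerivAt_christoffel_apply hO hΓ hx0 hl
    (hasDerivAt_comp_of_contDiffOn hO hZ hx0 hl) (hasDerivAt_comp_of_contDiffOn hO hY hx0 hl)
  have h4 := h1.unique (h2.add h3)
  simpa using h4

end CovariantSecondDerivative

/-! ### Torsion and curvature in terms of the Christoffel map. -/

section TorsionCurvature

variable {E : Type*} [NormedAddCommGroup E] [NormedSpace ℝ E] [FiniteDimensional ℝ E]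
  {M : Type*} [TopologicalSpace M] [ChartedSpace E M] [IsManifold 𝓘(ℝ, E) ∞ M] {x₀ : M}
  {cov : CovariantDerivative 𝓘(ℝ, E) E (TangentSpace 𝓘(ℝ, E) : M → Type _)}
  {Γ : E → E →L[ℝ] E →L[ℝ] E}

/-- These fields are pullbacks under the chart of constant fields on `E`, and the bracket commutes
with pullback. -/
lemma mlieBracket_constField (a b : E) {y : M} (hy : y ∈ (chartAt E x₀).source) :
    VectorField.mlieBracket 𝓘(ℝ, E) (constField x₀ a) (constField x₀ b) y = 0 := by
  -- The constant field must be read both as a section of the tangent bundle of `E` and as an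
  -- `E`-valued function; the equation links the two types.
  have hconst (c : E) : ∃ V : Π ξ : E, TangentSpace 𝓘(ℝ, E) ξ, V = (fun _ ↦ c : E → E) :=
    ⟨_, rfl⟩
  have hpull : ∀ (c : E) (V : Π ξ : E, TangentSpace 𝓘(ℝ, E) ξ), V = (fun _ ↦ c : E → E) →
      constField (E := E) x₀ c =ᶠ[𝓝 y]
        VectorField.mpullback 𝓘(ℝ, E) 𝓘(ℝ, E) (chartAt E x₀) V := by
    rintro c _ rfl
    filter_upwards [(chartAt E x₀).open_source.mem_nhds hy] with z hz
    have e1 : (tanCoord (E := E) x₀ z).comp (tanVec x₀ z) = ContinuousLinearMap.id ℝ E := by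
      ext w
      simp [tanCoord_tanVec hz]
    have e2 : (tanVec x₀ z).comp (tanCoord (E := E) x₀ z) = ContinuousLinearMap.id ℝ _ := by
      ext w
      simp [tanVec_tanCoord hz]
    have e3 := ContinuousLinearMap.inverse_eq e1 e2
    rw [tanCoord_eq_mfderiv hz] at e3
    exact congr($e3 c).symm
  have hdiff : ∀ (c : E) (V : Π ξ : E, TangentSpace 𝓘(ℝ, E) ξ), V = (fun _ ↦ c : E → E) →
      MDifferentiableAt 𝓘(ℝ, E) (𝓘(ℝ, E).prod 𝓘(ℝ, E)) (fun z ↦ (⟨z, V z⟩ :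
        TotalSpace E (TangentSpace 𝓘(ℝ, E) : E → Type _))) (chartAt E x₀ y) := by
    rintro c _ rfl
    refine (contMDiffAt_vectorSpace_iff_contDiffAt (n := 1).2 ?_).mdifferentiableAt one_ne_zero
    exact contDiffAt_const
  obtain ⟨A, hA⟩ := hconst a
  obtain ⟨B, hB⟩ := hconst b
  rw [Filter.EventuallyEq.mlieBracket_vectorField_eq (hpull a A hA) (hpull b B hB)]
  have hφ : ContMDiffAt 𝓘(ℝ, E) 𝓘(ℝ, E) ∞ (chartAt E x₀) y :=
    contMDiffAt_of_mem_maximalAtlas (IsManifold.chart_mem_maximalAtlas x₀) hy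
  have : IsManifold 𝓘(ℝ, E) (minSmoothness ℝ 2) M := by
    rw [minSmoothness_of_isRCLikeNormedField]
    infer_instance
  rw [← VectorField.mpullback_mlieBracket (n := ∞) (hdiff a A hA) (hdiff b B hB) hφ
    (by rw [minSmoothness_of_isRCLikeNormedField]; exact ENat.LEInfty.out)]
  rw [VectorField.mpullback_apply, ← VectorField.mlieBracketWithin_univ,
    VectorField.mlieBracketWithin_eq_lieBracketWithin, hA, hB]
  have : VectorField.lieBracketWithin ℝ (fun _ : E ↦ a) (fun _ ↦ b) univ = 0 := by
    funext ξ
    simp [VectorField.lieBracketWithin]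
  rw [this]
  exact map_zero _

namespace IsChristoffel

/-- For the constant-coefficient fields through `u` and `v` the bracket and the flat derivatives
vanish; only the `Γ` terms survive. -/
lemma tanCoord_torsion (h : IsChristoffel cov x₀ Γ) {y : M} (hy : y ∈ (chartAt E x₀).source)
    (u v : TangentSpace 𝓘(ℝ, E) y) : tanCoord x₀ y (cov.torsion y u v) =
      coordTorsion Γ (chartAt E x₀ y, (tanCoord x₀ y u, tanCoord x₀ y v)) := by
  have hu := mdifferentiableAt_constField (tanCoord x₀ y u) hy
  have hv := mdifferentiableAt_constField (tanCoord x₀ y v) hy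
  have h1 := cov.torsion_apply hu hv
  have h0 (w : E) : fderiv ℝ (localRep x₀ (constField x₀ w)) (chartAt E x₀ y) = 0 := by
    have : localRep x₀ (constField x₀ w) =ᶠ[𝓝 (chartAt E x₀ y)] fun _ ↦ w := by
      filter_upwards [(chartAt E x₀).open_target.mem_nhds ((chartAt E x₀).map_source hy)] with η hη
      exact localRep_constField x₀ w hη
    rw [this.fderiv_eq, fderiv_const_apply]
  rw [mlieBracket_constField _ _ hy] at h1
  have h2 := congrArg (tanCoord x₀ y) h1
  simp only [map_sub, map_zero, h.tanCoord_cov hy hu, h.tanCoord_cov hy hv, h0] at h2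
  simp only [constField, tanVec_tanCoord hy] at h2
  rw [h2]
  simp [coordTorsion]

/-- The Christoffel map of a torsion-free connection is symmetric. -/
lemma symm (h : IsChristoffel cov x₀ Γ) (hT : ∀ y : M, cov.torsion y = 0) :
    ∀ ξ ∈ (chartAt E x₀).target, ∀ v u, Γ ξ v u = Γ ξ u v := by
  intro ξ hξ v u
  have hy := (chartAt E x₀).map_target hξ
  have h1 := h.tanCoord_torsion hy (tanVec x₀ _ u) (tanVec x₀ _ v)
  rw [hT, tanCoord_tanVec hy, tanCoord_tanVec hy, (chartAt E x₀).right_inv hξ] at h1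
  exact sub_eq_zero.1 (by simpa [coordTorsion] using h1.symm)

/-- Vanishing torsion turns `[X, Y]` into `∇_X Y - ∇_Y X`, so no coordinate formula for the bracket
is needed. Second derivatives of `Z` cancel by their symmetry, and the remaining derivatives of the
fields cancel using the symmetry of `Γ`. -/
lemma tanCoord_curvatureField (h : IsChristoffel cov x₀ Γ) (hT : ∀ y : M, cov.torsion y = 0)
    {s : Set M} (hs : IsOpen s) (hsx : s ⊆ (chartAt E x₀).source)
    {X Y Z : Π y : M, TangentSpace 𝓘(ℝ, E) y}
    (hX : ContMDiffOn 𝓘(ℝ, E) (𝓘(ℝ, E).prod 𝓘(ℝ, E)) ∞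
      (fun z ↦ (⟨z, X z⟩ : TotalSpace E (TangentSpace 𝓘(ℝ, E) : M → Type _))) s)
    (hY : ContMDiffOn 𝓘(ℝ, E) (𝓘(ℝ, E).prod 𝓘(ℝ, E)) ∞
      (fun z ↦ (⟨z, Y z⟩ : TotalSpace E (TangentSpace 𝓘(ℝ, E) : M → Type _))) s)
    (hZ : ContMDiffOn 𝓘(ℝ, E) (𝓘(ℝ, E).prod 𝓘(ℝ, E)) ∞
      (fun z ↦ (⟨z, Z z⟩ : TotalSpace E (TangentSpace 𝓘(ℝ, E) : M → Type _))) s)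
    {y : M} (hy : y ∈ s) : tanCoord x₀ y (curvatureField cov X Y Z y) =
      coordCurvature Γ (chartAt E x₀ y) (tanCoord x₀ y (X y)) (tanCoord x₀ y (Y y))
        (tanCoord x₀ y (Z y)) := by
  have hO : IsOpen (chartAt E x₀ '' s) := (chartAt E x₀).isOpen_image_of_subset_source hs hsx
  have hOt : chartAt E x₀ '' s ⊆ (chartAt E x₀).target := by
    rintro _ ⟨z, hz, rfl⟩
    exact (chartAt E x₀).map_source (hsx hz)
  have hξ : chartAt E x₀ y ∈ chartAt E x₀ '' s := mem_image_of_mem _ hy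
  have hd : ∀ {V : Π y : M, TangentSpace 𝓘(ℝ, E) y},
      ContMDiffOn 𝓘(ℝ, E) (𝓘(ℝ, E).prod 𝓘(ℝ, E)) ∞
        (fun z ↦ (⟨z, V z⟩ : TotalSpace E (TangentSpace 𝓘(ℝ, E) : M → Type _))) s → ∀ z ∈ s,
      MDifferentiableAt 𝓘(ℝ, E) (𝓘(ℝ, E).prod 𝓘(ℝ, E))
        (fun z ↦ (⟨z, V z⟩ : TotalSpace E (TangentSpace 𝓘(ℝ, E) : M → Type _))) z :=
    fun hV z hz ↦ (hV.contMDiffAt (hs.mem_nhds hz)).mdifferentiableAt (by simp)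
  have hrep : ∀ {V : Π y : M, TangentSpace 𝓘(ℝ, E) y}, EqOn (localRep x₀ fun z ↦ cov Z z (V z))
      (fun ξ ↦ fderiv ℝ (localRep x₀ Z) ξ (localRep x₀ V ξ) +
        Γ ξ (localRep x₀ Z ξ) (localRep x₀ V ξ)) (chartAt E x₀ '' s) := by
    rintro V _ ⟨z, hz, rfl⟩
    simp only [localRep_chartAt _ (hsx hz)]
    exact h.tanCoord_cov (hsx hz) (hd hZ z hz) _
  have hX' := (contMDiffOn_section_iff_localRep hs hsx).1 hX
  have hY' := (contMDiffOn_section_iff_localRep hs hsx).1 hY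
  have hZ' := (contMDiffOn_section_iff_localRep hs hsx).1 hZ
  have hΓ := h.contDiffOn.mono hOt
  have hdcov : ∀ {V : Π y : M, TangentSpace 𝓘(ℝ, E) y},
      ContDiffOn ℝ ∞ (localRep x₀ V) (chartAt E x₀ '' s) →
      MDifferentiableAt 𝓘(ℝ, E) (𝓘(ℝ, E).prod 𝓘(ℝ, E)) (fun z ↦ (⟨z, cov Z z (V z)⟩ :
        TotalSpace E (TangentSpace 𝓘(ℝ, E) : M → Type _))) y := by
    intro V hV
    rw [mdifferentiableAt_section_iff_localRep (hsx hy)]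
    refine (ContDiffOn.contDiffAt (n := ∞) (ContDiffOn.congr ?_ hrep)
      (hO.mem_nhds hξ)).differentiableAt (by simp)
    exact ((hZ'.fderiv_of_isOpen hO (m := ∞) (by simp)).clm_apply hV).add
      (contDiffOn_christoffel_apply hΓ contDiffOn_id (mapsTo_id _) hZ' hV)
  have hbr : VectorField.mlieBracket 𝓘(ℝ, E) X Y y = cov Y y (X y) - cov X y (Y y) := by
    have := cov.torsion_apply (hd hX y hy) (hd hY y hy)
    rw [hT] at this
    exact (sub_eq_zero.1 this.symm).symm
  have hsec : ∀ a b : E, fderiv ℝ (fderiv ℝ (localRep x₀ Z)) (chartAt E x₀ y) a b =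
      fderiv ℝ (fderiv ℝ (localRep x₀ Z)) (chartAt E x₀ y) b a := fun a b ↦
    (hZ'.contDiffAt (hO.mem_nhds hξ)).isSymmSndFDerivAt
      (by rw [minSmoothness_of_isRCLikeNormedField]; exact ENat.LEInfty.out) a b
  have hcov2 : ∀ {V : Π y : M, TangentSpace 𝓘(ℝ, E) y},
      ContDiffOn ℝ ∞ (localRep x₀ V) (chartAt E x₀ '' s) → ∀ W : TangentSpace 𝓘(ℝ, E) y,
      tanCoord x₀ y (cov (fun z ↦ cov Z z (V z)) y W) = _ := fun {V} hV W ↦ by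
    rw [h.tanCoord_cov (hsx hy) (hdcov hV) W,
      (hrep.eventuallyEq_of_mem (hO.mem_nhds hξ)).fderiv_eq, fderiv_covariant hO hΓ hV hZ' hξ,
      h.tanCoord_cov (hsx hy) (hd hZ y hy)]
  rw [curvatureField, hbr, map_sub, map_sub, hcov2 hX', hcov2 hY',
    h.tanCoord_cov (hsx hy) (hd hZ y hy), map_sub, h.tanCoord_cov (hsx hy) (hd hX y hy),
    h.tanCoord_cov (hsx hy) (hd hY y hy)]
  simp only [localRep_chartAt _ (hsx hy), coordCurvature, map_add, map_sub, add_apply]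
  rw [hsec (tanCoord x₀ y (X y)) (tanCoord x₀ y (Y y)),
    h.symm hT _ (hOt hξ) (tanCoord x₀ y (X y)) (tanCoord x₀ y (Y y))]
  abel

lemma tanCoord_curvature (h : IsChristoffel cov x₀ Γ) (hT : ∀ y : M, cov.torsion y = 0)
    {y : M} (hy : y ∈ (chartAt E x₀).source) (u v w : TangentSpace 𝓘(ℝ, E) y) :
    tanCoord x₀ y (curvature cov y u v w) =
      coordCurvature Γ (chartAt E x₀ y) (tanCoord x₀ y u) (tanCoord x₀ y v)
        (tanCoord x₀ y w) := by
  have hs := (chartAt E x₀).open_source.inter (chartAt E y).open_source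
  have hext : ∀ u : TangentSpace 𝓘(ℝ, E) y, ContMDiffOn 𝓘(ℝ, E) (𝓘(ℝ, E).prod 𝓘(ℝ, E)) ∞
      (fun z ↦ (⟨z, FiberBundle.extend E u z⟩ :
        TotalSpace E (TangentSpace 𝓘(ℝ, E) : M → Type _)))
      ((chartAt E x₀).source ∩ (chartAt E y).source) := fun u ↦
    ((contMDiffOn_constField y _).mono inter_subset_right).congr fun z hz ↦ by
      rw [extend_eq_constField u hz.2]
  have := h.tanCoord_curvatureField hT hs inter_subset_left (hext u) (hext v) (hext w)
    ⟨hy, mem_chart_source E y⟩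
  rwa [FiberBundle.extend_apply_self, FiberBundle.extend_apply_self,
    FiberBundle.extend_apply_self] at this

end IsChristoffel

end TorsionCurvature

/-! ### Coordinates on `TM ×_M TM`. -/

section TripleChart

variable {E : Type*} [NormedAddCommGroup E] [NormedSpace ℝ E]
  {M : Type*} [TopologicalSpace M] [ChartedSpace E M] [IsManifold 𝓘(ℝ, E) ∞ M]

/-- The coordinates of a triple in the preferred chart at `x₀`. -/
def tripleCoord (x₀ : M) (p : Triple E M) : E × (E × E) :=
  (chartAt E x₀ p.proj, (tanCoord x₀ p.proj p.snd.1, tanCoord x₀ p.proj p.snd.2))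

/-- The triple with given coordinates in the preferred chart at `x₀`. -/
def tripleMk (x₀ : M) (z : E × (E × E)) : Triple E M :=
  ⟨(chartAt E x₀).symm z.1, (tanVec x₀ _ z.2.1, tanVec x₀ _ z.2.2)⟩

/-- `(P, u, v) ↦ (P, v, -u)`. -/
def turnTriple (p : Triple E M) : Triple E M := ⟨p.proj, (p.snd.2, -p.snd.1)⟩

omit [IsManifold 𝓘(ℝ, E) ∞ M] in
lemma turnTriple_injective : Function.Injective (turnTriple : Triple E M → Triple E M) := by
  have : Function.LeftInverse (fun p : Triple E M ↦ (⟨p.proj, (-p.snd.2, p.snd.1)⟩ : Triple E M))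
      turnTriple := by
    rintro ⟨x, u, v⟩
    exact congrArg (fun w : TangentSpace 𝓘(ℝ, E) x ↦ (⟨x, (w, v)⟩ : Triple E M)) (neg_neg u)
  exact this.injective

variable {x₀ : M}

lemma turnTriple_tripleMk (x₀ : M) (z : E × (E × E)) :
    turnTriple (tripleMk x₀ z) = tripleMk x₀ (quarterTurn z) :=
  congrArg (fun w ↦ (⟨(chartAt E x₀).symm z.1, (tanVec x₀ _ z.2.2, w)⟩ : Triple E M))
    (map_neg (tanVec x₀ ((chartAt E x₀).symm z.1)) z.2.1).symm

lemma tripleMk_tripleCoord {p : Triple E M} (hp : p.proj ∈ (chartAt E x₀).source) :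
    tripleMk x₀ (tripleCoord x₀ p) = p := by
  obtain ⟨x, u, v⟩ := p
  have key : ∀ y : M, y = x → (⟨y, (tanVec x₀ y (tanCoord x₀ x u), tanVec x₀ y (tanCoord x₀ x v))⟩ :
      Triple E M) = ⟨x, (u, v)⟩ := by
    rintro _ rfl
    rw [tanVec_tanCoord hp, tanVec_tanCoord hp]
  exact key _ ((chartAt E x₀).left_inv hp)

lemma tripleCoord_tripleMk {z : E × (E × E)} (hz : z.1 ∈ (chartAt E x₀).target) :
    tripleCoord x₀ (tripleMk x₀ z) = z :=
  have h := (chartAt E x₀).map_target hz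
  Prod.ext ((chartAt E x₀).right_inv hz) (Prod.ext (tanCoord_tanVec h _) (tanCoord_tanVec h _))

lemma tripleMk_proj_mem {z : E × (E × E)} (hz : z.1 ∈ (chartAt E x₀).target) :
    (tripleMk x₀ z).proj ∈ (chartAt E x₀).source :=
  (chartAt E x₀).map_target hz

lemma tripleCoord_injOn :
    InjOn (tripleCoord (E := E) x₀) {p | p.proj ∈ (chartAt E x₀).source} := fun p hp q hq h ↦ by
  rw [← tripleMk_tripleCoord hp, h, tripleMk_tripleCoord hq]

lemma contMDiffOn_triple_iff {B H N : Type*} [NormedAddCommGroup B] [NormedSpace ℝ B]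
    [TopologicalSpace H] {I : ModelWithCorners ℝ B H} [TopologicalSpace N] [ChartedSpace H N]
    {f : N → Triple E M} {s : Set N} (hf : ∀ p ∈ s, (f p).proj ∈ (chartAt E x₀).source) :
    ContMDiffOn I (𝓘(ℝ, E).prod 𝓘(ℝ, E × E)) ∞ f s ↔
      ContMDiffOn I 𝓘(ℝ, E × (E × E)) ∞ (fun p ↦ tripleCoord x₀ (f p)) s := by
  have hms : MapsTo f s (trivializationAt (E × E) ((TangentSpace 𝓘(ℝ, E) : M → Type _) ×ᵇ
      (TangentSpace 𝓘(ℝ, E) : M → Type _)) x₀).source := fun p hp ↦ by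
    rw [Trivialization.mem_source]
    exact ⟨hf p hp, hf p hp⟩
  rw [(trivializationAt (E × E) ((TangentSpace 𝓘(ℝ, E) : M → Type _) ×ᵇ
      (TangentSpace 𝓘(ℝ, E) : M → Type _)) x₀).contMDiffOn_iff hms]
  have e2 : ∀ p ∈ s, (trivializationAt (E × E) ((TangentSpace 𝓘(ℝ, E) : M → Type _) ×ᵇ
      (TangentSpace 𝓘(ℝ, E) : M → Type _)) x₀ (f p)).2 = (tripleCoord x₀ (f p)).2 := fun p hp ↦
    Prod.ext (trivializationAt_snd (hf p hp) _) (trivializationAt_snd (hf p hp) _)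
  constructor
  · rintro ⟨h1, h2⟩
    exact ((contMDiffOn_chart (x := x₀)).comp h1 hf).prodMk_space
      (h2.congr fun p hp ↦ (e2 p hp).symm)
  · intro h
    refine ⟨?_, (contDiff_snd.contMDiff.comp_contMDiffOn h).congr e2⟩
    refine ((contMDiffOn_chart_symm (x := x₀)).comp (contDiff_fst.contMDiff.comp_contMDiffOn h)
      fun p hp ↦ (chartAt E x₀).map_source (hf p hp)).congr fun p hp ↦ ?_
    exact ((chartAt E x₀).left_inv (hf p hp)).symm

lemma isOpen_proj_mem (x₀ : M) :
    IsOpen {p : Triple E M | p.proj ∈ (chartAt E x₀).source} :=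
  (chartAt E x₀).open_source.preimage (FiberBundle.continuous_proj (E × E) _)

lemma contMDiffOn_tripleCoord (x₀ : M) :
    ContMDiffOn (𝓘(ℝ, E).prod 𝓘(ℝ, E × E)) 𝓘(ℝ, E × (E × E)) ∞ (tripleCoord (E := E) x₀)
      {p | p.proj ∈ (chartAt E x₀).source} :=
  (contMDiffOn_triple_iff (f := id) fun _ hp ↦ hp).1 contMDiffOn_id

end TripleChart

/-! ### Geodesics as integral curves of the spray, and their uniqueness on `M`. -/

section ParallelCurves

variable {E : Type*} [NormedAddCommGroup E] [NormedSpace ℝ E]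
  {M : Type*} [TopologicalSpace M] [ChartedSpace E M] [IsManifold 𝓘(ℝ, E) ∞ M] {x₀ : M}
  {cov : CovariantDerivative 𝓘(ℝ, E) E (TangentSpace 𝓘(ℝ, E) : M → Type _)}

lemma IsParallelOn.mdifferentiableAt {γ : ℝ → M} {V : Π t : ℝ, TangentSpace 𝓘(ℝ, E) (γ t)}
    {J : Set ℝ} (hJ : IsOpen J) (hV : IsParallelOn cov γ V J) {t : ℝ} (ht : t ∈ J) :
    MDifferentiableAt 𝓘(ℝ, ℝ) (𝓘(ℝ, E).prod 𝓘(ℝ, E))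
      (fun t ↦ (⟨γ t, V t⟩ : TotalSpace E (TangentSpace 𝓘(ℝ, E) : M → Type _))) t :=
  (hV.1.contMDiffAt (hJ.mem_nhds ht)).mdifferentiableAt (by simp)

lemma IsGeodesicOn.mdifferentiableAt {γ : ℝ → M} {J : Set ℝ} (hJ : IsOpen J)
    (hγ : IsGeodesicOn cov γ J) {t : ℝ} (ht : t ∈ J) :
    MDifferentiableAt 𝓘(ℝ, ℝ) 𝓘(ℝ, E) γ t :=
  (hγ.1.contMDiffAt (hJ.mem_nhds ht)).mdifferentiableAt (by simp)

variable [FiniteDimensional ℝ E] {Γ : E → E →L[ℝ] E →L[ℝ] E}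

/-- A geodesic with its velocity and a parallel field is an integral curve of the spray. -/
lemma IsChristoffel.hasDerivAt_tripleCoord (h : IsChristoffel cov x₀ Γ) {γ : ℝ → M}
    {V : Π t : ℝ, TangentSpace 𝓘(ℝ, E) (γ t)} {J : Set ℝ} (hJ : IsOpen J)
    (hγ : IsGeodesicOn cov γ J) (hV : IsParallelOn cov γ V J) {t : ℝ} (ht : t ∈ J)
    (htx : γ t ∈ (chartAt E x₀).source) :
    HasDerivAt (fun τ ↦ tripleCoord x₀ (⟨γ τ, (velocity γ τ, V τ)⟩ : Triple E M))
      (spray Γ (tripleCoord x₀ (⟨γ t, (velocity γ t, V t)⟩ : Triple E M))) t := by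
  have h1 := hasDerivAt_chartAt_comp (hγ.mdifferentiableAt hJ ht) htx
  have h2 := h.hasDerivAt_tanCoord (hγ.2.mdifferentiableAt hJ ht) htx
  have h3 := h.hasDerivAt_tanCoord (hV.mdifferentiableAt hJ ht) htx
  rw [hγ.2.2 t ht, map_zero, zero_sub] at h2
  rw [hV.2 t ht, map_zero, zero_sub] at h3
  exact h1.prodMk (h2.prodMk h3)

/-- Uniqueness of geodesics and parallel transport. -/
theorem eqOn_of_isGeodesicOn [T2Space M] [CovariantDerivative.ContMDiffCovariantDerivative cov ∞]
    {γ γ' : ℝ → M} {V : Π t : ℝ, TangentSpace 𝓘(ℝ, E) (γ t)}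
    {V' : Π t : ℝ, TangentSpace 𝓘(ℝ, E) (γ' t)} {J : Set ℝ} (hJ : IsOpen J)
    (hJc : J.OrdConnected) (hγ : IsGeodesicOn cov γ J) (hV : IsParallelOn cov γ V J)
    (hγ' : IsGeodesicOn cov γ' J) (hV' : IsParallelOn cov γ' V' J) {t₀ : ℝ} (ht₀ : t₀ ∈ J)
    (heq : (⟨γ t₀, (velocity γ t₀, V t₀)⟩ : Triple E M) = ⟨γ' t₀, (velocity γ' t₀, V' t₀)⟩) :
    EqOn (fun t ↦ (⟨γ t, (velocity γ t, V t)⟩ : Triple E M))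
      (fun t ↦ ⟨γ' t, (velocity γ' t, V' t)⟩) J := by
  set c : ℝ → Triple E M := fun t ↦ ⟨γ t, (velocity γ t, V t)⟩ with hc
  set c' : ℝ → Triple E M := fun t ↦ ⟨γ' t, (velocity γ' t, V' t)⟩ with hc'
  have key : ∀ t ∈ J, (∃ᶠ τ in 𝓝 t, c τ = c' τ) → c =ᶠ[𝓝 t] c' := by
    intro t ht hf
    have hγt : ContinuousAt γ t := (hγ.mdifferentiableAt hJ ht).continuousAt
    have hγt' : ContinuousAt γ' t := (hγ'.mdifferentiableAt hJ ht).continuousAt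
    -- In a Hausdorff space two continuous curves that agree at times accumulating at `t` agree at
    -- `t`; one chart then contains both near `t`.
    have hγeq : γ t = γ' t := tendsto_nhds_unique_of_frequently_eq hγt hγt'
      (hf.mono fun τ hτ ↦ congrArg TotalSpace.proj hτ)
    obtain ⟨Γ, hΓ⟩ := exists_isChristoffel cov (γ t)
    have hm : ∀ᶠ τ in 𝓝 t, γ τ ∈ (chartAt E (γ t)).source :=
      hγt.eventually_mem (chart_source_mem_nhds E (γ t))
    have hm' : ∀ᶠ τ in 𝓝 t, γ' τ ∈ (chartAt E (γ t)).source :=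
      hγt'.eventually_mem (by rw [← hγeq]; exact chart_source_mem_nhds E (γ t))
    have hO : IsOpen ((chartAt E (γ t)).target ×ˢ (univ : Set (E × E))) :=
      (chartAt E (γ t)).open_target.prod isOpen_univ
    have := eventuallyEq_of_frequently_eq (α := fun τ ↦ tripleCoord (γ t) (c τ))
      (β := fun τ ↦ tripleCoord (γ t) (c' τ)) (A := spray Γ) (t₀ := t)
      (((contDiffOn_spray hΓ.contDiffOn).contDiffAt (hO.mem_nhds
        ⟨(chartAt E (γ t)).map_source (mem_chart_source E (γ t)), mem_univ _⟩)).of_le (by simp))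
      (by filter_upwards [hm, hJ.mem_nhds ht] with τ h1 h2
          exact hΓ.hasDerivAt_tripleCoord hJ hγ hV h2 h1)
      (by filter_upwards [hm', hJ.mem_nhds ht] with τ h1 h2
          exact hΓ.hasDerivAt_tripleCoord hJ hγ' hV' h2 h1)
      (hf.mono fun τ hτ ↦ congrArg _ hτ)
    filter_upwards [this, hm, hm'] with τ h1 h2 h3
    exact tripleCoord_injOn h2 h3 h1
  have hsub : J ⊆ {t | c =ᶠ[𝓝 t] c'} := by
    refine hJc.isPreconnected.subset_of_closure_inter_subset isOpen_setOfPred_eventually_nhds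
      ⟨t₀, ht₀, key t₀ ht₀ fun hc ↦ hc.self_of_nhds heq⟩ ?_
    rintro t ⟨ht, htJ⟩
    refine key t htJ ((mem_closure_iff_frequently.1 ht).mono fun τ hτ ↦ ?_)
    exact hτ.self_of_nhds
  exact fun t ht ↦ (hsub ht).self_of_nhds

/-- A field along a curve is parallel if its components satisfy the equation of parallel
transport. -/
lemma IsChristoffel.isParallelOn (h : IsChristoffel cov x₀ Γ) {γ : ℝ → M}
    {V : Π t : ℝ, TangentSpace 𝓘(ℝ, E) (γ t)} {J : Set ℝ} (hJ : IsOpen J)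
    (hγ : ContMDiffOn 𝓘(ℝ, ℝ) 𝓘(ℝ, E) ∞ γ J) (hγx : ∀ t ∈ J, γ t ∈ (chartAt E x₀).source)
    {y : ℝ → E} (hy : ContDiffOn ℝ ∞ y J) (hyV : ∀ t ∈ J, tanCoord x₀ (γ t) (V t) = y t)
    (hy' : ∀ t ∈ J, HasDerivAt y (-Γ (chartAt E x₀ (γ t)) (y t)
      (tanCoord x₀ (γ t) (velocity γ t))) t) : IsParallelOn cov γ V J := by
  have hsm : ContMDiffOn 𝓘(ℝ, ℝ) (𝓘(ℝ, E).prod 𝓘(ℝ, E)) ∞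
      (fun t ↦ (⟨γ t, V t⟩ : TotalSpace E (TangentSpace 𝓘(ℝ, E) : M → Type _))) J := by
    rw [(trivializationAt E (TangentSpace 𝓘(ℝ, E) : M → Type _) x₀).contMDiffOn_iff
      fun t ht ↦ hγx t ht]
    refine ⟨hγ, hy.contMDiffOn.congr fun t ht ↦ ?_⟩
    rw [trivializationAt_snd (hγx t ht), hyV t ht]
  refine ⟨hsm, fun t ht ↦ ?_⟩
  have h1 := h.hasDerivAt_tanCoord
    ((hsm.contMDiffAt (hJ.mem_nhds ht)).mdifferentiableAt (by simp)) (hγx t ht)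
  have h2 := h1.unique ((hy' t ht).congr_of_eventuallyEq (by
    filter_upwards [hJ.mem_nhds ht] with τ hτ using hyV τ hτ))
  rw [hyV t ht, sub_eq_neg_self] at h2
  exact tanCoord_injective (hγx t ht) (h2.trans (map_zero _).symm)

end ParallelCurves

/-! ### Turns on the manifold and their uniqueness. -/

section Turns

universe u

variable {E : Type u} [NormedAddCommGroup E] [NormedSpace ℝ E] [FiniteDimensional ℝ E]
  {M : Type*} [TopologicalSpace M] [ChartedSpace E M] [IsManifold 𝓘(ℝ, E) ∞ M] {x₀ : M}
  {cov : CovariantDerivative 𝓘(ℝ, E) E (TangentSpace 𝓘(ℝ, E) : M → Type _)}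
  {Γ : E → E →L[ℝ] E →L[ℝ] E}
  {a : ℝ} {N : Set (E × (E × E))} {ψ : ℝ → E × (E × E) → E × (E × E)}

/-- The flow in the preferred chart at `x₀` consists of geodesics with parallel fields. -/
theorem IsChristoffel.isGeodesicOn_flow (h : IsChristoffel cov x₀ Γ)
    (hψ : IsFlowOn Γ (chartAt E x₀).target a N ψ) {z : E × (E × E)} (hz : z ∈ N) :
    IsGeodesicOn cov (fun t ↦ (tripleMk x₀ (ψ t z)).proj) (Ioo (-a) a) ∧
    IsParallelOn cov (fun t ↦ (tripleMk x₀ (ψ t z)).proj) (fun t ↦ (tripleMk x₀ (ψ t z)).snd.1)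
      (Ioo (-a) a) ∧
    IsParallelOn cov (fun t ↦ (tripleMk x₀ (ψ t z)).proj) (fun t ↦ (tripleMk x₀ (ψ t z)).snd.2)
      (Ioo (-a) a) ∧
    ∀ t ∈ Ioo (-a) a, velocity (fun t ↦ (tripleMk x₀ (ψ t z)).proj) t =
      (tripleMk x₀ (ψ t z)).snd.1 := by
  set γ : ℝ → M := fun t ↦ (tripleMk x₀ (ψ t z)).proj with hγdef
  have hJ : IsOpen (Ioo (-a) a) := isOpen_Ioo
  have hmem : ∀ t ∈ Ioo (-a) a, (ψ t z).1 ∈ (chartAt E x₀).target := fun t ht ↦ hψ.mem t ht z hz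
  have hsrc : ∀ t ∈ Ioo (-a) a, γ t ∈ (chartAt E x₀).source := fun t ht ↦
    tripleMk_proj_mem (hmem t ht)
  have hφγ : ∀ t ∈ Ioo (-a) a, chartAt E x₀ (γ t) = (ψ t z).1 := fun t ht ↦
    (chartAt E x₀).right_inv (hmem t ht)
  have hsm : ContDiffOn ℝ ∞ (fun t ↦ ψ t z) (Ioo (-a) a) :=
    hψ.contDiffOn.comp (f := fun t : ℝ ↦ (t, z)) (by fun_prop) fun t ht ↦ ⟨ht, hz⟩
  have hγ : ContMDiffOn 𝓘(ℝ, ℝ) 𝓘(ℝ, E) ∞ γ (Ioo (-a) a) :=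
    (contMDiffOn_chart_symm (x := x₀)).comp hsm.fst.contMDiffOn hmem
  have hvel : ∀ t ∈ Ioo (-a) a, tanCoord x₀ (γ t) (velocity γ t) = (ψ t z).2.1 := fun t ht ↦ by
    have h1 := hasDerivAt_chartAt_comp
      ((hγ.contMDiffAt (hJ.mem_nhds ht)).mdifferentiableAt (by simp)) (hsrc t ht)
    refine h1.unique ((hψ.hasDerivAt_components ht hz).1.congr_of_eventuallyEq ?_)
    filter_upwards [hJ.mem_nhds ht] with τ hτ using hφγ τ hτ
  have hu : ∀ t ∈ Ioo (-a) a, tanCoord x₀ (γ t) (tripleMk x₀ (ψ t z)).snd.1 = (ψ t z).2.1 :=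
    fun t ht ↦ tanCoord_tanVec (hsrc t ht) _
  have hv : ∀ t ∈ Ioo (-a) a, tanCoord x₀ (γ t) (tripleMk x₀ (ψ t z)).snd.2 = (ψ t z).2.2 :=
    fun t ht ↦ tanCoord_tanVec (hsrc t ht) _
  have hdu : ∀ t ∈ Ioo (-a) a, HasDerivAt (fun t ↦ (ψ t z).2.1) (-Γ (chartAt E x₀ (γ t))
      (ψ t z).2.1 (tanCoord x₀ (γ t) (velocity γ t))) t := fun t ht ↦ by
    rw [hφγ t ht, hvel t ht]
    exact (hψ.hasDerivAt_components ht hz).2.1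
  have hdv : ∀ t ∈ Ioo (-a) a, HasDerivAt (fun t ↦ (ψ t z).2.2) (-Γ (chartAt E x₀ (γ t))
      (ψ t z).2.2 (tanCoord x₀ (γ t) (velocity γ t))) t := fun t ht ↦ by
    rw [hφγ t ht, hvel t ht]
    exact (hψ.hasDerivAt_components ht hz).2.2
  exact ⟨⟨hγ, h.isParallelOn hJ hγ hsrc hsm.snd.fst hvel hdu⟩,
    h.isParallelOn hJ hγ hsrc hsm.snd.fst hu hdu, h.isParallelOn hJ hγ hsrc hsm.snd.snd hv hdv,
    fun t ht ↦ tanCoord_injective (hsrc t ht) ((hvel t ht).trans (hu t ht).symm)⟩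

theorem IsChristoffel.isTurn_tripleMk (h : IsChristoffel cov x₀ Γ)
    (hψ : IsFlowOn Γ (chartAt E x₀).target a N ψ) {z : E × (E × E)} (hz : z ∈ N) {s : ℝ}
    (hs : s ∈ Ioo (-a) a) :
    IsTurn cov s (tripleMk x₀ z) (tripleMk x₀ (quarterTurn (ψ s z))) := by
  have h0 : (0 : ℝ) ∈ Ioo (-a) a := ⟨by linarith [hs.1, hs.2], by linarith [hs.1, hs.2]⟩
  obtain ⟨h1, h2, h3, h4⟩ := h.isGeodesicOn_flow hψ hz
  refine ⟨Ioo (-a) a, _, _, _, isOpen_Ioo, ordConnected_Ioo, h0, hs, h1, h4 0 h0, h2, h3, ?_,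
    (turnTriple_tripleMk x₀ _).symm⟩
  change _ = tripleMk x₀ (ψ 0 z)
  rw [hψ.zero z hz]

/-- `𝕋_s` and its inverse are unique where the flow is defined. -/
theorem IsChristoffel.eq_tripleMk_iff [T2Space M]
    [CovariantDerivative.ContMDiffCovariantDerivative cov ∞] (h : IsChristoffel cov x₀ Γ)
    (hψ : IsFlowOn Γ (chartAt E x₀).target a N ψ) {z : E × (E × E)} (hz : z ∈ N) {s : ℝ}
    (hs : s ∈ Ioo (-a) a) {p q : Triple E M} (hpq : IsTurn cov s p q) :
    p = tripleMk x₀ z ↔ q = tripleMk x₀ (quarterTurn (ψ s z)) := by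
  have h0 : (0 : ℝ) ∈ Ioo (-a) a := ⟨by linarith [hs.1, hs.2], by linarith [hs.1, hs.2]⟩
  obtain ⟨h1, -, h3, h4⟩ := h.isGeodesicOn_flow hψ hz
  obtain ⟨J, γ, u, v, hJ, hJc, h0J, hsJ, hγ, hu0, hu, hv, rfl, rfl⟩ := hpq
  -- `IsTurn` only says that `u` is parallel and starts as the velocity. The velocity is parallel
  -- too, so uniqueness of transport identifies them.
  have huγ : ∀ t ∈ J, velocity γ t = u t := by
    intro t ht
    have := eqOn_of_isGeodesicOn hJ hJc hγ hu hγ hγ.2 h0J (by rw [hu0]) ht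
    simp only [TotalSpace.mk_inj] at this
    exact (congrArg Prod.snd this).symm
  have hsub : ∀ {K : Set ℝ}, K ⊆ J → ∀ {V : Π t : ℝ, TangentSpace 𝓘(ℝ, E) (γ t)},
      IsParallelOn cov γ V J → IsParallelOn cov γ V K := fun hK _ hV ↦
    ⟨hV.1.mono hK, fun t ht ↦ hV.2 t (hK ht)⟩
  have hsub' : ∀ {γ : ℝ → M} {K : Set ℝ}, K ⊆ Ioo (-a) a →
      ∀ {V : Π t : ℝ, TangentSpace 𝓘(ℝ, E) (γ t)},
      IsParallelOn cov γ V (Ioo (-a) a) → IsParallelOn cov γ V K := fun hK _ hV ↦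
    ⟨hV.1.mono hK, fun t ht ↦ hV.2 t (hK ht)⟩
  have key : ∀ t₀ ∈ J ∩ Ioo (-a) a, (⟨γ t₀, (u t₀, v t₀)⟩ : Triple E M) = tripleMk x₀ (ψ t₀ z) →
      ∀ t ∈ J ∩ Ioo (-a) a, (⟨γ t, (u t, v t)⟩ : Triple E M) = tripleMk x₀ (ψ t z) := by
    intro t₀ ht₀ heq t ht
    have := eqOn_of_isGeodesicOn (hJ.inter isOpen_Ioo) (hJc.inter ordConnected_Ioo)
      ⟨hγ.1.mono inter_subset_left, hsub inter_subset_left hγ.2⟩ (hsub inter_subset_left hv)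
      ⟨h1.1.mono inter_subset_right, hsub' inter_subset_right h1.2⟩ (hsub' inter_subset_right h3)
      ht₀ (by rw [huγ t₀ ht₀.1, h4 t₀ ht₀.2]; exact heq) ht
    simp only [huγ t ht.1, h4 t ht.2] at this
    exact this
  have hq : (⟨γ s, (v s, -u s)⟩ : Triple E M) = turnTriple ⟨γ s, (u s, v s)⟩ := rfl
  rw [hq, ← turnTriple_tripleMk, turnTriple_injective.eq_iff]
  constructor
  · intro hp
    exact key 0 ⟨h0J, h0⟩ (by rw [hp, hψ.zero z hz]) s ⟨hsJ, hs⟩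
  · intro hp
    have := key s ⟨hsJ, hs⟩ hp 0 ⟨h0J, h0⟩
    rwa [hψ.zero z hz] at this

end Turns

/-! ### The congruences on the manifold. -/

section Congruences

universe u

variable {E : Type u} [NormedAddCommGroup E] [NormedSpace ℝ E] [FiniteDimensional ℝ E]
  {M : Type*} [TopologicalSpace M] [T2Space M] [ChartedSpace E M] [IsManifold 𝓘(ℝ, E) ∞ M]

theorem exists_turn_congruences
    (cov : CovariantDerivative 𝓘(ℝ, E) E (TangentSpace 𝓘(ℝ, E) : M → Type _))
    [CovariantDerivative.ContMDiffCovariantDerivative cov ∞]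
    (x : M) (ux vx : TangentSpace 𝓘(ℝ, E) x) {U : Set M} {f : M → ℝ} (hU : IsOpen U) (hx : x ∈ U)
    (hf : ContMDiffOn 𝓘(ℝ, E) 𝓘(ℝ, ℝ) ∞ f U) :
    ∃ (a : ℝ) (W : Set (Triple E M)) (Φ : ℤ → ℝ × Triple E M → Triple E M),
      0 < a ∧ IsOpen W ∧ (⟨x, (ux, vx)⟩ : Triple E M) ∈ W ∧
      (∀ i ∈ Icc (-2 : ℤ) 4,
        ContMDiffOn (𝓘(ℝ, ℝ).prod (𝓘(ℝ, E).prod 𝓘(ℝ, E × E)))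
          (𝓘(ℝ, E).prod 𝓘(ℝ, E × E)) ∞ (Φ i) (Ioo (-a) a ×ˢ W)) ∧
      (∀ s ∈ Ioo (-a) a, ∀ p ∈ W,
        IsTurnOrbit cov s p (fun i ↦ Φ i (s, p)) ∧
        (∀ c : ℤ → Triple E M, IsTurnOrbit cov s p c → ∀ i ∈ Icc (-2 : ℤ) 4, c i = Φ i (s, p)) ∧
        ∀ i ∈ Icc (-2 : ℤ) 4, (Φ i (s, p)).proj ∈ U) ∧
      CongrMod 3 (Ioo (-a) a ×ˢ W) (fun z ↦ f (Φ 2 z).proj - f (Φ (-2) z).proj)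
        (fun z ↦ -(z.1 ^ 2 * dirDeriv f z.2.proj
          (cov.torsion z.2.proj z.2.snd.1 z.2.snd.2))) ∧
      CongrMod 3 (Ioo (-a) a ×ˢ W) (fun z ↦ f (Φ 4 z).proj - f z.2.proj)
        (fun z ↦ -(z.1 ^ 2 * dirDeriv f z.2.proj
          (cov.torsion z.2.proj z.2.snd.1 z.2.snd.2))) ∧
      ((∀ y : M, cov.torsion y = 0) →
        CongrMod 4 (Ioo (-a) a ×ˢ W) (fun z ↦ f (Φ (-2) z).proj - f (Φ 2 z).proj)
          (fun z ↦ 1 / 2 * z.1 ^ 3 * dirDeriv f z.2.proj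
            (curvature cov z.2.proj z.2.snd.1 z.2.snd.2 (z.2.snd.1 + z.2.snd.2))) ∧
        CongrMod 4 (Ioo (-a) a ×ˢ W) (fun z ↦ f (Φ 4 z).proj - f z.2.proj)
          (fun z ↦ 1 / 2 * z.1 ^ 3 * dirDeriv f z.2.proj
            (curvature cov z.2.proj z.2.snd.1 z.2.snd.2 (z.2.snd.1 + z.2.snd.2)))) := by
  obtain ⟨Γ, hΓ⟩ := exists_isChristoffel cov x
  have hxx : x ∈ (chartAt E x).source := mem_chart_source E x
  have hφo := (chartAt E x).isOpen_inter_preimage_symm hU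
  have hφx : chartAt E x x ∈ (chartAt E x).target ∩ (chartAt E x).symm ⁻¹' U :=
    ⟨(chartAt E x).map_source hxx, by rwa [mem_preimage, (chartAt E x).left_inv hxx]⟩
  -- A ball is chosen because the difference quotient of `f` requires a convex domain.
  obtain ⟨ε, hε, hball⟩ := Metric.isOpen_iff.1 hφo _ hφx
  set B := Metric.ball (chartAt E x x) ε with hB
  set g : E → ℝ := f ∘ (chartAt E x).symm with hgdef
  have hg : ContDiffOn ℝ ∞ g B := by
    refine ((contMDiffOn_iff_comp_symm (x₀ := x) inter_subset_left).1
      (hf.mono (inter_subset_right (s := (chartAt E x).source)))).mono fun ξ hξ ↦ ?_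
    exact ⟨(chartAt E x).symm ξ, ⟨(chartAt E x).map_target (hball hξ).1, (hball hξ).2⟩,
      (chartAt E x).right_inv (hball hξ).1⟩
  obtain ⟨a, b, N, W, ψ, hb, hba, hψ, hN', hW, hzW, hD, ⟨g₁, hg₁, hC₁⟩, ⟨g₂, hg₂, hC₂⟩, hC⟩ :=
    exists_coordinate_congruences (chartAt E x).open_target hΓ.contDiffOn hφx.1
      (tanCoord x x ux) (tanCoord x x vx) Metric.isOpen_ball (convex_ball _ _)
      (Metric.mem_ball_self hε) hg
  obtain ⟨hsp, hstep⟩ := hψ.turnIter_spec (chartAt E x).open_target hΓ.contDiffOn hN' hD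
  have h0b : (0 : ℝ) ∈ Ioo (-b) b := ⟨by linarith, hb⟩
  have hsub : Ioo (-b) b ⊆ Ioo (-a) a := Ioo_subset_Ioo (by linarith) hba
  have hWB : ∀ z ∈ W, z.1 ∈ B := fun z hz ↦ ((hsp 0 (by simp)).2 (0, z) ⟨h0b, hz⟩).2
  set W' : Set (Triple E M) := {p | p.proj ∈ (chartAt E x).source} ∩ tripleCoord x ⁻¹' W with hW'
  have hW'o : IsOpen W' :=
    (contMDiffOn_tripleCoord x).continuousOn.isOpen_inter_preimage (isOpen_proj_mem x) hW
  have hκ : ContMDiffOn (𝓘(ℝ, ℝ).prod (𝓘(ℝ, E).prod 𝓘(ℝ, E × E))) 𝓘(ℝ, ℝ × (E × (E × E))) ∞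
      (fun p : ℝ × Triple E M ↦ (p.1, tripleCoord x p.2)) (Ioo (-b) b ×ˢ W') :=
    contMDiffOn_fst.prodMk_space ((contMDiffOn_tripleCoord x).comp contMDiffOn_snd
      fun p hp ↦ hp.2.1)
  have hκm : ∀ p ∈ Ioo (-b) b ×ˢ W', (p.1, tripleCoord x p.2) ∈ Ioo (-b) b ×ˢ W :=
    fun p hp ↦ ⟨hp.1, hp.2.2⟩
  have hcm : ∀ {k : ℕ} {H₁ H₂ G : ℝ × (E × (E × E)) → ℝ} {h₁ h₂ : ℝ × Triple E M → ℝ},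
      ContDiffOn ℝ ∞ H₁ (Ioo (-b) b ×ˢ W) → ContDiffOn ℝ ∞ H₂ (Ioo (-b) b ×ˢ W) →
      ContDiffOn ℝ ∞ G (Ioo (-b) b ×ˢ W) →
      (∀ p ∈ Ioo (-b) b ×ˢ W', h₁ p = H₁ (p.1, tripleCoord x p.2)) →
      (∀ p ∈ Ioo (-b) b ×ˢ W', h₂ p = H₂ (p.1, tripleCoord x p.2)) →
      (∀ s ∈ Ioo (-b) b, ∀ z ∈ W, H₁ (s, z) - H₂ (s, z) = s ^ k * G (s, z)) →
      CongrMod k (Ioo (-b) b ×ˢ W') h₁ h₂ := by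
    intro k H₁ H₂ G h₁ h₂ hH₁ hH₂ hG e₁ e₂ e
    refine ⟨(hH₁.contMDiffOn.comp hκ hκm).congr e₁, (hH₂.contMDiffOn.comp hκ hκm).congr e₂, _,
      hG.contMDiffOn.comp hκ hκm, fun p hp ↦ ?_⟩
    rw [e₁ p hp, e₂ p hp, e _ hp.1 _ hp.2.2]
    rfl
  have hgiter : ∀ i ∈ Icc (-2 : ℤ) 4, ContDiffOn ℝ ∞ (fun p ↦ g (turnIter ψ i p).1)
      (Ioo (-b) b ×ˢ W) := fun i hi ↦
    hg.comp (hsp i hi).1.fst fun p hp ↦ ((hsp i hi).2 p hp).2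
  have hgfst : ContDiffOn ℝ ∞ (fun p : ℝ × (E × (E × E)) ↦ g p.2.1) (Ioo (-b) b ×ˢ W) :=
    hg.comp (by fun_prop) fun p hp ↦ hWB _ hp.2
  have hdg : ∀ {c : E × (E × E) → E}, ContDiffOn ℝ ∞ c (Prod.fst ⁻¹' (chartAt E x).target) →
      ContDiffOn ℝ ∞ (fun p : ℝ × (E × (E × E)) ↦ fderiv ℝ g p.2.1 (c p.2))
        (Ioo (-b) b ×ˢ W) := by
    intro c hc
    refine ContDiffOn.clm_apply ((hg.fderiv_of_isOpen Metric.isOpen_ball (m := ∞) (by simp)).comp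
      (f := fun p : ℝ × (E × (E × E)) ↦ p.2.1) (by fun_prop) fun p hp ↦ hWB _ hp.2)
      (hc.comp contDiffOn_snd fun p hp ↦ (hball (hWB _ hp.2)).1)
  have hbase : ∀ p ∈ W', f p.proj = g (tripleCoord x p).1 := fun p hp ↦ by
    simp only [hgdef, tripleCoord, Function.comp_apply]
    rw [(chartAt E x).left_inv hp.1]
  have hdir : ∀ p ∈ W', ∀ X : TangentSpace 𝓘(ℝ, E) p.proj,
      dirDeriv f p.proj X = fderiv ℝ g (tripleCoord x p).1 (tanCoord x p.proj X) := by
    intro p hp X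
    have hpU : p.proj ∈ U := by
      have := (hball (hWB _ hp.2)).2
      rwa [mem_preimage, tripleCoord, (chartAt E x).left_inv hp.1] at this
    exact dirDeriv_eq_fderiv hp.1
      ((hf.contMDiffAt (hU.mem_nhds hpU)).mdifferentiableAt (by simp)) X
  have htor : ∀ p ∈ Ioo (-b) b ×ˢ W', -(p.1 ^ 2 * dirDeriv f p.2.proj
      (cov.torsion p.2.proj p.2.snd.1 p.2.snd.2)) = -(p.1 ^ 2 *
        fderiv ℝ g (tripleCoord x p.2).1 (coordTorsion Γ (tripleCoord x p.2))) := fun p hp ↦ by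
    rw [hdir _ hp.2, hΓ.tanCoord_torsion hp.2.1]
    rfl
  have htor' : ContDiffOn ℝ ∞ (fun p : ℝ × (E × (E × E)) ↦ -(p.1 ^ 2 *
      fderiv ℝ g p.2.1 (coordTorsion Γ p.2))) (Ioo (-b) b ×ˢ W) :=
    ((contDiffOn_fst.pow 2).mul (hdg (contDiffOn_coordTorsion hΓ.contDiffOn))).neg
  refine ⟨b, W', fun i p ↦ tripleMk x (turnIter ψ i (p.1, tripleCoord x p.2)), hb, hW'o,
    ⟨hxx, hzW⟩, fun i hi ↦ ?_, fun s hs p hp ↦ ⟨⟨tripleMk_tripleCoord hp.1, fun i hi hi' ↦ ?_⟩,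
    fun c hc ↦ ?_, fun i hi ↦ ?_⟩, ?_, ?_, fun hT ↦ ?_⟩
  · have ht : ∀ p ∈ Ioo (-b) b ×ˢ W', (turnIter ψ i (p.1, tripleCoord x p.2)).1 ∈
        (chartAt E x).target := fun p hp ↦ (hball ((hsp i hi).2 _ (hκm p hp)).2).1
    refine (contMDiffOn_triple_iff (x₀ := x) fun p hp ↦ tripleMk_proj_mem (ht p hp)).2 ?_
    refine ((hsp i hi).1.contMDiffOn.comp hκ hκm).congr fun p hp ↦ ?_
    exact tripleCoord_tripleMk (ht p hp)
  · have hp' := hκm (s, p) ⟨hs, hp⟩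
    change IsTurn cov s (tripleMk x _) (tripleMk x (turnIter ψ (i + 1) (s, tripleCoord x p)))
    rw [hstep i hi hi' _ hp']
    exact hΓ.isTurn_tripleMk hψ ((hsp i ⟨hi, hi'.le⟩).2 _ hp').1 (hsub hs)
  · have hp' := hκm (s, p) ⟨hs, hp⟩
    -- The equivalence carries agreement in both directions from index `0`: forward to `4`, and
    -- backward to `-2` by uniqueness of the inverse turn.
    have hiff : ∀ i : ℤ, -2 ≤ i → i < 4 →
        (c i = tripleMk x (turnIter ψ i (s, tripleCoord x p)) ↔
          c (i + 1) = tripleMk x (turnIter ψ (i + 1) (s, tripleCoord x p))) := fun i hi hi' ↦ by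
      rw [hstep i hi hi' _ hp']
      exact hΓ.eq_tripleMk_iff hψ ((hsp i ⟨hi, hi'.le⟩).2 _ hp').1 (hsub hs) (hc.2 i hi hi')
    have h0 : c 0 = tripleMk x (turnIter ψ 0 (s, tripleCoord x p)) := by
      rw [hc.1]
      exact (tripleMk_tripleCoord hp.1).symm
    have h1 := (hiff 0 (by norm_num) (by norm_num)).1 h0
    have h2 := (hiff 1 (by norm_num) (by norm_num)).1 h1
    have h3 := (hiff 2 (by norm_num) (by norm_num)).1 h2
    have h4 := (hiff 3 (by norm_num) (by norm_num)).1 h3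
    have h5 := (hiff (-1) (by norm_num) (by norm_num)).2 (by rwa [neg_add_cancel])
    have h6 := (hiff (-2) (by norm_num) (by norm_num)).2
      (by rwa [show (-2 : ℤ) + 1 = -1 by norm_num])
    rintro i ⟨hi, hi'⟩
    interval_cases i
    exacts [h6, h5, h0, h1, h2, h3, h4]
  · exact (hball ((hsp i hi).2 _ (hκm (s, p) ⟨hs, hp⟩)).2).2
  · refine hcm ((hgiter 2 (by simp)).sub (hgiter (-2) (by simp))) htor' hg₁ (fun p hp ↦ rfl) htor
      fun s hs z hz ↦ ?_
    simp only [hC₁ s hs z hz, map_neg]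
    ring
  · refine hcm ((hgiter 4 (by simp)).sub hgfst) htor' hg₂ (fun p hp ↦ ?_) htor
      fun s hs z hz ↦ ?_
    · rw [hbase _ hp.2]
      rfl
    · simp only [hC₂ s hs z hz, map_neg]
      ring
  · obtain ⟨⟨g₃, hg₃, hC₃⟩, ⟨g₄, hg₄, hC₄⟩⟩ := hC (hΓ.symm hT)
    have hcur : ∀ p ∈ Ioo (-b) b ×ˢ W', 1 / 2 * p.1 ^ 3 * dirDeriv f p.2.proj
        (curvature cov p.2.proj p.2.snd.1 p.2.snd.2 (p.2.snd.1 + p.2.snd.2)) =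
        1 / 2 * p.1 ^ 3 * fderiv ℝ g (tripleCoord x p.2).1
          (coordCurvature Γ (tripleCoord x p.2).1 (tripleCoord x p.2).2.1 (tripleCoord x p.2).2.2
            ((tripleCoord x p.2).2.1 + (tripleCoord x p.2).2.2)) := fun p hp ↦ by
      rw [hdir _ hp.2, hΓ.tanCoord_curvature hT hp.2.1, map_add]
      rfl
    have hcur' : ContDiffOn ℝ ∞ (fun p : ℝ × (E × (E × E)) ↦ 1 / 2 * p.1 ^ 3 *
        fderiv ℝ g p.2.1 (coordCurvature Γ p.2.1 p.2.2.1 p.2.2.2 (p.2.2.1 + p.2.2.2)))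
        (Ioo (-b) b ×ˢ W) :=
      (contDiffOn_const.mul (contDiffOn_fst.pow 3)).mul
        (hdg (contDiffOn_coordCurvature (chartAt E x).open_target hΓ.contDiffOn))
    constructor
    · refine hcm ((hgiter (-2) (by simp)).sub (hgiter 2 (by simp))) hcur' hg₃.neg
        (fun p hp ↦ rfl) hcur fun s hs z hz ↦ ?_
      have e := hC₃ s hs z hz
      simp only [map_neg, map_smul, smul_eq_mul] at e
      dsimp only
      linear_combination -e
    · refine hcm ((hgiter 4 (by simp)).sub hgfst) hcur' hg₄ (fun p hp ↦ ?_) hcur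
        fun s hs z hz ↦ ?_
      · rw [hbase _ hp.2]
        rfl
      · simp only [hC₄ s hs z hz, map_smul, smul_eq_mul]
        ring

end Congruences

/-! ### From congruences to limits. -/

section Limits

universe u

variable {E : Type u} [NormedAddCommGroup E] [NormedSpace ℝ E]
  {M : Type*} [TopologicalSpace M] [ChartedSpace E M]

lemma tendsto_of_forall_continuousLinearMap {F ι : Type*} [NormedAddCommGroup F] [NormedSpace ℝ F]
    [FiniteDimensional ℝ F] {g : ι → F} {l : Filter ι} {y : F}
    (h : ∀ L : F →L[ℝ] ℝ, Tendsto (fun i ↦ L (g i)) l (𝓝 (L y))) : Tendsto g l (𝓝 y) := by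
  set e := (Module.finBasis ℝ F).equivFunL
  have h1 : Tendsto (fun i ↦ e (g i)) l (𝓝 (e y)) := tendsto_pi_nhds.2 fun j ↦
    h ((ContinuousLinearMap.proj j).comp (e : F →L[ℝ] Fin (Module.finrank ℝ F) → ℝ))
  simpa [Function.comp_def] using (e.symm.continuous.tendsto (e y)).comp h1

section

variable [IsManifold 𝓘(ℝ, E) ∞ M]

lemma dirDeriv_clm_comp {F : Type*} [NormedAddCommGroup F] [NormedSpace ℝ F] {f : M → F} {x : M}
    (hf : MDifferentiableAt 𝓘(ℝ, E) 𝓘(ℝ, F) f x) (L : F →L[ℝ] ℝ) (X : TangentSpace 𝓘(ℝ, E) x) :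
    dirDeriv (fun y ↦ L (f y)) x X = L (dirDeriv f x X) := by
  have hx := mem_chart_source E x
  have hf' := (mdifferentiableAt_iff_comp_symm hx).1 hf
  have hL := L.hasFDerivAt.comp _ hf'.hasFDerivAt
  rw [dirDeriv_eq_fderiv hx hf, dirDeriv_eq_fderiv hx
    ((mdifferentiableAt_iff_comp_symm hx).2 hL.differentiableAt)]
  exact congr($hL.fderiv (tanCoord x x X))

/-- For fixed `p`, division by `s ^ k` leaves `d + s g(s, p)`, and `g` is continuous at `s = 0`. -/
lemma CongrMod.tendsto {a : ℝ} (ha : 0 < a) {W : Set (Triple E M)} (hW : IsOpen W) {k : ℕ}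
    {h₁ h₂ : ℝ × Triple E M → ℝ} (h : CongrMod (k + 1) (Ioo (-a) a ×ˢ W) h₁ h₂) {p : Triple E M}
    (hp : p ∈ W) {d : ℝ} (hd : ∀ s, h₂ (s, p) = s ^ k * d) {q : ℝ → ℝ}
    (hq : ∀ᶠ s in 𝓝[≠] 0, q s = h₁ (s, p)) :
    Tendsto (fun s ↦ (s ^ k)⁻¹ * q s) (𝓝[≠] 0) (𝓝 d) := by
  obtain ⟨-, -, g, hg, hg'⟩ := h
  have h0 : ((0 : ℝ), p) ∈ Ioo (-a) a ×ˢ W := ⟨⟨by linarith, ha⟩, hp⟩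
  have hgc : ContinuousAt (fun s : ℝ ↦ g (s, p)) 0 :=
    ContinuousAt.comp (f := fun s : ℝ ↦ (s, p))
      (hg.continuousOn.continuousAt ((isOpen_Ioo.prod hW).mem_nhds h0)) (by fun_prop)
  have hlim : Tendsto (fun s : ℝ ↦ d + s * g (s, p)) (𝓝 0) (𝓝 (d + 0 * g (0, p))) :=
    tendsto_const_nhds.add (tendsto_id.mul hgc)
  rw [zero_mul, add_zero] at hlim
  refine (hlim.mono_left nhdsWithin_le_nhds).congr' ?_
  filter_upwards [hq, self_mem_nhdsWithin,
    nhdsWithin_le_nhds (isOpen_Ioo.mem_nhds h0.1)] with s hs hs0 hsa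
  have hs0' : s ≠ 0 := hs0
  have := hg' (s, p) ⟨hsa, hp⟩
  rw [hd s] at this
  rw [hs, eq_inv_mul_iff_mul_eq₀ (pow_ne_zero k hs0')]
  simp only at this
  linear_combination -this

end

variable [FiniteDimensional ℝ E] [T2Space M] [IsManifold 𝓘(ℝ, E) ∞ M]
  (cov : CovariantDerivative 𝓘(ℝ, E) E (TangentSpace 𝓘(ℝ, E) : M → Type _))
  [CovariantDerivative.ContMDiffCovariantDerivative cov ∞]

theorem eventually_exists_isTurnOrbit (P₀ : M) (u v : TangentSpace 𝓘(ℝ, E) P₀) :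
    ∀ᶠ s : ℝ in 𝓝 0, ∃ c : ℤ → Triple E M, IsTurnOrbit cov s ⟨P₀, (u, v)⟩ c := by
  obtain ⟨a, W, Φ, ha, -, hp, -, hΦ, -⟩ := exists_turn_congruences cov P₀ u v isOpen_univ
    (mem_univ P₀) (f := fun _ ↦ 0) contMDiffOn_const
  filter_upwards [isOpen_Ioo.mem_nhds (show (0 : ℝ) ∈ Ioo (-a) a from ⟨by linarith, ha⟩)] with s hs
  exact ⟨_, (hΦ s hs _ hp).1⟩

theorem tendsto_gap {P₀ : M} {u v : TangentSpace 𝓘(ℝ, E) P₀} {F : Type*} [NormedAddCommGroup F]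
    [NormedSpace ℝ F] [FiniteDimensional ℝ F] {U : Set M} {f : M → F} (hU : IsOpen U)
    (hP : P₀ ∈ U) (hf : ContMDiffOn 𝓘(ℝ, E) 𝓘(ℝ, F) ∞ f U) {c : ℝ → ℤ → Triple E M}
    (hc : ∀ᶠ s : ℝ in 𝓝[≠] 0, IsTurnOrbit cov s ⟨P₀, (u, v)⟩ (c s)) :
    Tendsto (fun s : ℝ ↦ (s ^ 2)⁻¹ • (f (c s 4).proj - f P₀)) (𝓝[≠] 0)
      (𝓝 (dirDeriv f P₀ (-cov.torsion P₀ u v))) ∧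
    Tendsto (fun s : ℝ ↦ (s ^ 2)⁻¹ • (f (c s 2).proj - f (c s (-2)).proj)) (𝓝[≠] 0)
      (𝓝 (dirDeriv f P₀ (-cov.torsion P₀ u v))) ∧
    ((∀ y : M, cov.torsion y = 0) →
      Tendsto (fun s : ℝ ↦ (s ^ 3)⁻¹ • (f (c s 4).proj - f P₀)) (𝓝[≠] 0)
        (𝓝 (dirDeriv f P₀ ((1 / 2 : ℝ) • curvature cov P₀ u v (u + v)))) ∧
      Tendsto (fun s : ℝ ↦ (s ^ 3)⁻¹ • (f (c s (-2)).proj - f (c s 2).proj)) (𝓝[≠] 0)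
        (𝓝 (dirDeriv f P₀ ((1 / 2 : ℝ) • curvature cov P₀ u v (u + v))))) := by
  have hfP := (hf.contMDiffAt (hU.mem_nhds hP)).mdifferentiableAt (by simp)
  -- The congruences hold for real functions, so they are applied to each `L ∘ f`. The interval,
  -- neighbourhood and maps `Φ L` depend on `L`; uniqueness of orbits makes all of them agree with
  -- the given `c` for small `s ≠ 0`.
  have hB := fun L : F →L[ℝ] ℝ ↦ exists_turn_congruences cov P₀ u v hU hP
    (f := fun y ↦ L (f y)) (L.contDiff.contMDiff.comp_contMDiffOn hf)
  choose a W Φ ha hW hp _ hΦ hC₁ hC₂ hC using hB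
  have hceq : ∀ L : F →L[ℝ] ℝ, ∀ᶠ s : ℝ in 𝓝[≠] 0, ∀ i ∈ Icc (-2 : ℤ) 4,
      c s i = Φ L i (s, ⟨P₀, (u, v)⟩) := fun L ↦ by
    filter_upwards [hc, nhdsWithin_le_nhds (isOpen_Ioo.mem_nhds
      (show (0 : ℝ) ∈ Ioo (-a L) (a L) from ⟨by linarith [ha L], ha L⟩))] with s hs hsa
    exact (hΦ L s hsa _ (hp L)).2.1 _ hs
  have hneg : ∀ (L : F →L[ℝ] ℝ) (X : TangentSpace 𝓘(ℝ, E) P₀),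
      dirDeriv (fun y ↦ L (f y)) P₀ (-X) = -dirDeriv (fun y ↦ L (f y)) P₀ X :=
    fun L X ↦ map_neg (mvfderiv 𝓘(ℝ, E) (fun y ↦ L (f y)) P₀) X
  have hsmul : ∀ (L : F →L[ℝ] ℝ) (X : TangentSpace 𝓘(ℝ, E) P₀),
      dirDeriv (fun y ↦ L (f y)) P₀ ((1 / 2 : ℝ) • X) = 1 / 2 * dirDeriv (fun y ↦ L (f y)) P₀ X :=
    fun L X ↦ map_smul (mvfderiv 𝓘(ℝ, E) (fun y ↦ L (f y)) P₀) _ X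
  refine ⟨?_, ?_, fun hT ↦ ⟨?_, ?_⟩⟩ <;> refine tendsto_of_forall_continuousLinearMap fun L ↦ ?_ <;>
    simp only [map_smul, map_sub, smul_eq_mul, ← dirDeriv_clm_comp hfP L]
  · refine (hC₂ L).tendsto (ha L) (hW L) (hp L) (fun s ↦ ?_) ?_
    · rw [hneg]
      ring
    · filter_upwards [hceq L] with s hs
      rw [hs 4 (by simp)]
  · refine (hC₁ L).tendsto (ha L) (hW L) (hp L) (fun s ↦ ?_) ?_
    · rw [hneg]
      ring
    · filter_upwards [hceq L] with s hs
      rw [hs 2 (by simp), hs (-2) (by simp)]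
  · refine (hC L hT).2.tendsto (ha L) (hW L) (hp L) (fun s ↦ ?_) ?_
    · rw [hsmul]
      ring
    · filter_upwards [hceq L] with s hs
      rw [hs 4 (by simp)]
  · refine (hC L hT).1.tendsto (ha L) (hW L) (hp L) (fun s ↦ ?_) ?_
    · rw [hsmul]
      ring
    · filter_upwards [hceq L] with s hs
      rw [hs 2 (by simp), hs (-2) (by simp)]

end Limits

end GeodesicGap

end

theorem theorem1 {E : Type*} [NormedAddCommGroup E] [NormedSpace ℝ E] [FiniteDimensional ℝ E]
    {M : Type*} [TopologicalSpace M] [T2Space M] [ChartedSpace E M] [IsManifold 𝓘(ℝ, E) ∞ M]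
    (cov : CovariantDerivative 𝓘(ℝ, E) E (TangentSpace 𝓘(ℝ, E) : M → Type _))
    [CovariantDerivative.ContMDiffCovariantDerivative cov ∞] :
    -- the limits, for a fixed triple `(P₀, u, v)`
    (∀ (P₀ : M) (u v : TangentSpace 𝓘(ℝ, E) P₀),
      (∀ᶠ s : ℝ in 𝓝 0, ∃ c : ℤ → GeodesicGap.Triple E M,
        GeodesicGap.IsTurnOrbit cov s ⟨P₀, (u, v)⟩ c) ∧
      ∀ (F : Type) [NormedAddCommGroup F] [NormedSpace ℝ F] [FiniteDimensional ℝ F]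
        (U : Set M) (f : M → F), IsOpen U → P₀ ∈ U →
        ContMDiffOn 𝓘(ℝ, E) 𝓘(ℝ, F) ∞ f U →
        ∀ c : ℝ → ℤ → GeodesicGap.Triple E M,
        (∀ᶠ s : ℝ in 𝓝[≠] 0, GeodesicGap.IsTurnOrbit cov s ⟨P₀, (u, v)⟩ (c s)) →
          Tendsto (fun s : ℝ ↦ (s ^ 2)⁻¹ • (f (c s 4).proj - f P₀)) (𝓝[≠] 0)
            (𝓝 (GeodesicGap.dirDeriv f P₀ (-cov.torsion P₀ u v))) ∧
          Tendsto (fun s : ℝ ↦ (s ^ 2)⁻¹ • (f (c s 2).proj - f (c s (-2)).proj)) (𝓝[≠] 0)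
            (𝓝 (GeodesicGap.dirDeriv f P₀ (-cov.torsion P₀ u v))) ∧
          ((∀ y : M, cov.torsion y = 0) →
            Tendsto (fun s : ℝ ↦ (s ^ 3)⁻¹ • (f (c s 4).proj - f P₀)) (𝓝[≠] 0)
              (𝓝 (GeodesicGap.dirDeriv f P₀
                ((1 / 2 : ℝ) • GeodesicGap.curvature cov P₀ u v (u + v)))) ∧
            Tendsto (fun s : ℝ ↦ (s ^ 3)⁻¹ • (f (c s (-2)).proj - f (c s 2).proj)) (𝓝[≠] 0)
              (𝓝 (GeodesicGap.dirDeriv f P₀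
                ((1 / 2 : ℝ) • GeodesicGap.curvature cov P₀ u v (u + v)))))) ∧
    -- the congruences, for `(P₀, u₀, v₀)` varying in a neighbourhood of `(x, uₓ, vₓ)`
    (∀ (x : M) (ux vx : TangentSpace 𝓘(ℝ, E) x) (U : Set M) (f : M → ℝ),
      IsOpen U → x ∈ U → ContMDiffOn 𝓘(ℝ, E) 𝓘(ℝ, ℝ) ∞ f U →
      ∃ (a : ℝ) (W : Set (GeodesicGap.Triple E M))
        (Φ : ℤ → ℝ × GeodesicGap.Triple E M → GeodesicGap.Triple E M),
        0 < a ∧ IsOpen W ∧ (⟨x, (ux, vx)⟩ : GeodesicGap.Triple E M) ∈ W ∧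
        -- the iterates `Φ i (s, p) = (𝕋_s)^i p` are defined, unique, smooth, and lie over `U`
        (∀ i ∈ Icc (-2 : ℤ) 4,
          ContMDiffOn (𝓘(ℝ, ℝ).prod (𝓘(ℝ, E).prod 𝓘(ℝ, E × E)))
            (𝓘(ℝ, E).prod 𝓘(ℝ, E × E)) ∞ (Φ i) (Ioo (-a) a ×ˢ W)) ∧
        (∀ s ∈ Ioo (-a) a, ∀ p ∈ W,
          GeodesicGap.IsTurnOrbit cov s p (fun i ↦ Φ i (s, p)) ∧
          (∀ c : ℤ → GeodesicGap.Triple E M, GeodesicGap.IsTurnOrbit cov s p c →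
            ∀ i ∈ Icc (-2 : ℤ) 4, c i = Φ i (s, p)) ∧
          ∀ i ∈ Icc (-2 : ℤ) 4, (Φ i (s, p)).proj ∈ U) ∧
        GeodesicGap.CongrMod 3 (Ioo (-a) a ×ˢ W)
          (fun z ↦ f (Φ 2 z).proj - f (Φ (-2) z).proj)
          (fun z ↦ -(z.1 ^ 2 * GeodesicGap.dirDeriv f z.2.proj
            (cov.torsion z.2.proj z.2.snd.1 z.2.snd.2))) ∧
        GeodesicGap.CongrMod 3 (Ioo (-a) a ×ˢ W)
          (fun z ↦ f (Φ 4 z).proj - f z.2.proj)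
          (fun z ↦ -(z.1 ^ 2 * GeodesicGap.dirDeriv f z.2.proj
            (cov.torsion z.2.proj z.2.snd.1 z.2.snd.2))) ∧
        ((∀ y : M, cov.torsion y = 0) →
          GeodesicGap.CongrMod 4 (Ioo (-a) a ×ˢ W)
            (fun z ↦ f (Φ (-2) z).proj - f (Φ 2 z).proj)
            (fun z ↦ 1 / 2 * z.1 ^ 3 * GeodesicGap.dirDeriv f z.2.proj
              (GeodesicGap.curvature cov z.2.proj z.2.snd.1 z.2.snd.2
                (z.2.snd.1 + z.2.snd.2))) ∧
          GeodesicGap.CongrMod 4 (Ioo (-a) a ×ˢ W)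
            (fun z ↦ f (Φ 4 z).proj - f z.2.proj)
            (fun z ↦ 1 / 2 * z.1 ^ 3 * GeodesicGap.dirDeriv f z.2.proj
              (GeodesicGap.curvature cov z.2.proj z.2.snd.1 z.2.snd.2
                (z.2.snd.1 + z.2.snd.2))))) :=
  ⟨fun P₀ u v ↦ ⟨GeodesicGap.eventually_exists_isTurnOrbit cov P₀ u v,
    fun _ _ _ _ _ _ hU hP hf _ hc ↦ GeodesicGap.tendsto_gap cov hU hP hf hc⟩,
    fun x ux vx _ _ hU hx hf ↦ GeodesicGap.exists_turn_congruences cov x ux vx hU hx hf⟩
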